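/- Let $M$ be a compact smooth manifold with smooth boundary, $\dim M\ge 1$. For $j=1,2$ let $P_j=\frac1i L_j+V_j$, where $L_j$ is a smooth real vector field on $M$ and $V_j\in C^\infty(M,\mathbb C)$, and let $p_j(x,\xi)=\xi(L_j(x))$ be its principal symbol on $T^*M$. A null bicharacteristic of $P_j$ is an integral curve of the Hamilton vector field of $p_j$ in $\mathrm{Char}(P_j)=\{(x,\xi)\in T^*M\setminus 0 : p_j(x,\xi)=0\}$. For $z\in\mathrm{Char}(P_j)$ let $[-\tau_-(z),\tau_+(z)]$, $\tau_\pm(z)\in[0,\infty]$, be the maximal interval on which the null bicharacteristic $\gamma_z$ with $\gamma_z(0)=z$ exists in $T^*M\setminus 0$. Assume that $P_1,P_2$ are of real principal type, i.e. $\tau_\pm(z)<\infty$ for all $z\in\mathrm{Char}(P_j)$. Put $\partial^\pm_{\mathrm{null}}=\{z\in\mathrm{Char}(P_j):\tau_\mp(z)=0\}$. The scattering relation $\alpha_{P_j}$ is the map on $\partial^+_{\mathrm{null}}\cup\partial^-_{\mathrm{null}}$ given by $\alpha_{P_j}(z)=\gamma_z(\tau_+(z))$ on $\partial^+_{\mathrm{null}}$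 and $\alpha_{P_j}(z)=\gamma_z(-\tau_-(z))$ on $\partial^-_{\mathrm{null}}$. Assume that $M$ is strictly convex for $L_1$ and for $L_2$: whenever $\rho$ is a boundary defining function ($\rho\ge 0$ on $M$, $\partial M=\{\rho=0\}$, $d\rho\ne0$ on $\partial M$), $x\in\partial M$ and $L_j(x)\in T_x(\partial M)$, one has $\frac{d^2}{dt^2}\rho(x(t))|_{t=0}=L_j(L_j\rho)(x)<0$ for the integral curve $x(t)$ of $L_j$ (extended smoothly beyond $M$) with $x(0)=x$. Suppose that $L_1$ and $L_2$ have the same incoming boundary points (a point of $M$ is the initial point $x_1(0)$ of a maximal integral curve $x_1:[0,T_1]\to M$ of $L_1$ if and only if it is the initial point $x_2(0)$ of a maximal integral curve $x_2:[0,T_2]\to M$ of $L_2$), that $$\alpha_{P_1}=\alpha_{P_2},$$ and that $$\exp\Big[-i\int_0^{T_1}V_1(x_1(t))\,dt\Big]=\exp\Big[-i\int_0^{T_2}V_2(x_2(t))\,dt\Big]$$ whenever $x_j:[0,T_j]\to M$ are maximal integral curves of $L_j$ with $x_1(0)=x_2(0)$. Then the $C^\infty$ Cauchy data sets of $P_1$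 and $P_2$ are equal: $$\{u|_{\partial M} : u\in C^\infty(M),\ P_1u=0 \text{ in } M\}=\{u|_{\partial M} : u\in C^\infty(M),\ P_2u=0\text{ in } M\}.$$ -/

import Mathlib

open Set Filter Topology MeasureTheory
open scoped Manifold ContDiff ENNReal NNReal

noncomputable section

namespace RealPrincipalType

/-! ### Curves: maximality and life times

A class of curves in a set `X` is given by a predicate `C γ J`: "the restriction of `γ : ℝ → X` to
the interval `J` belongs to the class". Values of `γ` outside `J` are irrelevant. -/

section Curves

variable {X : Type*}

/-- `γ : [a, b] → X` is a curve of the class `C` which cannot be extended, as a curve of the class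
`C`, to a strictly larger closed interval. -/
def IsMaximalCurve (C : (ℝ → X) → Set ℝ → Prop) (γ : ℝ → X) (a b : ℝ) : Prop :=
  a ≤ b ∧ C γ (Icc a b) ∧
    ∀ (a' b' : ℝ) (γ' : ℝ → X), a' ≤ a → b ≤ b' → C γ' (Icc a' b') →
      EqOn γ' γ (Icc a b) → a' = a ∧ b' = b

/-- The forward life time `τ₊(z) ∈ [0, ∞]` of the curves of class `C` through `z` at time `0`. -/
def forwardTime (C : (ℝ → X) → Set ℝ → Prop) (z : X) : ℝ≥0∞ :=
  ⨆ (T : ℝ≥0) (_ : ∃ γ : ℝ → X, C γ (Icc 0 (T : ℝ)) ∧ γ 0 = z), (T : ℝ≥0∞)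

/-- The backward life time `τ₋(z) ∈ [0, ∞]` of the curves of class `C` through `z` at time `0`. -/
def backwardTime (C : (ℝ → X) → Set ℝ → Prop) (z : X) : ℝ≥0∞ :=
  ⨆ (T : ℝ≥0) (_ : ∃ γ : ℝ → X, C γ (Icc (-(T : ℝ)) 0) ∧ γ 0 = z), (T : ℝ≥0∞)

end Curves

section Manifold

variable {n : ℕ} [NeZero n]
  (M : Type*) [TopologicalSpace M] [ChartedSpace (EuclideanHalfSpace n) M]

/-- The cotangent bundle `T^*M`: pairs of a point `x` and a covector `ξ ∈ T_x^*M`. -/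
abbrev Cotangent : Type _ :=
  Bundle.TotalSpace (EuclideanSpace ℝ (Fin n) →L[ℝ] ℝ)
    (fun x : M => TangentSpace (𝓡∂ n) x →L[ℝ] ℝ)

variable {M}

/-! ### The Hamilton flow on `T^*M` in local coordinates -/

/-- The momentum coordinates of a covector `ξ ∈ T_x^*M` in the chart `φ` centred at `c`:
the covector `ξ ∘ (dφ⁻¹)_{φ(x)}` on `ℝⁿ`. -/
def momentum (c : M) (z : Cotangent (n := n) M) : EuclideanSpace ℝ (Fin n) →L[ℝ] ℝ :=
  z.2.comp (mfderivWithin 𝓘(ℝ, EuclideanSpace ℝ (Fin n)) (𝓡∂ n) (extChartAt (𝓡∂ n) c).symm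
    (range (𝓡∂ n)) (extChartAt (𝓡∂ n) c z.1))

/-- The point of `T^*M` with position coordinates `y` and momentum coordinates `η` in the chart
`φ` centred at `c`, namely `(φ⁻¹(y), η ∘ dφ)`. -/
def ofCoord (c : M) (y : EuclideanSpace ℝ (Fin n)) (η : EuclideanSpace ℝ (Fin n) →L[ℝ] ℝ) :
    Cotangent (n := n) M :=
  ⟨(extChartAt (𝓡∂ n) c).symm y,
    η.comp (mfderiv (𝓡∂ n) 𝓘(ℝ, EuclideanSpace ℝ (Fin n)) (extChartAt (𝓡∂ n) c)
      ((extChartAt (𝓡∂ n) c).symm y))⟩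

/-- `γ : J → T^*M` is a bicharacteristic curve of `p : T^*M → ℝ`, i.e. an integral curve of the
Hamilton vector field of `p`. In the coordinates `(y, η)` on `T^*M` induced by the chart around the
point `x(t)` this means `y' = ∂_η p`, `η' = -∂_y p` at the time `t`. The first equation is tested
against all covectors `ζ` on `ℝⁿ`. Derivatives at boundary points of `M` and at end points of `J`
are one-sided. -/
structure IsBicharacteristicOn (p : Cotangent (n := n) M → ℝ) (γ : ℝ → Cotangent (n := n) M)
    (J : Set ℝ) : Prop where
  continuousOn_proj : ContinuousOn (fun t => (γ t).1) J
  deriv_position : ∀ t ∈ J, ∀ ζ : EuclideanSpace ℝ (Fin n) →L[ℝ] ℝ,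
    HasDerivWithinAt (fun s => ζ (extChartAt (𝓡∂ n) (γ t).1 (γ s).1))
      (fderiv ℝ (fun η => p (ofCoord (γ t).1 (extChartAt (𝓡∂ n) (γ t).1 (γ t).1) η))
        (momentum (γ t).1 (γ t)) ζ) J t
  deriv_momentum : ∀ t ∈ J,
    HasDerivWithinAt (fun s => momentum (γ t).1 (γ s))
      (-fderivWithin ℝ (fun y => p (ofCoord (γ t).1 y (momentum (γ t).1 (γ t))))
        (range (𝓡∂ n)) (extChartAt (𝓡∂ n) (γ t).1 (γ t).1)) J t

/-- The characteristic set `{(x, ξ) ∈ T^*M ∖ 0 : p(x, ξ) = 0}`. -/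
def charSet (p : Cotangent (n := n) M → ℝ) : Set (Cotangent (n := n) M) :=
  {z | z.2 ≠ 0 ∧ p z = 0}

/-- Null bicharacteristic curves: bicharacteristic curves in the characteristic set. -/
def IsNullBicharacteristicOn (p : Cotangent (n := n) M → ℝ) (γ : ℝ → Cotangent (n := n) M)
    (J : Set ℝ) : Prop :=
  IsBicharacteristicOn p γ J ∧ ∀ t ∈ J, γ t ∈ charSet p

/-- The null bicharacteristic flow is nontrapping: `τ₊` and `τ₋` are finite on the characteristic
set. -/
def IsNontrapping (p : Cotangent (n := n) M → ℝ) : Prop :=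
  ∀ z ∈ charSet p, forwardTime (IsNullBicharacteristicOn p) z < ⊤ ∧
    backwardTime (IsNullBicharacteristicOn p) z < ⊤

/-- The incoming null boundary `∂⁺_null(T^*M) = {z ∈ Char : τ₋(z) = 0}`. -/
def incomingNull (p : Cotangent (n := n) M → ℝ) : Set (Cotangent (n := n) M) :=
  {z ∈ charSet p | backwardTime (IsNullBicharacteristicOn p) z = 0}

/-- The outgoing null boundary `∂⁻_null(T^*M) = {z ∈ Char : τ₊(z) = 0}`. -/
def outgoingNull (p : Cotangent (n := n) M → ℝ) : Set (Cotangent (n := n) M) :=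
  {z ∈ charSet p | forwardTime (IsNullBicharacteristicOn p) z = 0}

/-- The scattering relation, as the graph of the map `α` on `∂⁺_null(T^*M) ∪ ∂⁻_null(T^*M)` with
`α(z) = γ_z(τ₊(z))` on `∂⁺_null(T^*M)` and `α(z) = γ_z(-τ₋(z))` on `∂⁻_null(T^*M)`, where `γ_z` is
the null bicharacteristic curve with `γ_z(0) = z`. -/
def scatteringRelation (p : Cotangent (n := n) M → ℝ) :
    Set (Cotangent (n := n) M × Cotangent (n := n) M) :=
  {q |
    (q.1 ∈ incomingNull p ∧ ∃ γ : ℝ → Cotangent (n := n) M,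
      IsNullBicharacteristicOn p γ
        (Icc 0 (forwardTime (IsNullBicharacteristicOn p) q.1).toReal) ∧
      γ 0 = q.1 ∧ γ (forwardTime (IsNullBicharacteristicOn p) q.1).toReal = q.2) ∨
    (q.1 ∈ outgoingNull p ∧ ∃ γ : ℝ → Cotangent (n := n) M,
      IsNullBicharacteristicOn p γ
        (Icc (-(backwardTime (IsNullBicharacteristicOn p) q.1).toReal) 0) ∧
      γ 0 = q.1 ∧ γ (-(backwardTime (IsNullBicharacteristicOn p) q.1).toReal) = q.2)}

/-! ### Vector fields -/

/-- The derivative `L f` of a function `f` along the vector field `L`. -/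
def lieDeriv {F : Type*} [NormedAddCommGroup F] [NormedSpace ℝ F]
    (L : (x : M) → TangentSpace (𝓡∂ n) x) (f : M → F) (x : M) : F :=
  mfderiv (𝓡∂ n) 𝓘(ℝ, F) f x (L x)

/-- A boundary defining function: `ρ ∈ C^∞(M)`, `ρ ≥ 0`, `∂M = {ρ = 0}`, `dρ ≠ 0` on `∂M`. -/
structure IsBoundaryDefining (ρ : M → ℝ) : Prop where
  smooth : ContMDiff (𝓡∂ n) 𝓘(ℝ, ℝ) ∞ ρ
  nonneg : ∀ x, 0 ≤ ρ x
  eq_zero_iff : ∀ x, ρ x = 0 ↔ x ∈ (𝓡∂ n).boundary M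
  mfderiv_ne_zero : ∀ x ∈ (𝓡∂ n).boundary M, mfderiv (𝓡∂ n) 𝓘(ℝ, ℝ) ρ x ≠ 0

/-- `M` is strictly convex for `L`: if `L(x)` is tangent to `∂M` at `x ∈ ∂M`, then
`(d²/dt²) ρ(x(t)) < 0` at `t = 0` along the integral curve `x(t)` with `x(0) = x` of an extension of
`L` to an open manifold containing `M`. By the chain rule this second derivative is `L(Lρ)(x)`, in
which only the values of `L` and `ρ` on `M` enter; tangency is `dρ(L(x)) = 0`. -/
def IsStrictlyConvex (L : (x : M) → TangentSpace (𝓡∂ n) x) : Prop :=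
  ∀ ρ : M → ℝ, IsBoundaryDefining (n := n) ρ → ∀ x ∈ (𝓡∂ n).boundary M,
    lieDeriv L ρ x = 0 → lieDeriv L (lieDeriv L ρ) x < 0

/-- `γ : [0, T] → M` is a maximal integral curve of `L` in `M`. -/
def IsMaximalIntegralCurve (L : (x : M) → TangentSpace (𝓡∂ n) x) (γ : ℝ → M) (T : ℝ) : Prop :=
  IsMaximalCurve (fun γ J => IsMIntegralCurveOn γ L J) γ 0 T

/-- The set of initial points `γ(0)` of the maximal integral curves `γ : [0, T] → M` of `L`
(the incoming boundary points of `L`). -/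
def initialPoints (L : (x : M) → TangentSpace (𝓡∂ n) x) : Set M :=
  {x | ∃ (T : ℝ) (γ : ℝ → M), IsMaximalIntegralCurve L γ T ∧ γ 0 = x}

/-! ### First order operators with real principal symbol -/

variable (n M) in
/-- The data of a first order differential operator `P = (1/i) L + V` on `M`, with a smooth real
vector field `L` and a smooth complex valued function `V`. -/
structure FirstOrderOperator [IsManifold (𝓡∂ n) ∞ M] where
  L : (x : M) → TangentSpace (𝓡∂ n) x
  V : M → ℂ
  smooth_L : ContMDiff (𝓡∂ n) (𝓡∂ n).tangent ∞ (fun x => (⟨x, L x⟩ : TangentBundle (𝓡∂ n) M))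
  smooth_V : ContMDiff (𝓡∂ n) 𝓘(ℝ, ℂ) ∞ V

namespace FirstOrderOperator

variable [IsManifold (𝓡∂ n) ∞ M] (P : FirstOrderOperator n M)

/-- The action `P u = (1/i) L u + V u` on functions. -/
def apply (u : M → ℂ) (x : M) : ℂ :=
  (1 / Complex.I) * lieDeriv P.L u x + P.V x * u x

/-- The principal symbol `p(x, ξ) = ξ(L(x))` of `P = (1/i) L + V`. -/
def symbol (z : Cotangent (n := n) M) : ℝ := z.2 (P.L z.1)

/-- `P` is of real principal type (its principal symbol is real by construction). -/
def IsRealPrincipalType : Prop := IsNontrapping P.symbol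

/-- The `C^∞` Cauchy data set `{u|_{∂M} : u ∈ C^∞(M), P u = 0 in M}`. -/
def smoothCauchyData : Set ((𝓡∂ n).boundary M → ℂ) :=
  {f | ∃ u : M → ℂ, ContMDiff (𝓡∂ n) 𝓘(ℝ, ℂ) ∞ u ∧ (∀ x, P.apply u x = 0) ∧
    ∀ x : (𝓡∂ n).boundary M, f x = u x}

end FirstOrderOperator

end Manifold

end RealPrincipalType

end

/-!
# Cauchy data of first order operators of real principal type

Let `u₁` solve `P₁ u₁ = 0`. A solution of `P₂ u = 0`, that is of `L₂ u = -i V₂ u`, with the same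
boundary values is obtained by transport: at the points where integral curves of `L₂` enter `M` one
puts `u = u₁`, and along an integral curve `u` is then `exp(-i ∫ V₂)` times its value at the entry
point (`transport`). Let `x` be the point where this curve leaves `M`. As `L₁` and `L₂` have the
same incoming points, an integral curve of `L₁` starts at the same entry point; it ends at `x` as
well, because integral curves lift to null bicharacteristics with arbitrary null covectors
(`exists_lift_of_left`, `exists_lift_of_right`) and the scattering relations agree
(`IsMaximalIntegralCurve.apply_end_eq`). The equality of the exponentials gives `u = u₁` at `x`, so
that `u = u₁` on the whole boundary. By symmetry this proves the theorem
(`smoothCauchyData_subset`).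

Two points need an argument.

*Smoothness of `u`.* The difference `w = u - u₁` vanishes on the boundary and solves an
inhomogeneous transport equation with smooth coefficients along the integral curves of `L₂`. Near
boundary points where `L₂` is transversal to the boundary, `w` is smooth by the implicit function
theorem (`IsTransported.contDiffWithinAt_of_transversal`), and smoothness propagates along integral
curves (`IsTransported.contDiffAt_propagate`). The difficulty is a glancing point, where `L₂` is
tangent to the boundary: there the time which an integral curve needs to reach the boundary is not a
smooth function. By strict convexity, an interior point near a glancing point lies on a short chord
with both ends on the boundary (`exists_chord`), and `w` vanishes at both ends; hence the right hand
side of the transport equation has mean value zero over short chords, and so it vanishes at the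
glancing points (`IsGlancingSolution.rhs_eq_zero`). Strict convexity also makes the glancing set a
regular hypersurface of the boundary; by division, the normal derivative of `w` on the boundary,
which the equation prescribes off the glancing set, extends smoothly across it
(`IsGlancingSolution.exists_boundary_derivative`). After subtraction of a function with these
boundary values, `w` together with its first derivatives solves a (nonlinear) system of the same
form, and an induction shows that `w` is `C^k` for every `k`
(`IsGlancingSolution.exists_contDiffOn`). Of the boundary data, only the vanishing of `w` enters,
that is, the agreement of the outgoing boundary values.

*Trapped curves.* The nontrapping hypothesis concerns null bicharacteristics. It rules out zeros of
the vector fields (`IsNontrapping.field_ne_zero`), and in dimension at least two, where every vector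
is annihilated by a nonzero covector, also trapped integral curves. In dimension one the
characteristic set is empty, and circles are allowed components of `M`; there the image of an
inextendible integral curve is open and closed (`isClopen_image_of_complete`), which determines the
end points of the integral curves without the scattering relation and shows that no trapped curve
reaches the boundary.
-/

namespace RealPrincipalType

/-! ### Superposition operators and smooth local flows -/

section Superposition

universe u

variable {K : Type*} [TopologicalSpace K] [CompactSpace K]
  {E F : Type u} [NormedAddCommGroup E] [NormedSpace ℝ E] [NormedAddCommGroup F] [NormedSpace ℝ F]

/-- Pointwise application `T, h ↦ (x ↦ T x (h x))` as a continuous bilinear map. -/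
noncomputable def applyBilin : C(K, E →L[ℝ] F) →L[ℝ] C(K, E) →L[ℝ] C(K, F) :=
  LinearMap.mkContinuous₂
    (LinearMap.mk₂ ℝ (fun (T : C(K, E →L[ℝ] F)) (h : C(K, E)) =>
      (⟨fun x => T x (h x), T.continuous.clm_apply h.continuous⟩ : C(K, F)))
      (fun _ _ _ => by ext; simp) (fun _ _ _ => by ext; simp)
      (fun _ _ _ => by ext; simp) (fun _ _ _ => by ext; simp)) 1
    (fun T h => by
      rw [one_mul]
      refine (ContinuousMap.norm_le _ (by positivity)).2 fun x => ?_
      exact (T x).le_of_opNorm_le_of_le (T.norm_coe_le_norm x) (h.norm_coe_le_norm x))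

lemma hasFDerivAt_superposition {f : E → F} {f' : E → E →L[ℝ] F} (hf : ∀ x, HasFDerivAt f (f' x) x)
    (hc : Continuous f) (hc' : Continuous f') (α : C(K, E)) :
    HasFDerivAt (fun β : C(K, E) => (⟨f, hc⟩ : C(E, F)).comp β)
      (applyBilin ((⟨f', hc'⟩ : C(E, E →L[ℝ] F)).comp α)) α := by
  rw [hasFDerivAt_iff_isLittleO_nhds_zero, Asymptotics.isLittleO_iff]
  intro c hc0
  -- Uniform continuity of `f'` along the compact image of `α`.
  have key : ∀ᶠ v in 𝓝 (0 : E), ∀ x ∈ (univ : Set K), ‖f' (α x + v) - f' (α x)‖ < c := by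
    refine isCompact_univ.eventually_forall_of_forall_eventually fun x _ => ?_
    have hcont : Continuous fun q : K × E => ‖f' (α q.1 + q.2) - f' (α q.1)‖ := by fun_prop
    have := (hcont.tendsto (x, (0 : E))).eventually (Iio_mem_nhds (show
      ‖f' (α (x, (0 : E)).1 + (x, (0 : E)).2) - f' (α (x, (0 : E)).1)‖ < c by
        simpa using hc0))
    rw [nhds_prod_eq] at this
    simpa [nhds_prod_eq] using (Filter.tendsto_snd.prodMk Filter.tendsto_fst).eventually this
  obtain ⟨δ, hδ, hδ'⟩ := Metric.eventually_nhds_iff.1 key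
  filter_upwards [Metric.ball_mem_nhds (0 : C(K, E)) hδ] with h hh
  refine (ContinuousMap.norm_le _ (by positivity)).2 fun x => ?_
  have hx : ‖h x‖ < δ := lt_of_le_of_lt (h.norm_coe_le_norm x) (by simpa using hh)
  have hmv := (convex_ball (α x) δ).norm_image_sub_le_of_norm_hasFDerivWithin_le'
    (f := f) (f' := f') (φ := f' (α x)) (C := c) (fun y _ => (hf y).hasFDerivWithinAt)
    (fun y hy => by
      have := hδ' (y := y - α x) (by simpa [dist_eq_norm] using hy) x (mem_univ x)
      simpa using this.le) (Metric.mem_ball_self hδ)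
    (show α x + h x ∈ Metric.ball (α x) δ by simpa [dist_eq_norm] using hx)
  simp only [add_sub_cancel_left] at hmv
  refine hmv.trans ?_
  gcongr
  exact h.norm_coe_le_norm x

/-- The superposition operator `α ↦ f ∘ α` on continuous maps is as smooth as `f`. -/
theorem contDiff_superposition (k : ℕ) : ∀ {F : Type u} [NormedAddCommGroup F] [NormedSpace ℝ F]
    {f : E → F} (_ : ContDiff ℝ k f) (hc : Continuous f),
    ContDiff ℝ k (fun β : C(K, E) => (⟨f, hc⟩ : C(E, F)).comp β) := by
  induction k with
  | zero =>
    intro F _ _ f _ hc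
    exact contDiff_zero.2 (ContinuousMap.continuous_postcomp _)
  | succ k ih =>
    intro F _ _ f hf hc
    have h1 : ContDiff ℝ k (fderiv ℝ f) := (contDiff_succ_iff_fderiv.1 (by exact_mod_cast hf)).2.2
    have hd : Differentiable ℝ f := hf.differentiable (by simp)
    have := ih h1 h1.continuous
    push_cast
    rw [contDiff_succ_iff_hasFDerivAt]
    refine ⟨_, (applyBilin (K := K) (E := E) (F := F)).contDiff.comp this, fun α => ?_⟩
    exact hasFDerivAt_superposition (fun x => (hd x).hasFDerivAt) hc h1.continuous α

end Superposition

section Flow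

variable {E : Type*} [NormedAddCommGroup E] [NormedSpace ℝ E] [CompleteSpace E]

variable (E) in
/-- The embedding of `E` as constant curves. -/
noncomputable def constCLM : E →L[ℝ] C(unitInterval, E) :=
  LinearMap.mkContinuous
    { toFun := fun x => ContinuousMap.const _ x
      map_add' := fun _ _ => rfl
      map_smul' := fun _ _ => rfl } 1
    (fun x => by
      rw [one_mul]
      exact (ContinuousMap.norm_le _ (norm_nonneg _)).2 fun s => le_rfl)

/-- The integration operator `β ↦ (s ↦ ∫₀ˢ β)` on continuous curves on the unit interval. -/
noncomputable def integrationCLM : C(unitInterval, E) →L[ℝ] C(unitInterval, E) :=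
  LinearMap.mkContinuous
    { toFun := fun β => ⟨fun s => ∫ u in (0 : ℝ)..s, IccExtend zero_le_one β u,
        (intervalIntegral.continuous_primitive
          (fun a b => (β.continuous.Icc_extend').intervalIntegrable a b) 0).comp
          continuous_subtype_val⟩
      map_add' := fun β β' => by
        ext s
        simp only [ContinuousMap.coe_mk, ContinuousMap.add_apply]
        rw [← intervalIntegral.integral_add (β.continuous.Icc_extend'.intervalIntegrable _ _)
          (β'.continuous.Icc_extend'.intervalIntegrable _ _)]
        rfl
      map_smul' := fun c β => by
        ext s
        simp only [ContinuousMap.coe_mk, ContinuousMap.smul_apply, RingHom.id_apply]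
        rw [← intervalIntegral.integral_smul]
        rfl } 1
    (fun β => by
      rw [one_mul]
      refine (ContinuousMap.norm_le _ (by positivity)).2 fun s => ?_
      have := intervalIntegral.norm_integral_le_of_norm_le_const (a := 0) (b := (s : ℝ))
        (f := IccExtend zero_le_one β) (C := ‖β‖) (fun u _ => β.norm_coe_le_norm _)
      refine this.trans ?_
      rw [sub_zero, abs_of_nonneg s.2.1]
      exact mul_le_of_le_one_right (norm_nonneg _) s.2.2)

omit [CompleteSpace E] in
lemma integrationCLM_apply (β : C(unitInterval, E)) (s : unitInterval) :
    integrationCLM β s = ∫ u in (0 : ℝ)..s, IccExtend zero_le_one β u := rfl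

/-- Smooth dependence on initial values: the local flow of a `C^k` vector field is `C^k`. The flow
is the implicit function defined by `α = x + t ∫ v(α)` in the space of continuous curves `α` on the
unit interval, evaluated at time one. -/
theorem exists_contDiffAt_flow {v : E → E} {k : ℕ} (hk : k ≠ 0) (hv : ContDiff ℝ k v) (x₀ : E) :
    ∃ Φ : ℝ × E → E, ContDiffAt ℝ k Φ (0, x₀) ∧ ∃ ε > 0, ∃ r > 0,
      ∀ x ∈ Metric.closedBall x₀ r, Φ (0, x) = x ∧ ∀ t ∈ Icc (-ε) ε,
        HasDerivWithinAt (fun s => Φ (s, x)) (v (Φ (t, x))) (Icc (-ε) ε) t := by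
  have hv1 : ContDiff ℝ 1 v := hv.of_le (by exact_mod_cast Nat.one_le_iff_ne_zero.2 hk)
  obtain ⟨ε, hε, a, r, L, Kc, hr, hPL⟩ := IsPicardLindelof.of_contDiffAt_one (hv1.contDiffAt (x := x₀))
  obtain ⟨α, hα, hαc⟩ := (hPL 0).exists_forall_mem_closedBall_eq_hasDerivWithinAt_continuousOn
  simp only [zero_sub, zero_add] at hα hαc
  have hr' : (0 : ℝ) < r := hr
  let Φ : ℝ × E → E := fun p => α (p.2, p.1)
  refine ⟨Φ, ?_, ε, hε, r, hr', hα⟩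
  let N : C(unitInterval, E) → C(unitInterval, E) := fun β => (⟨v, hv.continuous⟩ : C(E, E)).comp β
  let G : (ℝ × E) × C(unitInterval, E) → C(unitInterval, E) := fun q =>
    q.2 - constCLM E q.1.2 - q.1.1 • integrationCLM (N q.2)
  have hN : ContDiff ℝ k N := contDiff_superposition k hv hv.continuous
  have hG : ContDiff ℝ k G := by
    refine (contDiff_snd.sub ?_).sub ?_
    · exact (constCLM E).contDiff.comp (contDiff_snd.comp contDiff_fst)
    · exact (contDiff_fst.comp contDiff_fst).smul
        (integrationCLM.contDiff.comp (hN.comp contDiff_snd))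
  set u : (ℝ × E) × C(unitInterval, E) := ((0, x₀), constCLM E x₀) with hu
  have hGu : G u = 0 := by simp [G, u]
  have hinv : (fderiv ℝ G u ∘L .inr ℝ (ℝ × E) C(unitInterval, E)).IsInvertible := by
    have h1 : HasFDerivAt (fun β => G ((0, x₀), β))
        (fderiv ℝ G u ∘L .inr ℝ (ℝ × E) C(unitInterval, E)) (constCLM E x₀) := by
      have h0 : HasFDerivAt G (fderiv ℝ G u) ((0, x₀), constCLM E x₀) :=
        ((hG.differentiable (by exact_mod_cast hk)) u).hasFDerivAt
      exact h0.comp _ (hasFDerivAt_prodMk_right (𝕜 := ℝ) (0, x₀) (constCLM E x₀))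
    have h2 : HasFDerivAt (fun β => G ((0, x₀), β))
        (ContinuousLinearMap.id ℝ C(unitInterval, E)) (constCLM E x₀) := by
      have : (fun β => G ((0, x₀), β)) = fun β => β - constCLM E x₀ := by
        ext β; simp [G]
      rw [this]
      exact (hasFDerivAt_id _).sub_const _
    rw [h1.unique h2]
    exact ContinuousLinearMap.isInvertible_equiv (f := ContinuousLinearEquiv.refl ℝ _)
  have hk' : (k : WithTop ℕ∞) ≠ 0 := by exact_mod_cast hk
  set ψ := (hG.contDiffAt (x := u)).implicitFunction hk' hinv with hψ
  have hψc : ContDiffAt ℝ k ψ (0, x₀) :=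
    (hG.contDiffAt (x := u)).contDiffAt_implicitFunction hk' hinv
  have hψe := (hG.contDiffAt (x := u)).eventually_apply_eq_iff_implicitFunction hk' hinv
  rw [hGu] at hψe
  have hev : ContDiffAt ℝ k (fun p => ψ p 1) (0, x₀) :=
    (ContinuousMap.evalCLM ℝ (M := E) (1 : unitInterval)).contDiff.contDiffAt.comp
      (f := ψ) (0, x₀) hψc
  refine hev.congr_of_eventuallyEq ?_
  obtain ⟨δ, hδ, hδ'⟩ := Metric.eventually_nhds_iff.1 hψe
  -- Short pieces of flow lines starting near `x₀` are uniformly close to the constant curve.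
  have hΦc : ContinuousAt Φ (0, x₀) := by
    have h1 : ContinuousAt α (x₀, 0) := hαc.continuousAt
      (prod_mem_nhds (Metric.closedBall_mem_nhds _ hr') (Icc_mem_nhds (by linarith) hε))
    have h2 : ContinuousAt (fun p : ℝ × E => (p.2, p.1)) (0, x₀) := by fun_prop
    exact ContinuousAt.comp (f := fun p : ℝ × E => (p.2, p.1)) (x := (0, x₀)) h1 h2
  have hΦ0 : Φ (0, x₀) = x₀ := (hα x₀ (Metric.mem_closedBall_self hr'.le)).1
  obtain ⟨δ₁, hδ₁, hδ₁'⟩ := Metric.continuousAt_iff.1 hΦc (δ / 2) (by positivity)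
  have hm : (0:ℝ) < min (min δ δ₁) (min ε r) := by positivity
  filter_upwards [Metric.ball_mem_nhds ((0 : ℝ), x₀) hm] with p hp
  obtain ⟨t, x⟩ := p
  simp only [Metric.mem_ball, Prod.dist_eq, sup_lt_iff, lt_min_iff, Real.dist_eq, sub_zero] at hp
  obtain ⟨⟨⟨ht1, hx1⟩, ht2, hx2⟩, ⟨ht3, hx3⟩, ht4, hx4⟩ := hp
  have hts : ∀ s ∈ Icc (0 : ℝ) 1, |t * s| ≤ |t| := fun s hs => by
    rw [abs_mul, abs_of_nonneg hs.1]
    exact mul_le_of_le_one_right (abs_nonneg _) hs.2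
  have hxr : x ∈ Metric.closedBall x₀ r := hx4.le
  have hder : ∀ s ∈ Icc (0 : ℝ) 1,
      HasDerivAt (fun s => Φ (t * s, x)) (t • v (Φ (t * s, x))) s := by
    intro s hs
    have h1 := abs_lt.1 ((hts s hs).trans_lt ht3)
    have h2 := ((hα x hxr).2 (t * s) ⟨h1.1.le, h1.2.le⟩).hasDerivAt (Icc_mem_nhds h1.1 h1.2)
    have h3 : HasDerivAt (fun s => t * s) t s := by simpa using (hasDerivAt_id s).const_mul t
    exact h2.scomp s h3
  let β : C(unitInterval, E) := ⟨fun s => Φ (t * s, x), by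
    refine continuous_iff_continuousAt.2 fun s => ?_
    exact ContinuousAt.comp (f := fun s : unitInterval => (s : ℝ))
      (g := fun s : ℝ => Φ (t * s, x)) (hder s s.2).continuousAt continuous_subtype_val.continuousAt⟩
  have hclose : dist (((t, x), β) : (ℝ × E) × C(unitInterval, E)) u < δ := by
    simp only [Prod.dist_eq, sup_lt_iff, hu]
    refine ⟨⟨by simpa [Real.dist_eq] using ht1, hx1⟩, ?_⟩
    refine lt_of_le_of_lt ((ContinuousMap.dist_le (by positivity)).2 fun s => ?_) (half_lt_self hδ)
    have := hδ₁' (x := (t * s, x)) (by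
      simp only [Prod.dist_eq, sup_lt_iff, Real.dist_eq, sub_zero]
      exact ⟨(hts s s.2).trans_lt ht2, hx2⟩)
    rw [hΦ0] at this
    exact this.le
  have hG0 : G ((t, x), β) = 0 := by
    ext s
    have hint : ∫ y in (0 : ℝ)..s, t • v (Φ (t * y, x)) = Φ (t * s, x) - Φ (t * 0, x) := by
      have hsub : ∀ y ∈ uIcc (0 : ℝ) s, y ∈ Icc (0 : ℝ) 1 := fun y hy => by
        rw [uIcc_of_le s.2.1] at hy; exact ⟨hy.1, hy.2.trans s.2.2⟩
      refine intervalIntegral.integral_eq_sub_of_hasDerivAt (fun y hy => hder y (hsub y hy)) ?_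
      refine ContinuousOn.intervalIntegrable fun y hy => ContinuousAt.continuousWithinAt ?_
      have := (hder y (hsub y hy)).continuousAt
      exact (hv.continuous.continuousAt.comp this).const_smul t
    have hint2 : ∫ y in (0 : ℝ)..s, IccExtend zero_le_one (N β) y
        = ∫ y in (0 : ℝ)..s, v (Φ (t * y, x)) := by
      refine intervalIntegral.integral_congr fun y hy => ?_
      rw [uIcc_of_le s.2.1] at hy
      rw [IccExtend_of_mem zero_le_one (N β) ⟨hy.1, hy.2.trans s.2.2⟩]
      rfl
    have h0 : Φ (0, x) = x := (hα x hxr).1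
    rw [intervalIntegral.integral_smul, mul_zero, h0] at hint
    simp only [G, ContinuousMap.sub_apply, ContinuousMap.smul_apply, integrationCLM_apply,
      ContinuousMap.zero_apply]
    rw [hint2, hint]
    change Φ (t * s, x) - x - (Φ (t * s, x) - x) = 0
    simp
  have hfin := (hδ' hclose).1 hG0
  change Φ (t, x) = ψ (t, x) 1
  rw [show ψ (t, x) = β from hfin]
  simp [β]

end Flow

/-! ### Extension of smooth functions from a half-space -/

section Extension

universe u

variable {E : Type u} [NormedAddCommGroup E] [NormedSpace ℝ E]

/-- The closed half-space `{ℓ ≥ 0}`. -/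
def halfSpace (ℓ : E →L[ℝ] ℝ) : Set E := {y | 0 ≤ ℓ y}

lemma isClosed_halfSpace (ℓ : E →L[ℝ] ℝ) : IsClosed (halfSpace ℓ) :=
  isClosed_le continuous_const ℓ.continuous

lemma convex_halfSpace (ℓ : E →L[ℝ] ℝ) : Convex ℝ (halfSpace ℓ) :=
  convex_halfSpace_ge ℓ.toLinearMap.isLinear 0

lemma halfSpace_mem_nhds {ℓ : E →L[ℝ] ℝ} {y : E} (hy : 0 < ℓ y) : halfSpace ℓ ∈ 𝓝 y :=
  mem_of_superset ((isOpen_lt continuous_const ℓ.continuous).mem_nhds hy)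
    fun _ h => le_of_lt (mem_ofPred.1 h)

lemma uniqueDiffOn_halfSpace {ℓ : E →L[ℝ] ℝ} {ν : E} (hν : ℓ ν = 1) :
    UniqueDiffOn ℝ (halfSpace ℓ) := by
  refine uniqueDiffOn_convex (convex_halfSpace ℓ) ⟨ν, ?_⟩
  exact mem_interior_iff_mem_nhds.2 (halfSpace_mem_nhds (by rw [hν]; exact one_pos))

/-- The linear map that fixes `ker ℓ` and sends `ν` to `-s ν` (when `ℓ ν = 1`). -/
noncomputable def stretch (ℓ : E →L[ℝ] ℝ) (ν : E) (s : ℝ) : E →L[ℝ] E :=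
  (ContinuousLinearMap.id ℝ E - ℓ.smulRight ν) + (-s) • ℓ.smulRight ν

lemma stretch_of_eq_zero {ℓ : E →L[ℝ] ℝ} {ν : E} {s : ℝ} {y : E} (hy : ℓ y = 0) :
    stretch ℓ ν s y = y := by
  simp [stretch, hy]

lemma apply_stretch {ℓ : E →L[ℝ] ℝ} {ν : E} (hν : ℓ ν = 1) (s : ℝ) (y : E) :
    ℓ (stretch ℓ ν s y) = -s * ℓ y := by
  simp [stretch, hν]

variable {ι : Type*} [Fintype ι] (c s : ι → ℝ)

/-- The extension of a function on `{ℓ ≥ 0}` across the hyperplane `{ℓ = 0}` by a combination of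
reflections, with operator valued weights `∑ᵢ cⱼ (-sⱼ)^{dᵢ} Qᵢ`. This family of weights is stable
under differentiation of the extension. -/
noncomputable def reflectExt (ℓ : E →L[ℝ] ℝ) (ν : E) {κ : Type} [Fintype κ] (d : κ → ℕ)
    {F : Type u} [NormedAddCommGroup F] [NormedSpace ℝ F] (Q : κ → F →L[ℝ] F) (f : E → F) (y : E) :
    F :=
  open scoped Classical in
  if 0 ≤ ℓ y then f y else
    ∑ j, ∑ i, (c j * (-s j) ^ d i) • Q i (f (stretch ℓ ν (s j) y))

lemma sum_reflect_eq {K : ℕ} (hc : ∀ i ≤ K, ∑ j, c j * (-s j) ^ i = 1)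
    {κ : Type} [Fintype κ] {d : κ → ℕ} (hd : ∀ i, d i ≤ K)
    {F : Type u} [NormedAddCommGroup F] [NormedSpace ℝ F] {Q : κ → F →L[ℝ] F}
    (hQ : ∑ i, Q i = ContinuousLinearMap.id ℝ F) (z : F) :
    ∑ j, ∑ i, (c j * (-s j) ^ d i) • Q i z = z := by
  rw [Finset.sum_comm]
  simp_rw [← Finset.sum_smul, hc _ (hd _), one_smul]
  rw [← sum_apply, hQ]
  rfl

/-- The combination of reflections of a `C^k` function is `C^k` if the weights satisfy the
matching conditions up to order `k`. -/
theorem contDiff_reflectExt {ℓ : E →L[ℝ] ℝ} {ν : E} (hν : ℓ ν = 1) (hs : ∀ j, 0 < s j) {K : ℕ}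
    (hc : ∀ i ≤ K, ∑ j, c j * (-s j) ^ i = 1) (k : ℕ) :
    ∀ {κ : Type} [Fintype κ] {d : κ → ℕ} (_ : ∀ i, d i + k ≤ K)
      {F : Type u} [NormedAddCommGroup F] [NormedSpace ℝ F] {Q : κ → F →L[ℝ] F}
      (_ : ∑ i, Q i = ContinuousLinearMap.id ℝ F) {f : E → F}
      (_ : ContDiffOn ℝ k f (halfSpace ℓ)), ContDiff ℝ k (reflectExt c s ℓ ν d Q f) := by
  have hmaps : ∀ j, MapsTo (stretch ℓ ν (s j)) {y | ℓ y ≤ 0} (halfSpace ℓ) := fun j y hy => by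
    change 0 ≤ ℓ _
    rw [apply_stretch hν]
    have := hs j
    have hy' : ℓ y ≤ 0 := hy
    nlinarith
  induction k with
  | zero =>
    intro κ _ d hd F _ _ Q hQ f hf
    simp only [CharP.cast_eq_zero, contDiff_zero, contDiffOn_zero] at hf ⊢
    rw [← continuousOn_univ]
    have hun : (univ : Set E) = halfSpace ℓ ∪ {y | ℓ y ≤ 0} := by
      ext y; simpa [halfSpace] using le_total 0 (ℓ y)
    rw [hun]
    refine ContinuousOn.union_of_isClosed ?_ ?_ (isClosed_halfSpace ℓ)
      (isClosed_le ℓ.continuous continuous_const)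
    · exact hf.congr fun y hy => if_pos hy
    · have : ContinuousOn (fun y => ∑ j, ∑ i, (c j * (-s j) ^ d i) •
          Q i (f (stretch ℓ ν (s j) y))) {y | ℓ y ≤ 0} := by
        refine continuousOn_finsetSum _ fun j _ => continuousOn_finsetSum _ fun i _ => ?_
        exact ((Q i).continuous.comp_continuousOn
          (hf.comp (stretch ℓ ν (s j)).continuous.continuousOn (hmaps j))).const_smul _
      refine this.congr fun y hy => ?_
      unfold reflectExt
      split_ifs with h
      · have h0 : ℓ y = 0 := le_antisymm hy h
        simp_rw [stretch_of_eq_zero h0]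
        exact (sum_reflect_eq c s hc (fun i => by simpa using hd i) hQ _).symm
      · rfl
  | succ k ih =>
    intro κ _ d hd F _ _ Q hQ f hf
    have hud := uniqueDiffOn_halfSpace hν
    have hf' : ContDiffOn ℝ k (fderivWithin ℝ f (halfSpace ℓ)) (halfSpace ℓ) :=
      hf.fderivWithin hud (by norm_cast)
    have hdiff : DifferentiableOn ℝ f (halfSpace ℓ) := hf.differentiableOn (by simp)
    -- The weights of the derivative.
    let d' : κ ⊕ κ → ℕ := Sum.elim d (fun i => d i + 1)
    let Q' : κ ⊕ κ → (E →L[ℝ] F) →L[ℝ] (E →L[ℝ] F) := Sum.elim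
      (fun i => (ContinuousLinearMap.compL ℝ E F F (Q i)).comp
        ((ContinuousLinearMap.compL ℝ E E F).flip (ContinuousLinearMap.id ℝ E - ℓ.smulRight ν)))
      (fun i => (ContinuousLinearMap.compL ℝ E F F (Q i)).comp
        ((ContinuousLinearMap.compL ℝ E E F).flip (ℓ.smulRight ν)))
    have hQs : ∀ z, ∑ i, Q i z = z := fun z => by
      rw [← sum_apply, hQ]; rfl
    have hQ' : ∑ i, Q' i = ContinuousLinearMap.id ℝ _ := by
      ext T v
      simp only [Fintype.sum_sum_type, Q', Sum.elim_inl, Sum.elim_inr]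
      simp [hQs]
    have hd' : ∀ i, d' i + k ≤ K := by
      rintro (i | i)
      · have := hd i; simp only [d', Sum.elim_inl]; omega
      · have := hd i; simp only [d', Sum.elim_inr]; omega
    have hIH := ih hd' hQ' hf'
    push_cast
    rw [contDiff_succ_iff_hasFDerivAt]
    refine ⟨_, hIH, fun y => ?_⟩
    -- The derivative of the reflected part.
    have hrefl : ∀ y, ℓ y ≤ 0 → HasFDerivWithinAt (fun y => ∑ j, ∑ i, (c j * (-s j) ^ d i) •
        Q i (f (stretch ℓ ν (s j) y)))
        (∑ j, ∑ i, (c j * (-s j) ^ d' i) •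
          Q' i (fderivWithin ℝ f (halfSpace ℓ) (stretch ℓ ν (s j) y))) {y | ℓ y ≤ 0} y := by
      intro y hy
      refine HasFDerivWithinAt.fun_sum fun j _ => ?_
      have h1 : HasFDerivWithinAt (fun y => f (stretch ℓ ν (s j) y))
          ((fderivWithin ℝ f (halfSpace ℓ) (stretch ℓ ν (s j) y)).comp (stretch ℓ ν (s j)))
          {y | ℓ y ≤ 0} y :=
        ((hdiff _ (hmaps j hy)).hasFDerivWithinAt).comp y
          (stretch ℓ ν (s j)).hasFDerivAt.hasFDerivWithinAt (hmaps j)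
      have h2 : HasFDerivWithinAt (fun y => ∑ i, (c j * (-s j) ^ d i) •
          Q i (f (stretch ℓ ν (s j) y))) (∑ i, (c j * (-s j) ^ d i) • (Q i).comp
          ((fderivWithin ℝ f (halfSpace ℓ) (stretch ℓ ν (s j) y)).comp (stretch ℓ ν (s j))))
          {y | ℓ y ≤ 0} y :=
        HasFDerivWithinAt.fun_sum fun i _ =>
          ((Q i).hasFDerivAt.comp_hasFDerivWithinAt y h1).const_smul _
      convert! h2 using 1
      ext v
      simp only [Fintype.sum_sum_type, Q', d', Sum.elim_inl, Sum.elim_inr]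
      simp only [← Finset.sum_add_distrib, sum_apply]
      refine Finset.sum_congr rfl fun i _ => ?_
      simp [stretch, pow_succ, smul_sub, smul_smul, mul_assoc]
    rcases lt_trichotomy (ℓ y) 0 with hy | hy | hy
    · have hn : {y | ℓ y ≤ 0} ∈ 𝓝 y :=
        mem_of_superset ((isOpen_lt ℓ.continuous continuous_const).mem_nhds hy)
          fun _ h => le_of_lt (mem_ofPred.1 h)
      have h1 := (hrefl y hy.le).hasFDerivAt hn
      have h2 : reflectExt c s ℓ ν d' Q' (fderivWithin ℝ f (halfSpace ℓ)) y =
        ∑ j, ∑ i, (c j * (-s j) ^ d' i) •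
          Q' i (fderivWithin ℝ f (halfSpace ℓ) (stretch ℓ ν (s j) y)) := if_neg hy.not_ge
      rw [h2]
      refine h1.congr_of_eventuallyEq ?_
      filter_upwards [(isOpen_lt ℓ.continuous continuous_const).mem_nhds hy] with z hz
      exact if_neg (not_le.2 hz)
    · have h2 : reflectExt c s ℓ ν d' Q' (fderivWithin ℝ f (halfSpace ℓ)) y =
        fderivWithin ℝ f (halfSpace ℓ) y := if_pos hy.ge
      rw [h2]
      have hun : (univ : Set E) = halfSpace ℓ ∪ {y | ℓ y ≤ 0} := by
        ext y; simpa [halfSpace] using le_total 0 (ℓ y)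
      rw [← hasFDerivWithinAt_univ, hun]
      refine HasFDerivWithinAt.union ?_ ?_
      · exact (hdiff y hy.ge).hasFDerivWithinAt.congr (fun z hz => if_pos hz) (if_pos hy.ge)
      · have h3 := hrefl y hy.le
        simp_rw [stretch_of_eq_zero hy] at h3
        rw [sum_reflect_eq c s hc (fun i => (Nat.le_add_right _ _).trans (hd' i)) hQ'] at h3
        have hcg : ∀ z ∈ {y | ℓ y ≤ 0}, reflectExt c s ℓ ν d Q f z =
            ∑ j, ∑ i, (c j * (-s j) ^ d i) • Q i (f (stretch ℓ ν (s j) z)) := by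
          intro z hz
          unfold reflectExt
          split_ifs with h
          · have h0 : ℓ z = 0 := le_antisymm hz h
            simp_rw [stretch_of_eq_zero h0]
            exact (sum_reflect_eq c s hc (fun i => (Nat.le_add_right _ _).trans (hd i)) hQ _).symm
          · rfl
        exact h3.congr hcg (hcg y hy.le)
    · have h2 : reflectExt c s ℓ ν d' Q' (fderivWithin ℝ f (halfSpace ℓ)) y =
        fderivWithin ℝ f (halfSpace ℓ) y := if_pos hy.le
      rw [h2]
      refine ((hdiff y hy.le).hasFDerivWithinAt.hasFDerivAt
        (halfSpace_mem_nhds hy)).congr_of_eventuallyEq ?_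
      filter_upwards [halfSpace_mem_nhds hy] with z hz
      exact if_pos hz

/-- Weights for the extension by reflections exist because the Vandermonde matrix is invertible. -/
lemma exists_reflection_weights (K : ℕ) :
    ∃ c : Fin (K + 1) → ℝ, ∀ i ≤ K, ∑ j, c j * (-((j : ℕ) + 1 : ℝ)) ^ i = 1 := by
  let v : Fin (K + 1) → ℝ := fun j => -((j : ℕ) + 1 : ℝ)
  have hv : Function.Injective v := fun a b h => by
    have : (a : ℝ) = b := by simpa [v] using h
    exact Fin.ext (by exact_mod_cast this)
  have hdet : IsUnit (Matrix.vandermonde v).det :=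
    (Matrix.det_vandermonde_ne_zero_iff.2 hv).isUnit
  have hU : IsUnit (Matrix.vandermonde v) := (Matrix.isUnit_iff_isUnit_det _).2 hdet
  obtain ⟨c, hc⟩ := (Matrix.vecMul_surjective_iff_isUnit.2 hU) 1
  refine ⟨c, fun i hi => ?_⟩
  have := congrFun hc ⟨i, Nat.lt_succ_of_le hi⟩
  simpa [Matrix.vecMul, dotProduct, Matrix.vandermonde_apply, v] using this

/-- A function which is smooth up to the boundary of a half-space near `e` extends locally, to any
finite order of smoothness, to a function on the whole space. -/
theorem exists_contDiff_extension [FiniteDimensional ℝ E] {ℓ : E →L[ℝ] ℝ} {ν : E} (hν : ℓ ν = 1)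
    {F : Type u} [NormedAddCommGroup F] [NormedSpace ℝ F] {f : E → F} {e : E}
    (he : e ∈ halfSpace ℓ) (k : ℕ) (hf : ContDiffWithinAt ℝ k f (halfSpace ℓ) e) :
    ∃ g : E → F, ContDiff ℝ k g ∧ g =ᶠ[𝓝[halfSpace ℓ] e] f := by
  obtain ⟨w, hw, hfw⟩ := hf.contDiffOn le_rfl (by simp)
  rw [insert_eq_of_mem he] at hw
  obtain ⟨r, hr, hrw⟩ := Metric.mem_nhdsWithin_iff.1 hw
  let χ : ContDiffBump e := ⟨r / 4, r / 2, by positivity, by linarith⟩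
  have hχf : ContDiffOn ℝ k (fun y => χ y • f y) (halfSpace ℓ) := by
    intro y hy
    by_cases hyr : y ∈ Metric.ball e r
    · have h1 : ContDiffWithinAt ℝ k f (halfSpace ℓ) y := by
        refine (hfw.2 y (hrw ⟨hyr, hy⟩)).mono_of_mem_nhdsWithin ?_
        exact mem_of_superset (inter_mem_nhdsWithin _ (Metric.isOpen_ball.mem_nhds hyr))
          fun z hz => hrw ⟨hz.2, hz.1⟩
      exact χ.contDiffAt.contDiffWithinAt.smul h1
    · have h0 : ∀ᶠ z in 𝓝 y, χ z = 0 := by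
        have : y ∉ tsupport χ := fun h => hyr (by
          rw [χ.tsupport_eq] at h
          exact Metric.closedBall_subset_ball (by change r / 2 < r; linarith) h)
        have := (isClosed_tsupport χ).isOpen_compl.mem_nhds this
        filter_upwards [this] with z hz
        exact image_eq_zero_of_notMem_tsupport hz
      have : ContDiffWithinAt ℝ k (fun _ : E => (0 : F)) (halfSpace ℓ) y := contDiffWithinAt_const
      refine this.congr_of_eventuallyEq (mem_nhdsWithin_of_mem_nhds ?_) ?_
      · filter_upwards [h0] with z hz; simp [hz]
      · simp [h0.self_of_nhds]
  obtain ⟨c, hc⟩ := exists_reflection_weights k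
  have := contDiff_reflectExt c (fun j : Fin (k + 1) => ((j : ℕ) + 1 : ℝ)) hν
    (fun j => by positivity) hc k (κ := Unit) (d := fun _ => 0) (fun _ => by simp)
    (Q := fun _ => ContinuousLinearMap.id ℝ F) (by simp) hχf
  refine ⟨_, this, ?_⟩
  have hb : Metric.ball e (r / 4) ∈ 𝓝 e := Metric.ball_mem_nhds _ (by positivity)
  filter_upwards [self_mem_nhdsWithin, mem_nhdsWithin_of_mem_nhds hb] with y hy hyb
  have h1 : χ y = 1 := χ.one_of_mem_closedBall (Metric.ball_subset_closedBall hyb)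
  rw [reflectExt, if_pos (show 0 ≤ ℓ y from hy), h1, one_smul]

end Extension

/-! ### Regularity of solutions of transport equations -/

section Transport

/-- `Y` is an integral curve of the vector field `v` on `[s, t]` (one-sided at the end points). -/
def IsCurveOn {E : Type*} [NormedAddCommGroup E] [NormedSpace ℝ E] (v : E → E) (Y : ℝ → E)
    (s t : ℝ) : Prop :=
  ∀ τ ∈ Icc s t, HasDerivWithinAt Y (v (Y τ)) (Icc s t) τ

section Curves

variable {E : Type*} [NormedAddCommGroup E] [NormedSpace ℝ E] {v : E → E} {Y Z : ℝ → E}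
  {s t s' t' : ℝ}

lemma IsCurveOn.mono (h : IsCurveOn v Y s t) (hs : s ≤ s') (ht : t' ≤ t) : IsCurveOn v Y s' t' :=
  fun τ hτ => (h τ ⟨hs.trans hτ.1, hτ.2.trans ht⟩).mono (Icc_subset_Icc hs ht)

lemma IsCurveOn.continuousOn (h : IsCurveOn v Y s t) : ContinuousOn Y (Icc s t) :=
  fun τ hτ => (h τ hτ).continuousWithinAt

lemma hasDerivWithinAt_shift {Y : ℝ → E} {y' : E} {d τ : ℝ}
    (h : HasDerivWithinAt Y y' (Icc (s + d) (t + d)) (τ + d)) :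
    HasDerivWithinAt (fun σ => Y (σ + d)) y' (Icc s t) τ := by
  have h1 : HasDerivWithinAt (fun σ : ℝ => σ + d) 1 (Icc s t) τ :=
    ((hasDerivAt_id τ).add_const d).hasDerivWithinAt
  have h2 : MapsTo (fun σ : ℝ => σ + d) (Icc s t) (Icc (s + d) (t + d)) :=
    fun σ hσ => ⟨by linarith [hσ.1], by linarith [hσ.2]⟩
  have := h.scomp τ h1 h2
  simpa [Function.comp_def] using this

lemma IsCurveOn.shift (d : ℝ) (h : IsCurveOn v Y (s + d) (t + d)) :
    IsCurveOn v (fun σ => Y (σ + d)) s t :=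
  fun τ hτ => hasDerivWithinAt_shift (h (τ + d) ⟨by linarith [hτ.1], by linarith [hτ.2]⟩)

lemma IsCurveOn.congr_field {v' : E → E} (h : IsCurveOn v Y s t)
    (hv : ∀ τ ∈ Icc s t, v (Y τ) = v' (Y τ)) : IsCurveOn v' Y s t :=
  fun τ hτ => by rw [← hv τ hτ]; exact h τ hτ

lemma exists_lipschitzOnWith_closedBall [FiniteDimensional ℝ E] (hv : ContDiff ℝ 1 v) (R : ℝ) :
    ∃ C : ℝ≥0, LipschitzOnWith C v (Metric.closedBall 0 R) := by
  obtain ⟨C, hC⟩ := (isCompact_closedBall (0 : E) R).exists_bound_of_continuousOn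
    ((hv.continuous_fderiv (by simp)).continuousOn)
  refine ⟨C.toNNReal, (convex_closedBall (0 : E) R).lipschitzOnWith_of_nnnorm_fderiv_le
    (fun x _ => (hv.differentiable (by simp)) x) fun x hx => ?_⟩
  rw [← NNReal.coe_le_coe, coe_nnnorm]
  exact (hC x hx).trans (Real.le_coe_toNNReal C)

/-- Uniqueness of integral curves of a `C¹` vector field. -/
theorem IsCurveOn.eqOn [FiniteDimensional ℝ E] (hv : ContDiff ℝ 1 v) (hY : IsCurveOn v Y s t)
    (hZ : IsCurveOn v Z s t) {τ₀ : ℝ} (hτ₀ : τ₀ ∈ Icc s t) (h0 : Y τ₀ = Z τ₀) :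
    EqOn Y Z (Icc s t) := by
  obtain ⟨R₁, hR₁⟩ := (isCompact_Icc.exists_bound_of_continuousOn hY.continuousOn)
  obtain ⟨R₂, hR₂⟩ := (isCompact_Icc.exists_bound_of_continuousOn hZ.continuousOn)
  obtain ⟨C, hC⟩ := exists_lipschitzOnWith_closedBall hv (max R₁ R₂)
  have hYm : ∀ τ ∈ Icc s t, Y τ ∈ Metric.closedBall (0 : E) (max R₁ R₂) := fun τ hτ => by
    simpa using Or.inl (hR₁ τ hτ)
  have hZm : ∀ τ ∈ Icc s t, Z τ ∈ Metric.closedBall (0 : E) (max R₁ R₂) := fun τ hτ => by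
    simpa using Or.inr (hR₂ τ hτ)
  intro τ hτ
  rcases le_total τ₀ τ with h | h
  · have hsub : Icc τ₀ t ⊆ Icc s t := Icc_subset_Icc_left hτ₀.1
    refine ODE_solution_unique_of_mem_Icc_right (v := fun _ => v) (s := fun _ => _)
      (fun _ _ => hC) (hY.continuousOn.mono hsub) (fun σ hσ => ?_)
      (fun σ hσ => hYm σ (hsub (Ico_subset_Icc_self hσ))) (hZ.continuousOn.mono hsub)
      (fun σ hσ => ?_) (fun σ hσ => hZm σ (hsub (Ico_subset_Icc_self hσ))) h0 ⟨h, hτ.2⟩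
    · exact (hY σ (hsub (Ico_subset_Icc_self hσ))).mono_of_mem_nhdsWithin
        (mem_of_superset (Icc_mem_nhdsGE hσ.2) (Icc_subset_Icc_left (hτ₀.1.trans hσ.1)))
    · exact (hZ σ (hsub (Ico_subset_Icc_self hσ))).mono_of_mem_nhdsWithin
        (mem_of_superset (Icc_mem_nhdsGE hσ.2) (Icc_subset_Icc_left (hτ₀.1.trans hσ.1)))
  · have hsub : Icc s τ₀ ⊆ Icc s t := Icc_subset_Icc_right hτ₀.2
    refine ODE_solution_unique_of_mem_Icc_left (v := fun _ => v) (s := fun _ => _)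
      (fun _ _ => hC) (hY.continuousOn.mono hsub) (fun σ hσ => ?_)
      (fun σ hσ => hYm σ (hsub (Ioc_subset_Icc_self hσ))) (hZ.continuousOn.mono hsub)
      (fun σ hσ => ?_) (fun σ hσ => hZm σ (hsub (Ioc_subset_Icc_self hσ))) h0 ⟨hτ.1, h⟩
    · exact (hY σ (hsub (Ioc_subset_Icc_self hσ))).mono_of_mem_nhdsWithin
        (mem_of_superset (Icc_mem_nhdsLE hσ.1) (Icc_subset_Icc_right (hσ.2.trans hτ₀.2)))
    · exact (hZ σ (hsub (Ioc_subset_Icc_self hσ))).mono_of_mem_nhdsWithin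
        (mem_of_superset (Icc_mem_nhdsLE hσ.1) (Icc_subset_Icc_right (hσ.2.trans hτ₀.2)))

/-- A local flow of a `C^k` vector field near `p`: it is `C^k`, stays in a given neighbourhood of
`p`, and every integral curve starting near `p` is a flow line for short times. -/
theorem exists_local_flow [FiniteDimensional ℝ E] {k : ℕ} (hk : k ≠ 0) (hv : ContDiff ℝ k v) (p : E)
    {W : Set E} (hW : W ∈ 𝓝 p) :
    ∃ Φ : ℝ × E → E, ∃ ε > 0, ∃ r > 0, ∀ x ∈ Metric.closedBall p r, Φ (0, x) = x ∧
      (∀ t ∈ Icc (-ε) ε, ContDiffAt ℝ k Φ (t, x) ∧ Φ (t, x) ∈ W) ∧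
      IsCurveOn v (fun t => Φ (t, x)) (-ε) ε ∧
      ∀ s t Z, s ≤ 0 → 0 ≤ t → -ε ≤ s → t ≤ ε → IsCurveOn v Z s t → Z 0 = x →
        ∀ τ ∈ Icc s t, Z τ = Φ (τ, x) := by
  obtain ⟨Φ, hΦ, ε, hε, r, hr, h⟩ := exists_contDiffAt_flow hk hv p
  have hv1 : ContDiff ℝ 1 v := hv.of_le (by exact_mod_cast Nat.one_le_iff_ne_zero.2 hk)
  have hp : Φ (0, p) = p := (h p (Metric.mem_closedBall_self hr.le)).1
  have hev : ∀ᶠ q in 𝓝 ((0 : ℝ), p), ContDiffAt ℝ k Φ q ∧ Φ q ∈ W := by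
    refine (hΦ.eventually (by simp)).and (hΦ.continuousAt.eventually ?_)
    rw [hp]; exact hW
  obtain ⟨δ, hδ, hδ'⟩ := Metric.eventually_nhds_iff.1 hev
  refine ⟨Φ, min ε (δ / 2), by positivity, min r (δ / 2), by positivity, fun x hx => ?_⟩
  have hx1 : x ∈ Metric.closedBall p r := Metric.closedBall_subset_closedBall (min_le_left _ _) hx
  have hc : IsCurveOn v (fun t => Φ (t, x)) (-ε) ε := (h x hx1).2
  have hc' := hc.mono (neg_le_neg (min_le_left ε (δ / 2))) (min_le_left ε (δ / 2))
  refine ⟨(h x hx1).1, fun t ht => hδ' ?_, hc', ?_⟩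
  · rw [Prod.dist_eq, sup_lt_iff, Real.dist_eq, sub_zero]
    have h1 : |t| ≤ δ / 2 := (abs_le.2 ht).trans (min_le_right _ _)
    have h2 : dist x p ≤ δ / 2 := hx.trans (min_le_right _ _)
    exact ⟨by linarith, by change dist x p < δ; linarith⟩
  · intro s t Z hs ht hs' ht' hZ hZ0 τ hτ
    exact hZ.eqOn hv1 (hc'.mono hs' ht') ⟨hs, ht⟩ (by rw [hZ0, (h x hx1).1]) hτ

end Curves

universe u

variable {E : Type} [NormedAddCommGroup E] [NormedSpace ℝ E]

/-- `w` solves the linear transport equation `w' = a w + b` along every integral curve of `L` in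
`U`. No differentiability of `w` in directions other than `L` is presupposed. -/
def IsTransported (U : Set E) (L : E → E) (a b w : E → ℂ) : Prop :=
  ∀ (s t : ℝ) (Y : ℝ → E), IsCurveOn L Y s t → (∀ τ ∈ Icc s t, Y τ ∈ U) →
    ∀ τ ∈ Icc s t, HasDerivWithinAt (fun σ => w (Y σ)) (a (Y τ) * w (Y τ) + b (Y τ)) (Icc s t) τ

/-- The graph of a solution along an integral curve is an integral curve of the augmented vector
field. -/
lemma IsTransported.isCurveOn_graph {U : Set E} {L : E → E} {a b w : E → ℂ}
    (hw : IsTransported U L a b w) {Y : ℝ → E} {s t : ℝ} (hY : IsCurveOn L Y s t)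
    (hU : ∀ τ ∈ Icc s t, Y τ ∈ U) :
    IsCurveOn (fun q : E × ℂ => (L q.1, a q.1 * q.2 + b q.1)) (fun τ => (Y τ, w (Y τ))) s t :=
  fun τ hτ => (hY τ hτ).prodMk (hw s t Y hY hU τ hτ)

variable [FiniteDimensional ℝ E]

/-- A solution of a transport equation is as smooth near `γ s₂` as it is near `γ s₁`. -/
theorem IsTransported.contDiffAt_propagate {ℓ : E →L[ℝ] ℝ} {ν : E} (hν : ℓ ν = 1) {e : E}
    (he : 0 < ℓ e) {L : E → E} {a b w : E → ℂ} {k : ℕ} (hk : k ≠ 0)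
    (hL : ContDiffWithinAt ℝ k L (halfSpace ℓ) e) (ha : ContDiffWithinAt ℝ k a (halfSpace ℓ) e)
    (hb : ContDiffWithinAt ℝ k b (halfSpace ℓ) e) {U : Set E} (hU : U ∈ 𝓝 e)
    (hw : IsTransported U L a b w) {γ : ℝ → E} {s t t₀ : ℝ} (ht₀ : t₀ ∈ Icc s t)
    (hγ : IsCurveOn L γ s t) (hγe : γ t₀ = e) :
    ∃ δ > 0, ∀ s₁ ∈ Icc s t, ∀ s₂ ∈ Icc s t, |s₁ - t₀| < δ → |s₂ - t₀| < δ →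
      ContDiffAt ℝ k w (γ s₁) → ContDiffAt ℝ k w (γ s₂) := by
  have heH : e ∈ halfSpace ℓ := he.le
  have hnhds : 𝓝[halfSpace ℓ] e = 𝓝 e := nhdsWithin_eq_nhds.2 (halfSpace_mem_nhds he)
  obtain ⟨L', hL'c, hL'⟩ := exists_contDiff_extension hν heH k hL
  obtain ⟨a', ha'c, ha'⟩ := exists_contDiff_extension hν heH k ha
  obtain ⟨b', hb'c, hb'⟩ := exists_contDiff_extension hν heH k hb
  rw [hnhds] at hL' ha' hb'
  have hW : {y | y ∈ U ∧ L' y = L y ∧ a' y = a y ∧ b' y = b y} ∈ 𝓝 e := by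
    filter_upwards [hU, hL', ha', hb'] with y h1 h2 h3 h4 using ⟨h1, h2, h3, h4⟩
  set W := {y | y ∈ U ∧ L' y = L y ∧ a' y = a y ∧ b' y = b y} with hWdef
  have hL1 : ContDiff ℝ 1 L' := hL'c.of_le (by exact_mod_cast Nat.one_le_iff_ne_zero.2 hk)
  obtain ⟨Ψ, ε₁, hε₁, r₁, hr₁, hΨ⟩ := exists_local_flow hk hL'c e hW
  have hvc : ContDiff ℝ k (fun q : E × ℂ => (L' q.1, a' q.1 * q.2 + b' q.1)) := by fun_prop
  obtain ⟨Φ, ε₂, hε₂, r₂, hr₂, hΦ⟩ := exists_local_flow hk hvc (e, w e) (univ_mem)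
  -- The curve and the solution along it stay close to their values at `t₀` for short times.
  obtain ⟨δ₁, hδ₁, hδ₁'⟩ : ∃ δ > 0, ∀ σ ∈ Icc s t, |σ - t₀| < δ →
      γ σ ∈ W ∧ γ σ ∈ Metric.ball e (min r₁ r₂) := by
    have := hγ.continuousOn t₀ ht₀
    have h2 : W ∩ Metric.ball e (min r₁ r₂) ∈ 𝓝 (γ t₀) := by
      rw [hγe]; exact inter_mem hW (Metric.ball_mem_nhds _ (by positivity))
    obtain ⟨δ, hδ, h⟩ := Metric.mem_nhdsWithin_iff.1 (this h2)
    exact ⟨δ, hδ, fun σ hσ h' => h ⟨by simpa [Real.dist_eq] using h', hσ⟩⟩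
  have hγW : ∀ σ₁ ∈ Icc s t, ∀ σ₂ ∈ Icc s t, |σ₁ - t₀| < δ₁ → |σ₂ - t₀| < δ₁ →
      IsCurveOn L' γ (min σ₁ σ₂) (max σ₁ σ₂) ∧ ∀ τ ∈ Icc (min σ₁ σ₂) (max σ₁ σ₂), γ τ ∈ W := by
    intro σ₁ h1 σ₂ h2 h3 h4
    have hsub : ∀ τ ∈ Icc (min σ₁ σ₂) (max σ₁ σ₂), γ τ ∈ W := by
      intro τ hτ
      rw [abs_lt] at h3 h4
      refine (hδ₁' τ ⟨(le_min h1.1 h2.1).trans hτ.1, hτ.2.trans (max_le h1.2 h2.2)⟩ ?_).1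
      rw [abs_lt]
      constructor
      · have : t₀ - δ₁ < min σ₁ σ₂ := lt_min (by linarith) (by linarith)
        linarith [hτ.1]
      · have : max σ₁ σ₂ < t₀ + δ₁ := max_lt (by linarith) (by linarith)
        linarith [hτ.2]
    exact ⟨(hγ.mono (le_min h1.1 h2.1) (max_le h1.2 h2.2)).congr_field
      fun τ hτ => (hsub τ hτ).2.1.symm, hsub⟩
  have hwγ : ∃ δ > 0, ∀ σ ∈ Icc s t, |σ - t₀| < δ → w (γ σ) ∈ Metric.ball (w e) r₂ := by
    -- restrict the curve to the part inside `W`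
    set s' := max s (t₀ - δ₁ / 2)
    set t' := min t (t₀ + δ₁ / 2)
    have hs' : s' ≤ t₀ := max_le ht₀.1 (by linarith)
    have ht' : t₀ ≤ t' := le_min ht₀.2 (by linarith)
    have hin : ∀ τ ∈ Icc s' t', γ τ ∈ U := fun τ hτ => by
      refine (hδ₁' τ ⟨(le_max_left _ _).trans hτ.1, hτ.2.trans (min_le_left _ _)⟩ ?_).1.1
      have h1 := (le_max_right s (t₀ - δ₁ / 2)).trans hτ.1
      have h2 := hτ.2.trans (min_le_right t (t₀ + δ₁ / 2))
      rw [abs_lt]; constructor <;> linarith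
    have hc := (hw s' t' γ (hγ.mono (le_max_left _ _) (min_le_left _ _)) hin t₀
      ⟨hs', ht'⟩).continuousWithinAt
    have hc2 : (fun σ => w (γ σ)) t₀ = w e := by simp [hγe]
    have h2 : Metric.ball (w e) r₂ ∈ 𝓝 ((fun σ => w (γ σ)) t₀) := by
      rw [hc2]; exact Metric.ball_mem_nhds _ hr₂
    obtain ⟨δ, hδ, h⟩ := Metric.mem_nhdsWithin_iff.1 (hc h2)
    refine ⟨min δ (δ₁ / 2), by positivity, fun σ hσ h' => h ⟨?_, ?_⟩⟩
    · simpa [Real.dist_eq] using h'.trans_le (min_le_left _ _)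
    · have := abs_lt.1 (h'.trans_le (min_le_right _ _))
      exact ⟨max_le hσ.1 (by linarith), le_min hσ.2 (by linarith)⟩
  obtain ⟨δ₂, hδ₂, hδ₂'⟩ := hwγ
  refine ⟨min (min δ₁ δ₂) (min (ε₁ / 2) (min (ε₂ / 2) r₂)), by positivity, ?_⟩
  intro s₁ hs₁ s₂ hs₂ h1 h2 hsm
  simp only [lt_min_iff] at h1 h2
  obtain ⟨⟨h1a, h1b⟩, h1c, h1d, -⟩ := h1
  obtain ⟨⟨h2a, h2b⟩, h2c, h2d, -⟩ := h2
  set d := s₂ - s₁ with hd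
  have hdε₁ : |d| ≤ ε₁ := by
    rw [abs_le]; rw [abs_lt] at h1c h2c; constructor <;> linarith
  have hdε₂ : |d| ≤ ε₂ := by
    rw [abs_le]; rw [abs_lt] at h1d h2d; constructor <;> linarith
  have hd1 := abs_le.1 hdε₁
  have hd2 := abs_le.1 hdε₂
  have hγ2 := Metric.ball_subset_ball (min_le_left _ _) (hδ₁' s₂ hs₂ h2a).2
  have hback : Ψ (-d, γ s₂) = γ s₁ := by
    have hcur := (hγW s₁ hs₁ s₂ hs₂ h1a h2a).1
    have hsh : IsCurveOn L' (fun σ => γ (σ + s₂)) (min s₁ s₂ - s₂) (max s₁ s₂ - s₂) :=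
      IsCurveOn.shift s₂ (by simpa using hcur)
    have := (hΨ (γ s₂) (Metric.ball_subset_closedBall hγ2)).2.2.2 (min s₁ s₂ - s₂)
      (max s₁ s₂ - s₂) _ (by linarith [min_le_right s₁ s₂]) (by linarith [le_max_right s₁ s₂])
      (by rcases min_choice s₁ s₂ with h | h <;> rw [h] <;> linarith)
      (by rcases max_choice s₁ s₂ with h | h <;> rw [h] <;> linarith) hsh (by simp) (-d)
      ⟨by linarith [min_le_left s₁ s₂], by linarith [le_max_left s₁ s₂]⟩
    rw [← this]
    simp [hd]
  have hdmem : -d ∈ Icc (-ε₁) ε₁ := ⟨by linarith, by linarith⟩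
  have hin : ContDiffAt ℝ k (fun y => Ψ (-d, y)) (γ s₂) := by
    have h := ((hΨ (γ s₂) (Metric.ball_subset_closedBall hγ2)).2.1 (-d) hdmem).1
    exact ContDiffAt.comp (γ s₂) (f := fun y => (-d, y)) h (by fun_prop)
  have hwin : ContDiffAt ℝ k (fun y => w (Ψ (-d, y))) (γ s₂) :=
    ContDiffAt.comp (γ s₂) (g := w) (by rw [hback]; exact hsm) hin
  have hmem : (γ s₁, w (γ s₁)) ∈ Metric.ball (e, w e) r₂ := by
    rw [← ball_prod_same]
    exact ⟨Metric.ball_subset_ball (min_le_right _ _) (hδ₁' s₁ hs₁ h1a).2, hδ₂' s₁ hs₁ h1b⟩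
  have hfin : ContDiffAt ℝ k (fun y => (Φ (d, (Ψ (-d, y), w (Ψ (-d, y))))).2) (γ s₂) := by
    have h := ((hΦ _ (Metric.ball_subset_closedBall hmem)).2.1 d ⟨by linarith, by linarith⟩).1
    refine contDiffAt_snd.comp _ (ContDiffAt.comp (γ s₂)
      (f := fun y => (d, (Ψ (-d, y), w (Ψ (-d, y))))) ?_ (contDiffAt_const.prodMk (hin.prodMk hwin)))
    rw [hback]; exact h
  refine hfin.congr_of_eventuallyEq ?_
  have hev : ∀ᶠ y in 𝓝 (γ s₂), (Ψ (-d, y), w (Ψ (-d, y))) ∈ Metric.ball (e, w e) r₂ := by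
    have hc : ContinuousAt (fun y => (Ψ (-d, y), w (Ψ (-d, y)))) (γ s₂) :=
      hin.continuousAt.prodMk hwin.continuousAt
    refine hc.eventually (Metric.isOpen_ball.mem_nhds ?_)
    simp only [hback]; exact hmem
  filter_upwards [hev, Metric.isOpen_ball.mem_nhds hγ2] with y hy1 hy2
  obtain ⟨hy0, hyW, hyc, -⟩ := hΨ y (Metric.ball_subset_closedBall hy2)
  have hsub : ∀ τ ∈ Icc (min 0 (-d)) (max 0 (-d)), τ ∈ Icc (-ε₁) ε₁ := fun τ hτ =>
    ⟨(le_min (by linarith) (by linarith)).trans hτ.1, hτ.2.trans (max_le (by linarith) (by linarith))⟩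
  have hcY : IsCurveOn L (fun τ => Ψ (τ, y)) (min 0 (-d)) (max 0 (-d)) :=
    (hyc.mono (le_min (by linarith) (by linarith)) (max_le (by linarith) (by linarith))).congr_field
      fun τ hτ => (hyW τ (hsub τ hτ)).2.2.1
  have hgr := (hw.isCurveOn_graph hcY fun τ hτ => (hyW τ (hsub τ hτ)).2.1).congr_field
    (v' := fun q : E × ℂ => (L' q.1, a' q.1 * q.2 + b' q.1))
    fun τ hτ => by
      obtain ⟨-, -, e1, e2, e3⟩ := hyW τ (hsub τ hτ)
      simp only [e1, e2, e3]
  have hgr' : IsCurveOn (fun q : E × ℂ => (L' q.1, a' q.1 * q.2 + b' q.1))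
      (fun σ => (Ψ (σ + -d, y), w (Ψ (σ + -d, y)))) (min 0 (-d) + d) (max 0 (-d) + d) :=
    IsCurveOn.shift (Y := fun τ => (Ψ (τ, y), w (Ψ (τ, y)))) (-d) (by simpa using hgr)
  have := (hΦ _ (Metric.ball_subset_closedBall hy1)).2.2.2 _ _ _
    (by linarith [min_le_right 0 (-d)]) (by linarith [le_max_right 0 (-d)])
    (by rcases min_choice 0 (-d) with h | h <;> rw [h] <;> linarith)
    (by rcases max_choice 0 (-d) with h | h <;> rw [h] <;> linarith) hgr' (by simp) d
    ⟨by linarith [min_le_left 0 (-d)], by linarith [le_max_left 0 (-d)]⟩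
  rw [← this]
  simp [hy0]

/-- A solution of a transport equation which vanishes on the boundary is smooth up to the boundary
near each boundary point at which the vector field is transversal to the boundary: it is obtained
by following the flow line to the boundary, and the implicit function theorem shows that the time
which this takes is smooth. -/
theorem IsTransported.contDiffWithinAt_of_transversal {ℓ : E →L[ℝ] ℝ} {ν : E} (hν : ℓ ν = 1) {e : E}
    (he : ℓ e = 0) {L : E → E} {a b w : E → ℂ} {k : ℕ} (hk : k ≠ 0)
    (hL : ContDiffWithinAt ℝ k L (halfSpace ℓ) e) (ha : ContDiffWithinAt ℝ k a (halfSpace ℓ) e)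
    (hb : ContDiffWithinAt ℝ k b (halfSpace ℓ) e) {U : Set E} (hU : U ∈ 𝓝[halfSpace ℓ] e)
    (hw : IsTransported U L a b w) (hw0 : ∀ y ∈ U, ℓ y = 0 → w y = 0) (htr : ℓ (L e) ≠ 0) :
    ContDiffWithinAt ℝ k w (halfSpace ℓ) e := by
  have heH : e ∈ halfSpace ℓ := he.ge
  obtain ⟨L', hL'c, hL'⟩ := exists_contDiff_extension hν heH k hL
  obtain ⟨a', ha'c, ha'⟩ := exists_contDiff_extension hν heH k ha
  obtain ⟨b', hb'c, hb'⟩ := exists_contDiff_extension hν heH k hb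
  have hL'e : L' e = L e := hL'.self_of_nhdsWithin heH
  have hvc : ContDiff ℝ k (fun q : E × ℂ => (L' q.1, a' q.1 * q.2 + b' q.1)) := by fun_prop
  obtain ⟨Φ, ε₂, hε₂, r₂, hr₂, hΦ⟩ := exists_local_flow hk hvc (e, (0 : ℂ)) (univ_mem)
  have hW : {y | (y ∈ halfSpace ℓ → y ∈ U ∧ L' y = L y ∧ a' y = a y ∧ b' y = b y) ∧
      0 < ℓ (L e) * ℓ (L' y) ∧ y ∈ Metric.ball e r₂} ∈ 𝓝 e := by
    have h1 : ∀ᶠ y in 𝓝[halfSpace ℓ] e, y ∈ U ∧ L' y = L y ∧ a' y = a y ∧ b' y = b y := by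
      filter_upwards [hU, hL', ha', hb'] with y h1 h2 h3 h4 using ⟨h1, h2, h3, h4⟩
    have h2 : ∀ᶠ y in 𝓝 e, 0 < ℓ (L e) * ℓ (L' y) := by
      have hc : Continuous fun y => ℓ (L e) * ℓ (L' y) :=
        continuous_const.mul (ℓ.continuous.comp hL'c.continuous)
      refine hc.continuousAt.eventually (lt_mem_nhds ?_)
      simp only [hL'e]; exact mul_self_pos.2 htr
    filter_upwards [eventually_nhdsWithin_iff.1 h1, h2, Metric.ball_mem_nhds e hr₂] with y h1 h2 h3
      using ⟨h1, h2, h3⟩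
  obtain ⟨Ψ, ε₁, hε₁, r₁, hr₁, hΨ⟩ := exists_local_flow hk hL'c e hW
  have hΨe := hΨ e (Metric.mem_closedBall_self hr₁.le)
  have hk' : (k : WithTop ℕ∞) ≠ 0 := by exact_mod_cast hk
  -- The time needed to reach the boundary.
  have hΘ : ContDiffAt ℝ k (fun q : E × ℝ => ℓ (Ψ (q.2, q.1))) (e, 0) := by
    refine ℓ.contDiff.contDiffAt.comp _ (ContDiffAt.comp (e, (0 : ℝ))
      (f := fun q : E × ℝ => (q.2, q.1)) ?_ (by fun_prop))
    exact (hΨe.2.1 0 ⟨by linarith, hε₁.le⟩).1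
  have hinv : (fderiv ℝ (fun q : E × ℝ => ℓ (Ψ (q.2, q.1))) (e, 0) ∘L .inr ℝ E ℝ).IsInvertible := by
    have h1 : HasFDerivAt (fun t => ℓ (Ψ (t, e)))
        (fderiv ℝ (fun q : E × ℝ => ℓ (Ψ (q.2, q.1))) (e, 0) ∘L .inr ℝ E ℝ) 0 :=
      HasFDerivAt.comp (g := fun q : E × ℝ => ℓ (Ψ (q.2, q.1))) (f := fun t => (e, t)) (0 : ℝ)
        (hΘ.differentiableAt hk').hasFDerivAt (hasFDerivAt_prodMk_right (𝕜 := ℝ) e (0 : ℝ))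
    have h2 : HasDerivAt (fun t => ℓ (Ψ (t, e))) (ℓ (L e)) 0 := by
      have := (hΨe.2.2.1 0 ⟨by linarith, hε₁.le⟩).hasDerivAt (Icc_mem_nhds (by linarith) hε₁)
      have h3 := ℓ.hasFDerivAt.comp_hasDerivAt (0 : ℝ) this
      simp only [hΨe.1, hL'e] at h3
      exact h3
    rw [h1.unique h2.hasFDerivAt]
    refine ⟨ContinuousLinearEquiv.smulLeft (Units.mk0 _ htr), ?_⟩
    ext
    simp
  set T := hΘ.implicitFunction hk' hinv with hT
  have hTc : ContDiffAt ℝ k T e := hΘ.contDiffAt_implicitFunction hk' hinv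
  have hTe : T e = 0 := hΘ.implicitFunction_apply_self hk' hinv
  have hTz : ∀ᶠ y in 𝓝 e, ℓ (Ψ (T y, y)) = 0 := by
    have := hΘ.eventually_apply_implicitFunction hk' hinv
    simpa [hΨe.1, he] using this
  have hqc : ContDiffAt ℝ k (fun y => Ψ (T y, y)) e := by
    refine ContDiffAt.comp e (f := fun y => (T y, y)) ?_ (hTc.prodMk contDiffAt_id)
    rw [hTe]
    exact (hΨe.2.1 0 ⟨by linarith, hε₁.le⟩).1
  have hfin : ContDiffAt ℝ k (fun y => (Φ (-T y, (Ψ (T y, y), 0))).2) e := by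
    refine contDiffAt_snd.comp _ (ContDiffAt.comp e (f := fun y => (-T y, (Ψ (T y, y), (0 : ℂ)))) ?_
      (hTc.neg.prodMk (hqc.prodMk contDiffAt_const)))
    rw [hTe, hΨe.1, neg_zero]
    exact ((hΦ _ (Metric.mem_closedBall_self hr₂.le)).2.1 0 ⟨by linarith, hε₂.le⟩).1
  have hTs : ∀ᶠ y in 𝓝 e, |T y| < min ε₁ ε₂ := by
    have := hTc.continuousAt.abs
    refine this.eventually (gt_mem_nhds ?_)
    simp only [hTe, abs_zero]; positivity
  have hev : ∀ᶠ y in 𝓝[halfSpace ℓ] e, w y = (Φ (-T y, (Ψ (T y, y), 0))).2 := by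
    filter_upwards [self_mem_nhdsWithin, mem_nhdsWithin_of_mem_nhds hTs,
      mem_nhdsWithin_of_mem_nhds hTz,
      mem_nhdsWithin_of_mem_nhds (Metric.closedBall_mem_nhds e hr₁)] with y hyH hyT hyz hyr
    obtain ⟨hy0, hyW, hyc, -⟩ := hΨ y hyr
    rw [lt_min_iff, abs_lt, abs_lt] at hyT
    obtain ⟨⟨h1, h2⟩, h3, h4⟩ := hyT
    set d := T y
    have hsub : ∀ τ ∈ Icc (min 0 d) (max 0 d), τ ∈ Icc (-ε₁) ε₁ := fun τ hτ =>
      ⟨(le_min (by linarith) (by linarith)).trans hτ.1,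
        hτ.2.trans (max_le (by linarith) (by linarith))⟩
    have hcY' : IsCurveOn L' (fun τ => Ψ (τ, y)) (min 0 d) (max 0 d) :=
      hyc.mono (le_min (by linarith) (by linarith)) (max_le (by linarith) (by linarith))
    -- Along the flow line `ℓ` is monotone, hence nonnegative.
    have hpos : ∀ τ ∈ Icc (min 0 d) (max 0 d), Ψ (τ, y) ∈ halfSpace ℓ := by
      have hfc : ContinuousOn (fun τ => ℓ (Ψ (τ, y))) (Icc (min 0 d) (max 0 d)) :=
        ℓ.continuous.comp_continuousOn hcY'.continuousOn
      have hfd : ∀ τ ∈ interior (Icc (min 0 d) (max 0 d)),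
          HasDerivAt (fun τ => ℓ (Ψ (τ, y))) (ℓ (L' (Ψ (τ, y)))) τ := fun τ hτ => by
        have := (hcY' τ (interior_subset hτ)).hasDerivAt (mem_interior_iff_mem_nhds.1 hτ)
        exact ℓ.hasFDerivAt.comp_hasDerivAt τ this
      have hy' : (0 : ℝ) ≤ ℓ y := hyH
      have hm0 : (0 : ℝ) ∈ Icc (min 0 d) (max 0 d) := ⟨min_le_left _ _, le_max_left _ _⟩
      have hmd : d ∈ Icc (min 0 d) (max 0 d) := ⟨min_le_right _ _, le_max_right _ _⟩
      intro τ hτ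
      change 0 ≤ ℓ (Ψ (τ, y))
      rcases lt_or_gt_of_ne htr with hneg | hpos
      · have hanti : AntitoneOn (fun τ => ℓ (Ψ (τ, y))) (Icc (min 0 d) (max 0 d)) :=
          antitoneOn_of_deriv_nonpos (convex_Icc _ _) hfc
            (fun τ hτ => (hfd τ hτ).differentiableAt.differentiableWithinAt) fun τ hτ => by
              rw [(hfd τ hτ).deriv]
              have := (hyW τ (hsub τ (interior_subset hτ))).2.2.1
              nlinarith
        rcases le_total 0 d with hd | hd
        · have := hanti hτ hmd (by simpa [hd] using hτ.2)
          simp only [hyz] at this; exact this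
        · have := hanti hτ hm0 (by simpa [hd] using hτ.2)
          simp only [hy0] at this; linarith
      · have hmono : MonotoneOn (fun τ => ℓ (Ψ (τ, y))) (Icc (min 0 d) (max 0 d)) :=
          monotoneOn_of_deriv_nonneg (convex_Icc _ _) hfc
            (fun τ hτ => (hfd τ hτ).differentiableAt.differentiableWithinAt) fun τ hτ => by
              rw [(hfd τ hτ).deriv]
              have := (hyW τ (hsub τ (interior_subset hτ))).2.2.1
              nlinarith
        rcases le_total 0 d with hd | hd
        · have := hmono hm0 hτ (by simpa [hd] using hτ.1)
          simp only [hy0] at this; linarith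
        · have := hmono hmd hτ (by simpa [hd] using hτ.1)
          simp only [hyz] at this; exact this
    have hmemW := fun τ hτ => (hyW τ (hsub τ hτ)).2.1 (hpos τ hτ)
    have hcY : IsCurveOn L (fun τ => Ψ (τ, y)) (min 0 d) (max 0 d) :=
      hcY'.congr_field fun τ hτ => (hmemW τ hτ).2.1
    have hgr := (hw.isCurveOn_graph hcY fun τ hτ => (hmemW τ hτ).1).congr_field
      (v' := fun q : E × ℂ => (L' q.1, a' q.1 * q.2 + b' q.1))
      fun τ hτ => by
        obtain ⟨-, e1, e2, e3⟩ := hmemW τ hτ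
        simp only [e1, e2, e3]
    have hgr' : IsCurveOn (fun q : E × ℂ => (L' q.1, a' q.1 * q.2 + b' q.1))
        (fun σ => (Ψ (σ + d, y), w (Ψ (σ + d, y)))) (min 0 d - d) (max 0 d - d) :=
      IsCurveOn.shift (Y := fun τ => (Ψ (τ, y), w (Ψ (τ, y)))) d (by simpa using hgr)
    have hdm : d ∈ Icc (min 0 d) (max 0 d) := ⟨min_le_right _ _, le_max_right _ _⟩
    have hwq : w (Ψ (d, y)) = 0 := hw0 _ (hmemW d hdm).1 hyz
    have hqm : (Ψ (d, y), (0 : ℂ)) ∈ Metric.closedBall (e, (0 : ℂ)) r₂ := by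
      rw [← closedBall_prod_same]
      exact ⟨Metric.ball_subset_closedBall (hyW d (hsub d hdm)).2.2.2,
        Metric.mem_closedBall_self hr₂.le⟩
    have := (hΦ _ hqm).2.2.2 _ _ _
      (by linarith [min_le_right 0 d]) (by linarith [le_max_right 0 d])
      (by rcases min_choice 0 d with h | h <;> rw [h] <;> linarith)
      (by rcases max_choice 0 d with h | h <;> rw [h] <;> linarith) hgr' (by simp [hwq]) (-d)
      ⟨by linarith [min_le_left 0 d], by linarith [le_max_left 0 d]⟩
    rw [← this]
    simp [hy0]
  exact hfin.contDiffWithinAt.congr_of_eventuallyEq hev (hev.self_of_nhdsWithin heH)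

end Transport

/-! ### Short chords near glancing points -/

section Chords

/-- A function with second derivative at most `-c` which starts with a positive value and whose
Taylor bound at `T` is negative reaches zero transversally. -/
lemma exists_transversal_zero {f m m' : ℝ → ℝ} {T c : ℝ} (hT : 0 < T) (hc : 0 < c)
    (hf : ∀ t ∈ Icc 0 T, HasDerivWithinAt f (m t) (Icc 0 T) t)
    (hm : ∀ t ∈ Icc 0 T, HasDerivWithinAt m (m' t) (Icc 0 T) t)
    (hm' : ∀ t ∈ Icc 0 T, m' t ≤ -c) (h0 : 0 < f 0) (hT0 : f 0 + m 0 * T < c * T ^ 2 / 2) :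
    ∃ b ∈ Ioc 0 T, f b = 0 ∧ m b < 0 ∧ ∀ t ∈ Ico 0 b, 0 < f t := by
  have hfc : ContinuousOn f (Icc 0 T) := fun t ht => (hf t ht).continuousWithinAt
  have hmc : ContinuousOn m (Icc 0 T) := fun t ht => (hm t ht).continuousWithinAt
  have hder : ∀ {p p' : ℝ → ℝ}, (∀ t ∈ Icc 0 T, HasDerivWithinAt p (p' t) (Icc 0 T) t) →
      (∀ t ∈ Icc 0 T, p' t ≤ 0) → AntitoneOn p (Icc 0 T) := by
    intro p p' hp hp'
    refine antitoneOn_of_hasDerivWithinAt_nonpos (f' := p') (convex_Icc 0 T)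
      (fun t ht => (hp t ht).continuousWithinAt)
      (fun t ht => (hp t (interior_subset ht)).mono interior_subset)
      (fun t ht => hp' t (interior_subset ht))
  have hq : AntitoneOn (fun t => m t + c * t) (Icc 0 T) :=
    hder (p' := fun t => m' t + c * 1) (fun t ht => (hm t ht).add
      ((hasDerivWithinAt_id t _).const_mul c)) (fun t ht => by linarith [hm' t ht])
  have hz : (0 : ℝ) ∈ Icc 0 T := ⟨le_rfl, hT.le⟩
  have hp : AntitoneOn (fun t => f t + c * t ^ 2 / 2 - m 0 * t) (Icc 0 T) := by
    refine hder (p' := fun t => m t + c * t - m 0) (fun t ht => ?_) (fun t ht => ?_)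
    · have h1 : HasDerivWithinAt (fun t : ℝ => c * t ^ 2 / 2) (c * t) (Icc 0 T) t := by
        have := (((hasDerivAt_id t).pow 2).const_mul c).div_const 2
        simp only [id] at this
        convert! this.hasDerivWithinAt using 1
        norm_num; ring
      have h2 : HasDerivWithinAt (fun t : ℝ => m 0 * t) (m 0) (Icc 0 T) t := by
        simpa using ((hasDerivWithinAt_id t (Icc 0 T)).const_mul (m 0))
      exact ((hf t ht).add h1).sub h2
    · have := hq hz ht ht.1
      simp only [mul_zero, add_zero] at this
      linarith
  have hfT : f T < 0 := by
    have := hp hz ⟨hT.le, le_rfl⟩ hT.le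
    simp only at this
    nlinarith
  -- The first zero.
  have hcomp : IsCompact (Icc 0 T ∩ f ⁻¹' Iic 0) :=
    isCompact_Icc.of_isClosed_subset (hfc.preimage_isClosed_of_isClosed isClosed_Icc isClosed_Iic)
      inter_subset_left
  obtain ⟨b, hb, hbl⟩ := hcomp.exists_isLeast ⟨T, ⟨hT.le, le_rfl⟩, hfT.le⟩
  have hbI : b ∈ Icc 0 T := hb.1
  have hpos : ∀ t ∈ Ico 0 b, 0 < f t := fun t ht => by
    by_contra! h
    exact absurd (hbl ⟨⟨ht.1, ht.2.le.trans hbI.2⟩, h⟩) (not_le.2 ht.2)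
  have hb0 : 0 < b := by
    rcases hbI.1.eq_or_lt with h | h
    · have : f b ≤ 0 := hb.2
      rw [← h] at this; linarith
    · exact h
  have hfb : f b = 0 := by
    refine le_antisymm hb.2 ?_
    have h1 : ContinuousWithinAt f (Ico 0 b) b :=
      (hfc b hbI).mono (Ico_subset_Icc_self.trans (Icc_subset_Icc_right hbI.2))
    have hne : (𝓝[Ico 0 b] b).NeBot := by
      rw [← mem_closure_iff_nhdsWithin_neBot, closure_Ico hb0.ne]
      exact ⟨hb0.le, le_rfl⟩
    exact ge_of_tendsto h1 (eventually_mem_nhdsWithin.mono fun t ht => (hpos t ht).le)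
  refine ⟨b, ⟨hb0, hbI.2⟩, hfb, ?_, hpos⟩
  by_contra! hmb
  have hsub : Icc 0 b ⊆ Icc 0 T := Icc_subset_Icc_right hbI.2
  have hmono : MonotoneOn f (Icc 0 b) := by
    refine monotoneOn_of_hasDerivWithinAt_nonneg (f' := m) (convex_Icc 0 b) (hfc.mono hsub)
      (fun t ht => (hf t (hsub (interior_subset ht))).mono (interior_subset.trans hsub))
      (fun t ht => ?_)
    have ht' := interior_subset ht
    have := hq (hsub ht') hbI ht'.2
    simp only at this
    nlinarith [ht'.2]
  have := hmono ⟨le_rfl, hb0.le⟩ ⟨hb0.le, le_rfl⟩ hb0.le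
  linarith

variable {E : Type*} [NormedAddCommGroup E] [NormedSpace ℝ E] [FiniteDimensional ℝ E]

/-- Near a glancing point with strictly convex contact, each interior point lies on a short chord:
an integral curve which leaves the half-space transversally at both ends after a short time. -/
theorem exists_chord {ℓ : E →L[ℝ] ℝ} {L : E → E} (hL : ContDiff ℝ 1 L) {g : E}
    (hg : ℓ g = 0) (hg0 : ℓ (L g) = 0) (hg1 : ℓ (fderiv ℝ L g (L g)) < 0) {η : ℝ} (hη : 0 < η) :
    ∀ᶠ y in 𝓝 g, 0 < ℓ y → ∃ a b Y, a < 0 ∧ 0 < b ∧ -η ≤ a ∧ b ≤ η ∧ IsCurveOn L Y a b ∧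
      Y 0 = y ∧ (∀ τ ∈ Icc a b, Y τ ∈ Metric.ball g η) ∧ (∀ τ ∈ Ioo a b, 0 < ℓ (Y τ)) ∧
      ℓ (Y a) = 0 ∧ ℓ (Y b) = 0 ∧ 0 < ℓ (L (Y a)) ∧ ℓ (L (Y b)) < 0 := by
  have hL' : Continuous fun y => ℓ (fderiv ℝ L y (L y)) :=
    ℓ.continuous.comp ((hL.continuous_fderiv (by simp)).clm_apply hL.continuous)
  set c := -ℓ (fderiv ℝ L g (L g)) / 2 with hcdef
  have hc : 0 < c := by rw [hcdef]; linarith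
  have hW : {y | y ∈ Metric.ball g η ∧ ℓ (fderiv ℝ L y (L y)) < -c} ∈ 𝓝 g := by
    refine inter_mem (Metric.ball_mem_nhds g hη) (hL'.continuousAt.eventually (gt_mem_nhds ?_))
    rw [hcdef]; linarith
  obtain ⟨Ψ, ε, hε, r, hr, hΨ⟩ := exists_local_flow (k := 1) one_ne_zero (by exact_mod_cast hL) g hW
  set T := min ε η with hTdef
  have hT : 0 < T := lt_min hε hη
  have hsmall : ∀ᶠ y in 𝓝 g, ℓ y + |ℓ (L y)| * T < c * T ^ 2 / 2 := by
    have hcont : Continuous fun y => ℓ y + |ℓ (L y)| * T :=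
      ℓ.continuous.add (((ℓ.continuous.comp hL.continuous).abs).mul continuous_const)
    refine hcont.continuousAt.eventually (gt_mem_nhds ?_)
    simp only [hg, hg0]
    simp only [abs_zero, zero_mul, add_zero]
    positivity
  filter_upwards [hsmall, Metric.closedBall_mem_nhds g hr] with y hy hyr hy0
  obtain ⟨hΨ0, hΨW, hΨc, -⟩ := hΨ y hyr
  have hcT : IsCurveOn L (fun t => Ψ (t, y)) (-T) T :=
    hΨc.mono (neg_le_neg (min_le_left _ _)) (min_le_left _ _)
  have hΨW' : ∀ t ∈ Icc (-T) T, Ψ (t, y) ∈ Metric.ball g η ∧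
      ℓ (fderiv ℝ L (Ψ (t, y)) (L (Ψ (t, y)))) < -c := fun t ht =>
    (hΨW t ⟨(neg_le_neg (min_le_left _ _)).trans ht.1, ht.2.trans (min_le_left _ _)⟩).2
  have hf : ∀ t ∈ Icc (-T) T, HasDerivWithinAt (fun t => ℓ (Ψ (t, y))) (ℓ (L (Ψ (t, y))))
      (Icc (-T) T) t := fun t ht => ℓ.hasFDerivAt.comp_hasDerivWithinAt t (hcT t ht)
  have hm : ∀ t ∈ Icc (-T) T, HasDerivWithinAt (fun t => ℓ (L (Ψ (t, y))))
      (ℓ (fderiv ℝ L (Ψ (t, y)) (L (Ψ (t, y))))) (Icc (-T) T) t := fun t ht => by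
    have h1 := ((hL.differentiable (by simp)) (Ψ (t, y))).hasFDerivAt
    exact ℓ.hasFDerivAt.comp_hasDerivWithinAt t (h1.comp_hasDerivWithinAt t (hcT t ht))
  have hsub : Icc 0 T ⊆ Icc (-T) T := Icc_subset_Icc_left (by linarith)
  obtain ⟨b, hb, hfb, hmb, hposb⟩ := exists_transversal_zero hT hc
    (fun t ht => (hf t (hsub ht)).mono hsub) (fun t ht => (hm t (hsub ht)).mono hsub)
    (fun t ht => (hΨW' t (hsub ht)).2.le) (by rw [hΨ0]; exact hy0)
    (by rw [hΨ0]; nlinarith [le_abs_self (ℓ (L y))])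
  have hneg : ∀ t ∈ Icc (0 : ℝ) T, -t ∈ Icc (-T) T := fun t ht =>
    ⟨by linarith [ht.2], by linarith [ht.1]⟩
  have hrev : ∀ {p : ℝ → ℝ} {p' t : ℝ}, t ∈ Icc (0 : ℝ) T →
      HasDerivWithinAt p p' (Icc (-T) T) (-t) →
      HasDerivWithinAt (fun t => p (-t)) (-p') (Icc 0 T) t := by
    intro p p' t ht hp
    have h1 : HasDerivWithinAt (fun t : ℝ => -t) (-1) (Icc 0 T) t :=
      (hasDerivAt_neg t).hasDerivWithinAt
    simpa [Function.comp_def] using hp.comp t h1 hneg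
  obtain ⟨a, ha, hfa, hma, hposa⟩ := exists_transversal_zero (f := fun t => ℓ (Ψ (-t, y)))
    (m := fun t => -ℓ (L (Ψ (-t, y))))
    (m' := fun t => ℓ (fderiv ℝ L (Ψ (-t, y)) (L (Ψ (-t, y))))) hT hc
    (fun t ht => hrev ht (hf _ (hneg t ht)))
    (fun t ht => by simpa using (hrev ht (hm _ (hneg t ht))).fun_neg)
    (fun t ht => (hΨW' _ (hneg t ht)).2.le) (by simp only [neg_zero, hΨ0]; exact hy0)
    (by simp only [neg_zero, hΨ0]; nlinarith [neg_abs_le (ℓ (L y))])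
  have hTη : T ≤ η := min_le_right _ _
  refine ⟨-a, b, fun t => Ψ (t, y), by linarith [ha.1], hb.1, by linarith [ha.2],
    hb.2.trans hTη, hcT.mono (by linarith [ha.2]) hb.2, hΨ0, fun τ hτ =>
      (hΨW' τ ⟨by linarith [hτ.1, ha.2], hτ.2.trans hb.2⟩).1, fun τ hτ => ?_, hfa, hfb, ?_, hmb⟩
  · rcases le_total 0 τ with h | h
    · exact hposb τ ⟨h, hτ.2⟩
    · have := hposa (-τ) ⟨by linarith, by linarith [hτ.1]⟩
      simpa using this
  · have : -ℓ (L (Ψ (-a, y))) < 0 := hma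
    linarith

end Chords

/-! ### Division of smooth functions -/

section Division

variable {E F : Type} [NormedAddCommGroup E] [NormedSpace ℝ E] [FiniteDimensional ℝ E]
  [NormedAddCommGroup F] [NormedSpace ℝ F]

lemma exists_contDiff_eventuallyEq {f : E → F} {O : Set E} (hO : IsOpen O)
    (hf : ContDiffOn ℝ ∞ f O) {g : E} (hg : g ∈ O) :
    ∃ f₁ : E → F, ContDiff ℝ ∞ f₁ ∧ f₁ =ᶠ[𝓝 g] f := by
  obtain ⟨r, hr, hrO⟩ := Metric.isOpen_iff.1 hO g hg
  let χ : ContDiffBump g := ⟨r / 4, r / 2, by positivity, by linarith⟩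
  refine ⟨fun y => χ y • f y, contDiff_iff_contDiffAt.2 fun y => ?_, ?_⟩
  · by_cases hy : y ∈ Metric.ball g r
    · exact χ.contDiffAt.smul ((hf y (hrO hy)).contDiffAt (hO.mem_nhds (hrO hy)))
    · have hy' : y ∉ tsupport χ := fun h => hy (by
        rw [χ.tsupport_eq] at h
        exact Metric.closedBall_subset_ball (by change r / 2 < r; linarith) h)
      have h0 : (fun y => χ y • f y) =ᶠ[𝓝 y] fun _ => 0 := by
        filter_upwards [(isClosed_tsupport χ).isOpen_compl.mem_nhds hy'] with z hz
        rw [image_eq_zero_of_notMem_tsupport hz, zero_smul]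
      exact contDiffAt_const.congr_of_eventuallyEq h0
  · filter_upwards [Metric.ball_mem_nhds g (show 0 < r / 4 by positivity)] with y hy
    rw [χ.one_of_mem_closedBall (Metric.ball_subset_closedBall hy), one_smul]

omit [FiniteDimensional ℝ E] in
/-- The average of a smooth function over segments depending smoothly on a parameter is smooth. -/
lemma contDiffOn_segment_average [CompleteSpace F] {f : E → F} (hf : ContDiff ℝ ∞ f) {σ : E → ℝ}
    {O : Set E} (hσ : ContDiffOn ℝ ∞ σ O) (v : E) :
    ContDiffOn ℝ ∞ (fun y => ∫ θ in (0 : ℝ)..1, f (y + (θ * σ y) • v)) O := by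
  let ζ : C(unitInterval, E) := ⟨fun θ => (θ : ℝ) • v, by fun_prop⟩
  rw [contDiffOn_infty] at hσ ⊢
  intro k
  have h1 : ContDiffOn ℝ k (fun y => constCLM E y + σ y • ζ) O :=
    ((constCLM E).contDiff.contDiffOn).add ((hσ k).smul contDiffOn_const)
  have hfk : ContDiff ℝ k f := hf.of_le (by exact_mod_cast le_top)
  have h2 := (contDiff_superposition (K := unitInterval) k hfk hf.continuous).comp_contDiffOn h1
  have h3 := (ContinuousMap.evalCLM ℝ (M := F) (1 : unitInterval)).contDiff.comp_contDiffOn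
    ((integrationCLM (E := F)).contDiff.comp_contDiffOn h2)
  refine h3.congr fun y _ => ?_
  change _ = integrationCLM _ _
  rw [integrationCLM_apply]
  refine intervalIntegral.integral_congr fun θ hθ => ?_
  have hθ' : θ ∈ Icc (0 : ℝ) 1 := by rw [← uIcc_of_le zero_le_one]; exact hθ
  rw [IccExtend_of_mem zero_le_one _ hθ']
  change f _ = f (y + σ y • θ • v)
  rw [smul_smul, mul_comm]

/-- **Division**: a smooth function which vanishes on the regular hypersurface `{m = 0}` is a smooth
multiple of `m`. -/
theorem exists_contDiffOn_smul_eq [CompleteSpace F] {h : E → F} {m : E → ℝ} (hh : ContDiff ℝ ∞ h)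
    (hm : ContDiff ℝ ∞ m) {g v : E} (hg : m g = 0) (hv : fderiv ℝ m g v ≠ 0)
    (h0 : ∀ᶠ z in 𝓝 g, m z = 0 → h z = 0) :
    ∃ k : E → F, ∃ O : Set E, IsOpen O ∧ g ∈ O ∧ ContDiffOn ℝ ∞ k O ∧ ∀ y ∈ O, h y = m y • k y := by
  -- `σ y` is the time at which the line through `y` in direction `v` meets `{m = 0}`.
  let Θ : E × ℝ → ℝ := fun q => m (q.1 + q.2 • v)
  have hΘ : ContDiff ℝ ∞ Θ := hm.comp (by fun_prop)
  have hinv : ∀ u : E × ℝ, fderiv ℝ m (u.1 + u.2 • v) v ≠ 0 →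
      (fderiv ℝ Θ u ∘L .inr ℝ E ℝ).IsInvertible := by
    intro u hu
    have h1 : HasFDerivAt (fun t => Θ (u.1, t)) (fderiv ℝ Θ u ∘L .inr ℝ E ℝ) u.2 :=
      HasFDerivAt.comp (f := fun t => (u.1, t)) u.2
        ((hΘ.differentiable (by simp)) (u.1, u.2)).hasFDerivAt
        (hasFDerivAt_prodMk_right (𝕜 := ℝ) u.1 u.2)
    have h2 : HasDerivAt (fun t => Θ (u.1, t)) (fderiv ℝ m (u.1 + u.2 • v) v) u.2 := by
      have h3 : HasDerivAt (fun t : ℝ => u.1 + t • v) v u.2 := by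
        simpa using ((hasDerivAt_id u.2).smul_const v).const_add u.1
      exact ((hm.differentiable (by simp)) (u.1 + u.2 • v)).hasFDerivAt.comp_hasDerivAt u.2 h3
    rw [h1.unique h2.hasFDerivAt]
    refine ⟨ContinuousLinearEquiv.smulLeft (Units.mk0 _ hu), ?_⟩
    ext; simp
  have hne : (∞ : WithTop ℕ∞) ≠ 0 := by simp
  have hg0 : (g, (0 : ℝ)).1 + (g, (0 : ℝ)).2 • v = g := by simp
  have hinvg := hinv (g, 0) (by rw [hg0]; exact hv)
  set σ := (hΘ.contDiffAt (x := (g, (0 : ℝ)))).implicitFunction hne hinvg with hσdef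
  have hσg : σ g = 0 := (hΘ.contDiffAt (x := (g, (0 : ℝ)))).implicitFunction_apply_self hne hinvg
  have hσc : ContDiffAt ℝ ∞ σ g := (hΘ.contDiffAt (x := (g, (0 : ℝ)))).contDiffAt_implicitFunction
    hne hinvg
  have hσz : ∀ᶠ y in 𝓝 g, Θ (y, σ y) = 0 := by
    have := (hΘ.contDiffAt (x := (g, (0 : ℝ)))).eventually_apply_implicitFunction hne hinvg
    simpa [Θ, hg] using this
  have hσcont : ∀ᶠ y in 𝓝 g, ContinuousAt σ y := by
    have h1 : ContDiffAt ℝ 1 σ g := hσc.of_le (by exact_mod_cast le_top)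
    exact (h1.eventually (by simp)).mono fun y hy => hy.continuousAt
  have hpt : ContinuousAt (fun y => y + σ y • v) g :=
    continuousAt_id.add (hσc.continuousAt.smul continuousAt_const)
  have hpg : (fun y => y + σ y • v) g = g := by simp [hσg]
  have hder : ∀ᶠ y in 𝓝 g, fderiv ℝ m (y + σ y • v) v ≠ 0 := by
    have hc : Continuous fun z => fderiv ℝ m z v :=
      (hm.continuous_fderiv (by simp)).clm_apply continuous_const
    have : ∀ᶠ z in 𝓝 ((fun y => y + σ y • v) g), fderiv ℝ m z v ≠ 0 := by
      rw [hpg]; exact hc.continuousAt.eventually_ne hv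
    exact hpt.eventually this
  have hh0 : ∀ᶠ y in 𝓝 g, m (y + σ y • v) = 0 → h (y + σ y • v) = 0 := by
    rw [← hpg] at h0
    exact hpt.eventually h0
  -- The implicit function is smooth at all points near `g` by local uniqueness.
  have hσs : ∀ᶠ y in 𝓝 g, ContDiffAt ℝ ∞ σ y := by
    filter_upwards [hσz.eventually_nhds, hσcont, hder] with y h1 h2 h3
    have hinvy := hinv (y, σ y) h3
    have h4 := (hΘ.contDiffAt (x := (y, σ y))).contDiffAt_implicitFunction hne hinvy
    have h5 := (hΘ.contDiffAt (x := (y, σ y))).eventually_apply_eq_iff_implicitFunction hne hinvy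
    refine h4.congr_of_eventuallyEq ?_
    have h6 : ContinuousAt (fun z => (z, σ z)) y := continuousAt_id.prodMk h2
    filter_upwards [h1, h6.eventually h5] with z hz1 hz2
    exact (hz2.1 (by rw [hz1, h1.self_of_nhds])).symm
  let A : (E → ℝ) → E → ℝ := fun f y => ∫ θ in (0 : ℝ)..1, f (y + (θ * σ y) • v)
  let M : E → ℝ := fun y => ∫ θ in (0 : ℝ)..1, fderiv ℝ m (y + (θ * σ y) • v) v
  let N : E → F := fun y => ∫ θ in (0 : ℝ)..1, fderiv ℝ h (y + (θ * σ y) • v) v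
  have hMg : M g ≠ 0 := by simp [M, hσg, hv]
  obtain ⟨O₁, hO₁, hO₁o, hgO₁⟩ := eventually_nhds_iff.1 (hσs.and (hσz.and hh0))
  have hσO : ContDiffOn ℝ ∞ σ O₁ := fun y hy => (hO₁ y hy).1.contDiffWithinAt
  have hMc : ContDiffOn ℝ ∞ M O₁ :=
    contDiffOn_segment_average ((hm.fderiv_right (m := ∞) (by simp)).clm_apply contDiff_const) hσO v
  have hNc : ContDiffOn ℝ ∞ N O₁ :=
    contDiffOn_segment_average ((hh.fderiv_right (m := ∞) (by simp)).clm_apply contDiff_const) hσO v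
  obtain ⟨O₂, hO₂, hO₂o, hgO₂⟩ := eventually_nhds_iff.1
    ((hMc.continuousOn.continuousAt (hO₁o.mem_nhds hgO₁)).eventually_ne hMg)
  have htaylor : ∀ {G : Type} [NormedAddCommGroup G] [NormedSpace ℝ G] [CompleteSpace G] {f : E → G},
      ContDiff ℝ ∞ f → ∀ y, f (y + σ y • v) - f y =
        σ y • ∫ θ in (0 : ℝ)..1, fderiv ℝ f (y + (θ * σ y) • v) v := by
    intro G _ _ _ f hf y
    have h1 : ∀ θ ∈ uIcc (0 : ℝ) 1, HasDerivAt (fun θ : ℝ => f (y + (θ * σ y) • v))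
        (σ y • fderiv ℝ f (y + (θ * σ y) • v) v) θ := by
      intro θ _
      have h2 : HasDerivAt (fun θ : ℝ => y + (θ * σ y) • v) (σ y • v) θ := by
        simpa using (((hasDerivAt_id θ).mul_const (σ y)).smul_const v).const_add y
      have := ((hf.differentiable (by simp)) (y + (θ * σ y) • v)).hasFDerivAt.comp_hasDerivAt θ h2
      simpa [Function.comp_def] using this
    have hcont : Continuous fun θ : ℝ => σ y • fderiv ℝ f (y + (θ * σ y) • v) v := by
      have := (hf.continuous_fderiv (by simp))
      fun_prop
    have := intervalIntegral.integral_eq_sub_of_hasDerivAt h1 (hcont.intervalIntegrable 0 1)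
    rw [intervalIntegral.integral_smul] at this
    simpa using this.symm
  refine ⟨fun y => (M y)⁻¹ • N y, O₁ ∩ O₂, hO₁o.inter hO₂o, ⟨hgO₁, hgO₂⟩, ?_, fun y hy => ?_⟩
  · exact ((hMc.mono inter_subset_left).inv fun y hy => hO₂ y hy.2).smul (hNc.mono inter_subset_left)
  · have hz : m (y + σ y • v) = 0 := (hO₁ y hy.1).2.1
    have e1 := htaylor hm y
    have e2 := htaylor hh y
    rw [hz, zero_sub] at e1
    rw [(hO₁ y hy.1).2.2 hz, zero_sub] at e2
    have hMy := hO₂ y hy.2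
    have e1' : m y = -(σ y * M y) := by rw [← smul_eq_mul]; linarith
    have e2' : h y = -(σ y • N y) := by rw [← e2, neg_neg]
    rw [e1', e2', smul_smul, neg_mul, mul_assoc, mul_inv_cancel₀ hMy, mul_one, neg_smul]

end Division

/-! ### Regularity of solutions at glancing points -/

section Glancing

variable {E : Type} [NormedAddCommGroup E] [NormedSpace ℝ E]

/-- The half-ball `{ℓ ≥ 0} ∩ B(g, r)`. -/
def halfBall (ℓ : E →L[ℝ] ℝ) (g : E) (r : ℝ) : Set E := halfSpace ℓ ∩ Metric.ball g r

lemma halfBall_subset {ℓ : E →L[ℝ] ℝ} {g : E} {r r' : ℝ} (h : r' ≤ r) :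
    halfBall ℓ g r' ⊆ halfBall ℓ g r :=
  inter_subset_inter_right _ (Metric.ball_subset_ball h)

lemma halfBall_mem_nhdsWithin {ℓ : E →L[ℝ] ℝ} {g y : E} {r : ℝ} (hy : y ∈ Metric.ball g r) :
    halfBall ℓ g r ∈ 𝓝[halfSpace ℓ] y :=
  inter_mem self_mem_nhdsWithin (mem_nhdsWithin_of_mem_nhds (Metric.isOpen_ball.mem_nhds hy))

lemma halfBall_mem_nhds {ℓ : E →L[ℝ] ℝ} {g y : E} {r : ℝ} (hy : y ∈ Metric.ball g r)
    (hy0 : 0 < ℓ y) : halfBall ℓ g r ∈ 𝓝 y :=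
  inter_mem (halfSpace_mem_nhds hy0) (Metric.isOpen_ball.mem_nhds hy)

lemma uniqueDiffOn_halfBall {ℓ : E →L[ℝ] ℝ} {ν : E} (hν : ℓ ν = 1) (g : E) (r : ℝ) :
    UniqueDiffOn ℝ (halfBall ℓ g r) :=
  (uniqueDiffOn_halfSpace hν).inter Metric.isOpen_ball

/-- The set of points of the half-ball which are not glancing: interior points and those boundary
points at which `L` is transversal to the boundary. -/
def nonGlancing (ℓ : E →L[ℝ] ℝ) (L : E → E) (g : E) (r : ℝ) : Set E :=
  {y | y ∈ halfBall ℓ g r ∧ (ℓ y = 0 → ℓ (L y) ≠ 0)}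

/-- The function `w` is smooth on the half-ball off the glancing set, vanishes on the flat boundary
and solves `dw(L) = B(·, w)` in the interior, and the half-ball is strictly convex for `L` at its
glancing points. -/
structure IsGlancingSolution {F : Type} [NormedAddCommGroup F] [NormedSpace ℝ F] (ℓ : E →L[ℝ] ℝ)
    (g : E) (r : ℝ) (L : E → E) (B : E × F → F) (w : E → F) : Prop where
  smooth_field : ContDiffOn ℝ ∞ L (halfBall ℓ g r)
  smooth_rhs : ContDiffOn ℝ ∞ B (halfBall ℓ g r ×ˢ univ)
  smooth_sol : ContDiffOn ℝ ∞ w (nonGlancing ℓ L g r)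
  boundary : ∀ y ∈ halfBall ℓ g r, ℓ y = 0 → w y = 0
  equation : ∀ y ∈ Metric.ball g r, 0 < ℓ y → fderiv ℝ w y (L y) = B (y, w y)
  convex : ∀ y ∈ halfBall ℓ g r, ℓ y = 0 → ℓ (L y) = 0 →
    ℓ (fderivWithin ℝ L (halfSpace ℓ) y (L y)) < 0

variable {ℓ : E →L[ℝ] ℝ} {ν g : E} {r : ℝ} {L : E → E}

lemma nonGlancing_mem_nhdsWithin (hL : ContinuousOn L (halfBall ℓ g r)) {y : E}
    (hy : y ∈ nonGlancing ℓ L g r) : nonGlancing ℓ L g r ∈ 𝓝[halfSpace ℓ] y := by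
  have h1 := halfBall_mem_nhdsWithin (ℓ := ℓ) hy.1.2
  by_cases h0 : ℓ y = 0
  · have hc : ContinuousWithinAt (fun z => ℓ (L z)) (halfSpace ℓ) y :=
      ℓ.continuous.continuousAt.comp_continuousWithinAt ((hL y hy.1).mono_of_mem_nhdsWithin h1)
    filter_upwards [h1, hc.eventually_ne (hy.2 h0)] with z hz1 hz2 using ⟨hz1, fun _ => hz2⟩
  · filter_upwards [h1, mem_nhdsWithin_of_mem_nhds (ℓ.continuous.continuousAt.eventually_ne h0)]
      with z hz1 hz2 using ⟨hz1, fun h => absurd h hz2⟩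

lemma interior_mem_nonGlancing {y : E} (hy : y ∈ Metric.ball g r) (hy0 : 0 < ℓ y) :
    y ∈ nonGlancing ℓ L g r :=
  ⟨⟨hy0.le, hy⟩, fun h => absurd h hy0.ne'⟩

lemma nonGlancing_mem_nhds (hL : ContinuousOn L (halfBall ℓ g r)) {y : E}
    (hy : y ∈ Metric.ball g r) (hy0 : 0 < ℓ y) : nonGlancing ℓ L g r ∈ 𝓝 y := by
  have := nonGlancing_mem_nhdsWithin hL (interior_mem_nonGlancing (L := L) hy hy0)
  rwa [nhdsWithin_eq_nhds.2 (halfSpace_mem_nhds hy0)] at this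

lemma uniqueDiffOn_nonGlancing (hν : ℓ ν = 1) (hL : ContinuousOn L (halfBall ℓ g r)) :
    UniqueDiffOn ℝ (nonGlancing ℓ L g r) := fun y hy =>
  ((uniqueDiffOn_halfSpace hν) y hy.1.1).mono_nhds
    (by rw [nhdsWithin_le_iff]; exact nonGlancing_mem_nhdsWithin hL hy)

variable {F : Type} [NormedAddCommGroup F] [NormedSpace ℝ F] {B : E × F → F} {w : E → F}

lemma IsGlancingSolution.mono (h : IsGlancingSolution ℓ g r L B w) {r' : ℝ} (hr : r' ≤ r) :
    IsGlancingSolution ℓ g r' L B w where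
  smooth_field := h.smooth_field.mono (halfBall_subset hr)
  smooth_rhs := h.smooth_rhs.mono (prod_mono_left (halfBall_subset hr))
  smooth_sol := h.smooth_sol.mono fun _ hy => ⟨halfBall_subset hr hy.1, hy.2⟩
  boundary y hy := h.boundary y (halfBall_subset hr hy)
  equation y hy := h.equation y (Metric.ball_subset_ball hr hy)
  convex y hy := h.convex y (halfBall_subset hr hy)

variable [FiniteDimensional ℝ E]

/-- Near a glancing point, every interior point lies on a short integral curve with end points on
the boundary, along which `w` solves an ordinary differential equation. -/
lemma IsGlancingSolution.exists_chord (hν : ℓ ν = 1) (h : IsGlancingSolution ℓ g r L B w) {q : E}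
    (hq : q ∈ Metric.ball g r) (hq0 : ℓ q = 0) (hqL : ℓ (L q) = 0) {η : ℝ} (hη : 0 < η) :
    ∀ᶠ y in 𝓝 q, 0 < ℓ y → ∃ (a b : ℝ) (Y : ℝ → E), a < 0 ∧ 0 < b ∧ -η ≤ a ∧ b ≤ η ∧ Y 0 = y ∧
      (∀ τ ∈ Icc a b, Y τ ∈ halfBall ℓ q η) ∧ w (Y a) = 0 ∧ w (Y b) = 0 ∧
      ContinuousOn (fun τ => w (Y τ)) (Icc a b) ∧
      ∀ τ ∈ Ico a b, HasDerivWithinAt (fun τ => w (Y τ)) (B (Y τ, w (Y τ))) (Ici τ) τ := by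
  have hqH : q ∈ halfSpace ℓ := hq0.ge
  have hqU : q ∈ halfBall ℓ g r := ⟨hqH, hq⟩
  have hLq : ContDiffWithinAt ℝ ∞ L (halfSpace ℓ) q :=
    (h.smooth_field q hqU).mono_of_mem_nhdsWithin (halfBall_mem_nhdsWithin hq)
  obtain ⟨L', hL'c, hL'⟩ := exists_contDiff_extension hν hqH 1 (hLq.of_le (by exact_mod_cast le_top))
  have hL'1 : ContDiff ℝ 1 L' := by exact_mod_cast hL'c
  have hL'q : L' q = L q := hL'.self_of_nhdsWithin hqH
  have hfd : fderiv ℝ L' q = fderivWithin ℝ L (halfSpace ℓ) q := by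
    rw [← hL'.fderivWithin_eq hL'q]
    exact (((hL'1.differentiable (by simp)) q).fderivWithin
      ((uniqueDiffOn_halfSpace hν) q hqH)).symm
  obtain ⟨ρ, hρ, hρ'⟩ := Metric.mem_nhdsWithin_iff.1
    (inter_mem hL' (halfBall_mem_nhdsWithin (ℓ := ℓ) hq))
  have key := RealPrincipalType.exists_chord hL'1 hq0 (by rw [hL'q]; exact hqL)
    (by rw [hL'q, hfd]; exact h.convex q hqU hq0 hqL) (η := min η ρ) (by positivity)
  filter_upwards [key] with y hy hy0
  obtain ⟨a, b, Y, ha, hb, haη, hbη, hY, hY0, hYb, hYi, hYa0, hYb0, hYa1, hYb1⟩ := hy hy0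
  have hYH : ∀ τ ∈ Icc a b, Y τ ∈ halfSpace ℓ := by
    intro τ hτ
    rcases hτ.1.eq_or_lt with h1 | h1
    · rw [← h1]; exact hYa0.ge
    rcases hτ.2.eq_or_lt with h2 | h2
    · rw [h2]; exact hYb0.ge
    · exact (hYi τ ⟨h1, h2⟩).le
  have hYU : ∀ τ ∈ Icc a b, L' (Y τ) = L (Y τ) ∧ Y τ ∈ halfBall ℓ g r := fun τ hτ =>
    hρ' ⟨Metric.ball_subset_ball (min_le_right _ _) (hYb τ hτ), hYH τ hτ⟩
  have hYS : ∀ τ ∈ Icc a b, Y τ ∈ nonGlancing ℓ L g r := by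
    intro τ hτ
    refine ⟨(hYU τ hτ).2, fun h0 => ?_⟩
    rw [← (hYU τ hτ).1]
    rcases hτ.1.eq_or_lt with h1 | h1
    · rw [← h1]; exact hYa1.ne'
    rcases hτ.2.eq_or_lt with h2 | h2
    · rw [h2]; exact hYb1.ne
    · exact absurd h0 (hYi τ ⟨h1, h2⟩).ne'
  have hwc : ContinuousOn (fun τ => w (Y τ)) (Icc a b) :=
    h.smooth_sol.continuousOn.comp hY.continuousOn hYS
  have hBc : ContinuousOn (fun τ => B (Y τ, w (Y τ))) (Icc a b) :=
    h.smooth_rhs.continuousOn.comp (hY.continuousOn.prodMk hwc)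
      fun τ hτ => ⟨(hYU τ hτ).2, mem_univ _⟩
  have hder : ∀ τ ∈ Ioo a b, HasDerivAt (fun τ => w (Y τ)) (B (Y τ, w (Y τ))) τ := by
    intro τ hτ
    have hτ' := Ioo_subset_Icc_self hτ
    have h1 := (hY τ hτ').hasDerivAt (Icc_mem_nhds hτ.1 hτ.2)
    rw [(hYU τ hτ').1] at h1
    have h2 : DifferentiableAt ℝ w (Y τ) :=
      ((h.smooth_sol (Y τ) (hYS τ hτ')).contDiffAt (nonGlancing_mem_nhds
        h.smooth_field.continuousOn (hYU τ hτ').2.2 (hYi τ hτ))).differentiableAt (by simp)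
    have h3 := h2.hasFDerivAt.comp_hasDerivAt τ h1
    rwa [h.equation _ (hYU τ hτ').2.2 (hYi τ hτ)] at h3
  have hab : a < b := ha.trans hb
  refine ⟨a, b, Y, ha, hb, by linarith [min_le_left η ρ], hbη.trans (min_le_left _ _), hY0,
    fun τ hτ => ⟨hYH τ hτ, Metric.ball_subset_ball (min_le_left _ _) (hYb τ hτ)⟩,
    h.boundary _ (hYU a ⟨le_rfl, hab.le⟩).2 hYa0, h.boundary _ (hYU b ⟨hab.le, le_rfl⟩).2 hYb0,
    hwc, fun τ hτ => ?_⟩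
  rcases hτ.1.eq_or_lt with h1 | h1
  · subst h1
    refine hasDerivWithinAt_Ici_of_tendsto_deriv (s := Ioo a b)
      (fun τ hτ => (hder τ hτ).differentiableAt.differentiableWithinAt)
      ((hwc a ⟨le_rfl, hab.le⟩).mono Ioo_subset_Icc_self) (Ioo_mem_nhdsGT hab) ?_
    have h2 : Tendsto (fun τ => B (Y τ, w (Y τ))) (𝓝[>] a) (𝓝 (B (Y a, w (Y a)))) :=
      ((hBc a ⟨le_rfl, hab.le⟩).mono Ioo_subset_Icc_self).tendsto.mono_left
        (nhdsWithin_le_iff.2 (Ioo_mem_nhdsGT hab))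
    refine h2.congr' ?_
    filter_upwards [Ioo_mem_nhdsGT hab] with τ hτ using (hder τ hτ).deriv.symm
  · exact (hder τ ⟨h1, hτ.2⟩).hasDerivWithinAt

omit [FiniteDimensional ℝ E] in
lemma exists_interior_near (hν : ℓ ν = 1) {q : E} (hq0 : ℓ q = 0) {P : E → Prop}
    (hP : ∀ᶠ y in 𝓝 q, P y) : ∃ y, 0 < ℓ y ∧ P y := by
  have h1 : Tendsto (fun s : ℝ => q + s • ν) (𝓝[>] 0) (𝓝 q) := by
    have : Continuous fun s : ℝ => q + s • ν := by fun_prop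
    simpa using (this.tendsto 0).mono_left nhdsWithin_le_nhds
  obtain ⟨s, hs1, hs2⟩ := ((h1.eventually hP).and self_mem_nhdsWithin).exists
  exact ⟨q + s • ν, by simpa [hq0, hν] using hs2, hs1⟩

/-- Since `w` vanishes at both ends of short chords, the right hand side vanishes at glancing
points. -/
lemma IsGlancingSolution.rhs_eq_zero (hν : ℓ ν = 1) (h : IsGlancingSolution ℓ g r L B w) {q : E}
    (hq : q ∈ Metric.ball g r) (hq0 : ℓ q = 0) (hqL : ℓ (L q) = 0) :
    B (q, 0) = 0 ∧ ContinuousWithinAt w (halfSpace ℓ) q := by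
  have hqH : q ∈ halfSpace ℓ := hq0.ge
  have hwq : w q = 0 := h.boundary q ⟨hqH, hq⟩ hq0
  have hBc : ContinuousWithinAt B (halfSpace ℓ ×ˢ univ) (q, 0) := by
    refine (h.smooth_rhs.continuousOn (q, 0) ⟨⟨hqH, hq⟩, mem_univ _⟩).mono_of_mem_nhdsWithin ?_
    rw [nhdsWithin_prod_eq]
    exact prod_mem_prod (halfBall_mem_nhdsWithin hq) self_mem_nhdsWithin
  have hBnear : ∀ β > 0, ∃ δ > 0, ∀ y ∈ halfBall ℓ q δ, ∀ z : F, ‖z‖ ≤ δ →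
      ‖B (y, z) - B (q, 0)‖ < β := by
    intro β hβ
    obtain ⟨δ, hδ, hδ'⟩ := Metric.continuousWithinAt_iff.1 hBc β hβ
    refine ⟨δ / 2, by positivity, fun y hy z hz => ?_⟩
    rw [← dist_eq_norm]
    refine hδ' ⟨hy.1, mem_univ _⟩ ?_
    rw [Prod.dist_eq, sup_lt_iff]
    refine ⟨(Metric.mem_ball.1 hy.2).trans (by linarith), ?_⟩
    rw [dist_zero_right]; linarith
  -- A priori bound for `w` along short chords.
  have hbound : ∀ β > 0, ∃ δ > 0, ∀ η ≤ δ, ∀ a b (Y : ℝ → E), a < 0 → 0 < b → -η ≤ a → b ≤ η →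
      (∀ τ ∈ Icc a b, Y τ ∈ halfBall ℓ q η) → w (Y a) = 0 →
      ContinuousOn (fun τ => w (Y τ)) (Icc a b) →
      (∀ τ ∈ Ico a b, HasDerivWithinAt (fun τ => w (Y τ)) (B (Y τ, w (Y τ))) (Ici τ) τ) →
      ∀ τ ∈ Icc a b, ‖w (Y τ)‖ ≤ β := by
    intro β hβ
    obtain ⟨δ, hδ, hB⟩ := hBnear 1 one_pos
    set C := ‖B (q, 0)‖ + 1 with hC
    have hC0 : 0 < C := by positivity
    refine ⟨min δ (min δ β / (2 * (C + 1))), by positivity, ?_⟩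
    intro η hη a b Y ha hb haη hbη hY hwa hwc hwd
    have hη1 : η ≤ δ := hη.trans (min_le_left _ _)
    have hη2 : (C + 1) * (2 * η) ≤ min δ β := by
      have := hη.trans (min_le_right _ _)
      rw [le_div_iff₀ (by positivity)] at this
      linarith
    have hlin : ∀ τ ∈ Icc a b, (C + 1) * (τ - a) ≤ min δ β := fun τ hτ => by
      refine le_trans ?_ hη2
      gcongr
      linarith [hτ.2]
    intro τ hτ
    have := image_norm_le_of_norm_deriv_right_lt_deriv_boundary (f := fun τ => w (Y τ))
      (f' := fun τ => B (Y τ, w (Y τ))) (B := fun τ => (C + 1) * (τ - a)) (B' := fun _ => C + 1)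
      hwc hwd (by simp [hwa]) (fun x => by
        simpa using ((hasDerivAt_id x).sub_const a).const_mul (C + 1)) (fun x hx hx' => by
        have hx1 : ‖w (Y x)‖ ≤ δ := by
          rw [hx']; exact (hlin x (Ico_subset_Icc_self hx)).trans (min_le_left _ _)
        have := hB (Y x) (halfBall_subset hη1 (hY x (Ico_subset_Icc_self hx))) _ hx1
        have h3 := norm_le_norm_sub_add (B (Y x, w (Y x))) (B (q, 0))
        linarith) hτ
    exact this.trans ((hlin τ hτ).trans (min_le_right _ _))
  constructor
  · by_contra hne
    set β := ‖B (q, 0)‖ with hβ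
    have hβ0 : 0 < β := norm_pos_iff.2 hne
    obtain ⟨δ₁, hδ₁, hB⟩ := hBnear (β / 2) (by positivity)
    obtain ⟨δ₂, hδ₂, hw⟩ := hbound δ₁ hδ₁
    obtain ⟨y, hy0, hy⟩ := exists_interior_near hν hq0
      (h.exists_chord hν hq hq0 hqL (η := min δ₁ δ₂) (by positivity))
    obtain ⟨a, b, Y, ha, hb, haη, hbη, -, hY, hwa, hwb, hwc, hwd⟩ := hy hy0
    have hsmall := hw _ (min_le_right _ _) a b Y ha hb haη hbη hY hwa hwc hwd
    have hab : a < b := ha.trans hb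
    have := norm_image_sub_le_of_norm_deriv_right_le_segment
      (f := fun τ => w (Y τ) - (τ - a) • B (q, 0)) (f' := fun τ => B (Y τ, w (Y τ)) - B (q, 0))
      (C := β / 2) (a := a) (b := b) (hwc.sub (by fun_prop)) (fun x hx => by
        have h2 : HasDerivAt (fun τ : ℝ => (τ - a) • B (q, 0)) (B (q, 0)) x := by
          simpa using ((hasDerivAt_id x).sub_const a).smul_const (B (q, 0))
        exact (hwd x hx).sub h2.hasDerivWithinAt) (fun x hx =>
        (hB (Y x) (halfBall_subset (min_le_left _ _) (hY x (Ico_subset_Icc_self hx))) _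
          (hsmall x (Ico_subset_Icc_self hx))).le) b ⟨hab.le, le_rfl⟩
    simp only [hwa, hwb, sub_self, zero_smul, sub_zero, zero_sub, norm_neg, norm_smul,
      Real.norm_eq_abs, abs_of_pos (sub_pos.2 hab), ← hβ] at this
    nlinarith [sub_pos.2 hab]
  · rw [Metric.continuousWithinAt_iff']
    intro ε hε
    obtain ⟨δ, hδ, hw⟩ := hbound (ε / 2) (by positivity)
    filter_upwards [mem_nhdsWithin_of_mem_nhds (h.exists_chord hν hq hq0 hqL hδ),
      halfBall_mem_nhdsWithin (ℓ := ℓ) hq] with y hy hyU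
    rw [hwq, dist_zero_right]
    have hyH : 0 ≤ ℓ y := hyU.1
    rcases hyH.eq_or_lt with h0 | h0
    · rw [h.boundary y hyU h0.symm, norm_zero]; exact hε
    · obtain ⟨a, b, Y, ha, hb, haη, hbη, hY0, hY, hwa, hwb, hwc, hwd⟩ := hy h0
      have := hw _ le_rfl a b Y ha hb haη hbη hY hwa hwc hwd 0 ⟨ha.le, hb.le⟩
      rw [hY0] at this
      linarith

end Glancing

section Glancing

variable {E : Type} [NormedAddCommGroup E] [NormedSpace ℝ E] {ℓ : E →L[ℝ] ℝ} {ν g : E} {r : ℝ}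
  {L : E → E} {F : Type} [NormedAddCommGroup F] [NormedSpace ℝ F] {B : E × F → F} {w : E → F}

lemma mem_closure_interior_halfBall (hν : ℓ ν = 1) {y : E} (hy : y ∈ halfBall ℓ g r) :
    y ∈ closure ({z | 0 < ℓ z} ∩ Metric.ball g r) := by
  have h1 : Tendsto (fun s : ℝ => y + s • ν) (𝓝[>] 0) (𝓝 y) := by
    have : Continuous fun s : ℝ => y + s • ν := by fun_prop
    simpa using (this.tendsto 0).mono_left nhdsWithin_le_nhds
  refine mem_closure_of_tendsto h1 ?_
  filter_upwards [h1.eventually (Metric.isOpen_ball.mem_nhds hy.2), self_mem_nhdsWithin]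
    with s hs1 hs2
  refine ⟨?_, hs1⟩
  have : 0 ≤ ℓ y := hy.1
  have hs3 : 0 < s := hs2
  simp only [mem_ofPred_eq, map_add, map_smul, hν, smul_eq_mul, mul_one]
  linarith

variable [FiniteDimensional ℝ E]

/-- The normal derivative of `w` on the boundary, prescribed by the equation, extends smoothly
across the glancing set. -/
lemma IsGlancingSolution.exists_boundary_derivative [CompleteSpace F] (hν : ℓ ν = 1)
    (h : IsGlancingSolution ℓ g r L B w) (hr : 0 < r) (hg : ℓ g = 0) (hgL : ℓ (L g) = 0) :
    ∃ k : E → F, ∃ r₁ > 0, r₁ ≤ r ∧ ContDiffOn ℝ ∞ k (Metric.ball g r₁) ∧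
      ∀ y ∈ Metric.ball g r₁, ℓ y = 0 → B (y, 0) = ℓ (L y) • k y := by
  -- Extend the boundary values of `B(·, 0)` and `ℓ ∘ L` constantly in the direction `ν`.
  let π : E →L[ℝ] E := ContinuousLinearMap.id ℝ E - ℓ.smulRight ν
  have hπ : ∀ y, π y = y - ℓ y • ν := fun y => by simp [π]
  have hπ0 : ∀ y, ℓ (π y) = 0 := fun y => by simp [hπ, hν]
  have hπb : ∀ y, ℓ y = 0 → π y = y := fun y hy => by simp [hπ, hy]
  set O : Set E := π ⁻¹' Metric.ball g r with hO
  have hOo : IsOpen O := Metric.isOpen_ball.preimage π.continuous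
  have hgO : g ∈ O := by simp [hO, hπb g hg, hr]
  have hOU : ∀ y ∈ O, π y ∈ halfBall ℓ g r := fun y hy => ⟨(hπ0 y).ge, hy⟩
  have hs : ContDiffOn ℝ ∞ (fun y => B (π y, 0)) O :=
    h.smooth_rhs.comp ((π.contDiff.contDiffOn).prodMk contDiffOn_const)
      fun y hy => ⟨hOU y hy, mem_univ _⟩
  have ms : ContDiffOn ℝ ∞ (fun y => ℓ (L (π y))) O :=
    ℓ.contDiff.comp_contDiffOn (h.smooth_field.comp π.contDiff.contDiffOn hOU)
  obtain ⟨f, hf, hf'⟩ := exists_contDiff_eventuallyEq hOo hs hgO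
  obtain ⟨m, hm, hm'⟩ := exists_contDiff_eventuallyEq hOo ms hgO
  have hmg : m g = 0 := by
    rw [hm'.self_of_nhds]
    simp only [hπb g hg, hgL]
  have hgU : g ∈ halfBall ℓ g r := ⟨hg.ge, Metric.mem_ball_self hr⟩
  have hder : fderiv ℝ m g (L g) ≠ 0 := by
    have h1 : HasFDerivWithinAt L (fderivWithin ℝ L (halfSpace ℓ) g) (halfSpace ℓ) (π g) := by
      rw [hπb g hg]
      exact (((h.smooth_field g hgU).mono_of_mem_nhdsWithin
        (halfBall_mem_nhdsWithin hgU.2)).differentiableWithinAt (by simp)).hasFDerivWithinAt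
    have h2 : HasFDerivAt (fun y => L (π y)) ((fderivWithin ℝ L (halfSpace ℓ) g).comp π) g := by
      rw [← hasFDerivWithinAt_univ]
      exact h1.comp g π.hasFDerivAt.hasFDerivWithinAt fun y _ => (hπ0 y).ge
    have h3 := (ℓ.hasFDerivAt.comp g h2).congr_of_eventuallyEq hm'
    rw [h3.fderiv]
    simpa [hπb _ hgL] using (h.convex g hgU hg hgL).ne
  have h0 : ∀ᶠ z in 𝓝 g, m z = 0 → f z = 0 := by
    filter_upwards [hf', hm', hOo.mem_nhds hgO] with z hz1 hz2 hzO hz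
    rw [hz1]
    rw [hz2] at hz
    exact (h.rhs_eq_zero hν hzO (hπ0 z) hz).1
  obtain ⟨k, O', hO'o, hgO', hk, hk'⟩ := exists_contDiffOn_smul_eq hf hm hmg hder h0
  obtain ⟨r₁, hr₁, hr₁'⟩ := Metric.mem_nhds_iff.1
    (inter_mem (hO'o.mem_nhds hgO') (inter_mem hf' hm'))
  refine ⟨k, min r₁ r, by positivity, min_le_right _ _, hk.mono fun y hy =>
    (hr₁' (Metric.ball_subset_ball (min_le_left _ _) hy)).1, fun y hy hy0 => ?_⟩
  obtain ⟨h1, h2, h3⟩ := hr₁' (Metric.ball_subset_ball (min_le_left _ _) hy)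
  simp only [mem_ofPred_eq] at h2 h3
  have := hk' y h1
  rwa [h2, h3, hπb y hy0] at this

omit [FiniteDimensional ℝ E] in
/-- At a boundary point at which `L` is transversal, the derivative of `w` is determined by the
boundary condition and the equation. -/
lemma IsGlancingSolution.fderivWithin_boundary (hν : ℓ ν = 1)
    (h : IsGlancingSolution ℓ g r L B w) {y : E} (hy : y ∈ nonGlancing ℓ L g r) (hy0 : ℓ y = 0)
    {k : F} (hk : B (y, 0) = ℓ (L y) • k) :
    fderivWithin ℝ w (nonGlancing ℓ L g r) y = ℓ.smulRight k := by
  set N := nonGlancing ℓ L g r with hN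
  have hu := uniqueDiffOn_nonGlancing hν h.smooth_field.continuousOn
  set A := fderivWithin ℝ w N y with hA
  have hwA : HasFDerivWithinAt w A N y :=
    ((h.smooth_sol y hy).differentiableWithinAt (by simp)).hasFDerivWithinAt
  have hNn : N ∈ 𝓝[halfSpace ℓ] y := nonGlancing_mem_nhdsWithin h.smooth_field.continuousOn hy
  have htan : ∀ v, ℓ v = 0 → A v = 0 := by
    intro v hv
    obtain ⟨O, hO, hO'⟩ := mem_nhdsWithin_iff_exists_mem_nhds_inter.1 hNn
    have hc : Continuous fun t : ℝ => y + t • v := by fun_prop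
    have h1 : ∀ᶠ t in 𝓝 (0 : ℝ), y + t • v ∈ N := by
      filter_upwards [(hc.tendsto' 0 y (by simp)).eventually hO] with t ht
      exact hO' ⟨ht, by simp [halfSpace, hy0, hv]⟩
    have h2 : HasDerivAt (fun t : ℝ => y + t • v) v 0 := by
      simpa using ((hasDerivAt_id (0 : ℝ)).smul_const v).const_add y
    have h3 : HasDerivWithinAt (fun t : ℝ => w (y + t • v)) (A v)
        {t : ℝ | y + t • v ∈ N} 0 := by
      have h4 : HasFDerivWithinAt w A N (y + (0 : ℝ) • v) := by simpa using hwA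
      exact h4.comp_hasDerivWithinAt 0 h2.hasDerivWithinAt fun t ht => ht
    have h5 : HasDerivAt (fun t : ℝ => w (y + t • v)) (A v) 0 := h3.hasDerivAt h1
    have h6 : HasDerivAt (fun t : ℝ => w (y + t • v)) 0 0 := by
      refine (hasDerivAt_const (0 : ℝ) (0 : F)).congr_of_eventuallyEq ?_
      filter_upwards [h1] with t ht
      exact h.boundary _ ht.1 (by simp [hy0, hv])
    exact h5.unique h6
  have hLy : A (L y) = ℓ (L y) • k := by
    have hwy : w y = 0 := h.boundary y hy.1 hy0
    have h1 : ContinuousOn (fun z => fderivWithin ℝ w N z (L z) - B (z, w z)) N := by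
      refine ((h.smooth_sol.continuousOn_fderivWithin hu (by simp)).clm_apply
        (h.smooth_field.continuousOn.mono fun z hz => hz.1)).sub ?_
      exact h.smooth_rhs.continuousOn.comp (continuousOn_id.prodMk h.smooth_sol.continuousOn)
        fun z hz => ⟨hz.1, mem_univ _⟩
    set S : Set E := {z | 0 < ℓ z} ∩ Metric.ball g r with hS
    have hSN : S ⊆ N := fun z hz => interior_mem_nonGlancing hz.2 hz.1
    have h2 := ((h1 y hy).mono hSN)
    have h3 : EqOn (fun z => fderivWithin ℝ w N z (L z) - B (z, w z)) (fun _ => 0) S := by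
      intro z hz
      have := fderivWithin_of_mem_nhds (f := w) (𝕜 := ℝ)
        (nonGlancing_mem_nhds (L := L) h.smooth_field.continuousOn hz.2 hz.1)
      simp only [← hN] at this
      simp only [this, h.equation z hz.2 hz.1, sub_self]
    have h4 := h2.mem_closure_image (mem_closure_interior_halfBall hν hy.1)
    have h5 : (fun z => fderivWithin ℝ w N z (L z) - B (z, w z)) '' S ⊆ {0} := by
      rintro _ ⟨z, hz, rfl⟩
      exact h3 hz
    have h6 := closure_mono h5 h4
    rw [closure_singleton, mem_singleton_iff, sub_eq_zero, hwy, hk] at h6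
    exact h6
  ext v
  have hne := hy.2 hy0
  have h1 := htan (v - (ℓ v / ℓ (L y)) • L y) (by simp [hne])
  rw [map_sub, map_smul, hLy, smul_smul, div_mul_cancel₀ _ hne, sub_eq_zero] at h1
  simpa using h1

/-- Solutions at glancing points are smooth: the pair of `w` and its derivative, corrected by the
smooth extension of its boundary values, is a solution of a problem of the same kind. -/
theorem IsGlancingSolution.exists_contDiffOn (hν : ℓ ν = 1) (hg : ℓ g = 0) (hgL : ℓ (L g) = 0)
    (k : ℕ) : ∀ {F : Type} [NormedAddCommGroup F] [NormedSpace ℝ F] [CompleteSpace F]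
      {B : E × F → F} {w : E → F} {r : ℝ}, 0 < r → IsGlancingSolution ℓ g r L B w →
      ∃ r' > 0, ContDiffOn ℝ k w (halfBall ℓ g r') := by
  induction k with
  | zero =>
    intro F _ _ _ B w r hr h
    refine ⟨r, hr, ?_⟩
    rw [Nat.cast_zero, contDiffOn_zero]
    intro y hy
    by_cases hy' : ℓ y = 0 ∧ ℓ (L y) = 0
    · exact (h.rhs_eq_zero hν hy.2 hy'.1 hy'.2).2.mono inter_subset_left
    · have hyN : y ∈ nonGlancing ℓ L g r := ⟨hy, fun h0 h1 => hy' ⟨h0, h1⟩⟩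
      exact ((h.smooth_sol.continuousOn y hyN).mono_of_mem_nhdsWithin
        (nonGlancing_mem_nhdsWithin h.smooth_field.continuousOn hyN)).mono inter_subset_left
  | succ k ih =>
    intro F _ _ _ B w r₀ hr₀ h₀
    obtain ⟨κ, r, hr, hrr₀, hκ, hκB⟩ := h₀.exists_boundary_derivative hν hr₀ hg hgL
    have h := h₀.mono hrr₀
    set U := halfBall ℓ g r with hU
    set N := nonGlancing ℓ L g r with hN
    have hUu : UniqueDiffOn ℝ U := uniqueDiffOn_halfBall hν g r
    have hNu : UniqueDiffOn ℝ N := uniqueDiffOn_nonGlancing hν h.smooth_field.continuousOn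
    have hUN : N ⊆ U := fun y hy => hy.1
    let K : E → E →L[ℝ] F := fun y => ℓ.smulRight (κ y)
    have hK : ContDiffOn ℝ ∞ K (Metric.ball g r) := by
      exact ((ContinuousLinearMap.smulRightL ℝ E F ℓ).contDiff).comp_contDiffOn hκ
    have hKU : ContDiffOn ℝ ∞ K U := hK.mono inter_subset_right
    -- The derivative of `w`, extended to the glancing points by the prescribed boundary values `K`.
    let D : E → E →L[ℝ] F := fun y => if ℓ y = 0 then K y else fderiv ℝ w y
    have hDN : ∀ y ∈ N, D y = fderivWithin ℝ w N y := by
      intro y hy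
      by_cases hy0 : ℓ y = 0
      · simp only [D, hy0, if_true]
        exact (h.fderivWithin_boundary hν hy hy0 (hκB y hy.1.2 hy0)).symm
      · have hpos : 0 < ℓ y := lt_of_le_of_ne hy.1.1 (Ne.symm hy0)
        simp only [D, hy0, if_false]
        exact (fderivWithin_of_mem_nhds
          (nonGlancing_mem_nhds h.smooth_field.continuousOn hy.1.2 hpos)).symm
    have hDc : ContDiffOn ℝ ∞ D N :=
      (h.smooth_sol.fderivWithin hNu (m := ∞) (by simp)).congr hDN
    -- `T` vanishes on the boundary; `B'` comes from differentiating the equation for `w`.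
    let T : E → E →L[ℝ] F := fun y => D y - K y
    let B' : E × (F × (E →L[ℝ] F)) → F × (E →L[ℝ] F) := fun q =>
      (B (q.1, q.2.1),
        (fderivWithin ℝ B (U ×ˢ univ) (q.1, q.2.1)).comp
            ((ContinuousLinearMap.id ℝ E).prod (q.2.2 + K q.1))
          - (q.2.2 + K q.1).comp (fderivWithin ℝ L U q.1) - (fderivWithin ℝ K U q.1) (L q.1))
    have hBu : UniqueDiffOn ℝ (U ×ˢ (univ : Set F)) := hUu.prod uniqueDiffOn_univ
    have hW : IsGlancingSolution ℓ g r L B' (fun y => (w y, T y)) := by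
      refine ⟨h.smooth_field, ?_, h.smooth_sol.prodMk (hDc.sub (hKU.mono hUN)), ?_, ?_, h.convex⟩
      · have e1 : ContDiffOn ℝ ∞ (fun q : E × (F × (E →L[ℝ] F)) => (q.1, q.2.1)) (U ×ˢ univ) :=
          ContDiff.contDiffOn (by fun_prop)
        have e1m : MapsTo (fun q : E × (F × (E →L[ℝ] F)) => (q.1, q.2.1)) (U ×ˢ univ)
            (U ×ˢ univ) := fun q hq => ⟨hq.1, mem_univ _⟩
        have e2 : ContDiffOn ℝ ∞ (fun q : E × (F × (E →L[ℝ] F)) => q.1) (U ×ˢ univ) :=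
          contDiff_fst.contDiffOn
        have e2m : MapsTo (fun q : E × (F × (E →L[ℝ] F)) => q.1) (U ×ˢ univ) U := fun q hq => hq.1
        have e3 : ContDiffOn ℝ ∞ (fun q : E × (F × (E →L[ℝ] F)) => q.2.2 + K q.1) (U ×ˢ univ) :=
          ContDiffOn.add (ContDiff.contDiffOn (by fun_prop)) (hKU.comp e2 e2m)
        refine (h.smooth_rhs.comp e1 e1m).prodMk (ContDiffOn.sub (ContDiffOn.sub ?_ ?_) ?_)
        · refine ContDiffOn.clm_comp
            ((h.smooth_rhs.fderivWithin hBu (m := ∞) (by simp)).comp e1 e1m) ?_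
          have : ContDiff ℝ ∞ fun A : E →L[ℝ] F => (ContinuousLinearMap.id ℝ E).prod A :=
            (ContinuousLinearMap.prodₗᵢ (𝕜 := ℝ) (E := E) (F := E)
              (G := F) ℝ).contDiff.comp (contDiff_const.prodMk contDiff_id)
          exact this.comp_contDiffOn e3
        · exact e3.clm_comp ((h.smooth_field.fderivWithin hUu (m := ∞) (by simp)).comp e2 e2m)
        · exact ((hKU.fderivWithin hUu (m := ∞) (by simp)).comp e2 e2m).clm_apply
            (h.smooth_field.comp e2 e2m)
      · intro y hy hy0
        simp [T, D, hy0, h.boundary y hy hy0]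
      · intro y hy hy0
        have hyU : U ∈ 𝓝 y := halfBall_mem_nhds hy hy0
        have hyN : N ∈ 𝓝 y := nonGlancing_mem_nhds h.smooth_field.continuousOn hy hy0
        have hBn : U ×ˢ (univ : Set F) ∈ 𝓝 (y, w y) := prod_mem_nhds hyU univ_mem
        have hwy : ContDiffAt ℝ ∞ w y := h.smooth_sol.contDiffAt hyN
        have hLd : DifferentiableAt ℝ L y :=
          (h.smooth_field.contDiffAt hyU).differentiableAt (by simp)
        have hKd : DifferentiableAt ℝ K y := (hKU.contDiffAt hyU).differentiableAt (by simp)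
        have hDd : DifferentiableAt ℝ D y := (hDc.contDiffAt hyN).differentiableAt (by simp)
        have hBd : DifferentiableAt ℝ B (y, w y) :=
          (h.smooth_rhs.contDiffAt hBn).differentiableAt (by simp)
        have hwd := hwy.differentiableAt (by simp)
        have hDw : D =ᶠ[𝓝 y] fderiv ℝ w := by
          filter_upwards [ℓ.continuous.continuousAt.eventually_ne hy0.ne'] with z hz
          simp [D, hz]
        have hsym : ∀ v, fderiv ℝ D y v (L y) = fderiv ℝ D y (L y) v := by
          intro v
          rw [hDw.fderiv_eq]
          exact (hwy.isSymmSndFDerivAt (by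
            rw [minSmoothness_of_isRCLikeNormedField]
            exact WithTop.coe_le_coe.2 le_top)).eq v (L y)
        -- Differentiate the equation.
        have hdiff : ∀ v, fderiv ℝ D y v (L y) + D y (fderiv ℝ L y v) =
            fderiv ℝ B (y, w y) (v, D y v) := by
          intro v
          have e1 : HasFDerivAt (fun z => D z (L z)) _ y := hDd.hasFDerivAt.clm_apply hLd.hasFDerivAt
          have e2 : HasFDerivAt (fun z => B (z, w z)) _ y :=
            hBd.hasFDerivAt.comp y ((hasFDerivAt_id y).prodMk hwd.hasFDerivAt)
          have e3 : (fun z => D z (L z)) =ᶠ[𝓝 y] fun z => B (z, w z) := by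
            filter_upwards [hDw, Metric.isOpen_ball.mem_nhds hy,
              ℓ.continuous.continuousAt.eventually (lt_mem_nhds hy0)] with z hz1 hz2 hz3
            rw [hz1, h.equation z hz2 hz3]
          have e4 := DFunLike.congr_fun ((e2.congr_of_eventuallyEq e3).unique e1) v
          simp only [ContinuousLinearMap.comp_apply, ContinuousLinearMap.prod_apply,
            ContinuousLinearMap.id_apply, add_apply,
            ContinuousLinearMap.flip_apply] at e4
          rw [hDw.self_of_nhds] at e4 ⊢
          rw [e4]
          exact add_comm _ _
        have hTd : HasFDerivAt T (fderiv ℝ D y - fderiv ℝ K y) y :=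
          hDd.hasFDerivAt.sub hKd.hasFDerivAt
        rw [(hwd.hasFDerivAt.prodMk hTd).fderiv]
        simp only [ContinuousLinearMap.prod_apply, B', T, sub_add_cancel]
        rw [h.equation y hy hy0, fderivWithin_of_mem_nhds hBn, fderivWithin_of_mem_nhds hyU,
          fderivWithin_of_mem_nhds hyU]
        refine Prod.ext rfl ?_
        ext v
        simp only [sub_apply, ContinuousLinearMap.comp_apply,
          ContinuousLinearMap.prod_apply, ContinuousLinearMap.id_apply]
        rw [← hdiff v, hsym v]
        abel
    obtain ⟨r', hr', hW'⟩ := ih hr hW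
    set ρ := min r' r with hρ
    have hρ0 : 0 < ρ := lt_min hr' hr
    have hW'' := hW'.mono (halfBall_subset (ℓ := ℓ) (g := g) (min_le_left r' r))
    have hwk : ContDiffOn ℝ k w (halfBall ℓ g ρ) := contDiff_fst.comp_contDiffOn hW''
    have hDk : ContDiffOn ℝ k D (halfBall ℓ g ρ) := by
      have e1 : ContDiffOn ℝ k T (halfBall ℓ g ρ) := contDiff_snd.comp_contDiffOn hW''
      have e2 : ContDiffOn ℝ k K (halfBall ℓ g ρ) :=
        (hKU.mono (halfBall_subset (min_le_right r' r))).of_le (by exact_mod_cast le_top)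
      exact (e1.add e2).congr fun y _ => by simp [T]
    refine ⟨ρ / 2, by positivity, ?_⟩
    rw [Nat.cast_succ, contDiffOn_succ_iff_hasFDerivWithinAt_of_uniqueDiffOn
      (uniqueDiffOn_halfBall hν g _)]
    refine ⟨by simp, D, hDk.mono (halfBall_subset (by linarith)), fun y hy => ?_⟩
    set S : Set E := {z | 0 < ℓ z} ∩ Metric.ball g (ρ / 2) with hS
    have hcl : closure S ⊆ halfBall ℓ g ρ := by
      refine (closure_inter_subset_inter_closure _ _).trans (inter_subset_inter ?_ ?_)
      · exact closure_minimal (fun z hz => (show 0 < ℓ z from hz).le) (isClosed_halfSpace ℓ)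
      · exact Metric.closure_ball_subset_closedBall.trans
          (Metric.closedBall_subset_ball (by linarith))
    have hSc : S ⊆ halfBall ℓ g ρ := subset_closure.trans hcl
    have hSd : ∀ z ∈ S, DifferentiableAt ℝ w z := fun z hz =>
      (h.smooth_sol.contDiffAt (nonGlancing_mem_nhds h.smooth_field.continuousOn
        (Metric.ball_subset_ball (min_le_right r' r) (hSc hz).2) hz.1)).differentiableAt (by simp)
    refine (hasFDerivWithinAt_closure_of_tendsto_fderiv (s := S) (f' := D y)
      (fun z hz => (hSd z hz).differentiableWithinAt) ?_ ?_ ?_ ?_).mono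
      fun z hz => mem_closure_interior_halfBall hν hz
    · exact ((convex_Ioi (0 : ℝ)).is_linear_preimage ℓ.toLinearMap.isLinear).inter
        (convex_ball _ _)
    · exact (isOpen_Ioi.preimage ℓ.continuous).inter Metric.isOpen_ball
    · exact fun z hz => (hwk.continuousOn z (hcl hz)).mono hSc
    · refine (((hDk.continuousOn y (halfBall_subset (by linarith) hy)).mono hSc).tendsto).congr' ?_
      filter_upwards [self_mem_nhdsWithin] with z hz
      have : ℓ z ≠ 0 := ne_of_gt hz.1
      simp [D, this]

end Glancing

/-! ### Vector fields in charts -/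

section Charts

variable {n : ℕ} [NeZero n]

variable (n) in
/-- The linear function whose nonnegative half-space models a manifold with boundary. -/
noncomputable def firstCoord : EuclideanSpace ℝ (Fin n) →L[ℝ] ℝ := EuclideanSpace.proj 0

variable (n) in
/-- The first basis vector, which points into the model half-space. -/
noncomputable def inwardVector : EuclideanSpace ℝ (Fin n) := EuclideanSpace.single 0 1

lemma firstCoord_inwardVector : firstCoord n (inwardVector n) = 1 := by
  simp [firstCoord, inwardVector]

lemma range_model_eq : range (𝓡∂ n) = halfSpace (firstCoord n) := by
  rw [range_modelWithCornersEuclideanHalfSpace]; rfl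

variable {M : Type*} [TopologicalSpace M] [ChartedSpace (EuclideanHalfSpace n) M]

/-- The vector field `L` in the coordinates of the chart centred at `c`. -/
noncomputable def chartField (L : (x : M) → TangentSpace (𝓡∂ n) x) (c : M)
    (y : EuclideanSpace ℝ (Fin n)) : EuclideanSpace ℝ (Fin n) :=
  mfderiv (𝓡∂ n) 𝓘(ℝ, EuclideanSpace ℝ (Fin n)) (extChartAt (𝓡∂ n) c)
    ((extChartAt (𝓡∂ n) c).symm y) (L ((extChartAt (𝓡∂ n) c).symm y))

lemma chartField_apply (L : (x : M) → TangentSpace (𝓡∂ n) x) {c x : M}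
    (hx : x ∈ (extChartAt (𝓡∂ n) c).source) :
    chartField L c (extChartAt (𝓡∂ n) c x) =
      mfderiv (𝓡∂ n) 𝓘(ℝ, EuclideanSpace ℝ (Fin n)) (extChartAt (𝓡∂ n) c) x (L x) := by
  unfold chartField
  rw [(extChartAt (𝓡∂ n) c).left_inv hx]

lemma extChartAt_target_mem {c : M} {y : EuclideanSpace ℝ (Fin n)}
    (hy : y ∈ (extChartAt (𝓡∂ n) c).target) :
    (extChartAt (𝓡∂ n) c).target ∈ 𝓝[halfSpace (firstCoord n)] y := by
  rw [← range_model_eq]; exact extChartAt_target_mem_nhdsWithin_of_mem hy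

lemma extChartAt_target_subset (c : M) :
    (extChartAt (𝓡∂ n) c).target ⊆ halfSpace (firstCoord n) := by
  rw [← range_model_eq]; exact extChartAt_target_subset_range c

variable [IsManifold (𝓡∂ n) ∞ M]

lemma mem_boundary_iff {c x : M} (hx : x ∈ (extChartAt (𝓡∂ n) c).source) :
    x ∈ (𝓡∂ n).boundary M ↔ firstCoord n (extChartAt (𝓡∂ n) c x) = 0 := by
  have hx' : x ∈ (chartAt (EuclideanHalfSpace n) c).source := by rwa [← extChartAt_source (𝓡∂ n)]
  have h1 := (𝓡∂ n).isInteriorPoint_iff_of_mem_atlas (n := ∞) (by simp)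
    (chart_mem_atlas (EuclideanHalfSpace n) c) hx'
  change (𝓡∂ n).IsInteriorPoint x ↔ extChartAt (𝓡∂ n) c x ∈ interior (extChartAt (𝓡∂ n) c).target
    at h1
  have hy := (extChartAt (𝓡∂ n) c).map_source hx
  have hH : 0 ≤ firstCoord n (extChartAt (𝓡∂ n) c x) := extChartAt_target_subset c hy
  have h2 : extChartAt (𝓡∂ n) c x ∈ interior (extChartAt (𝓡∂ n) c).target ↔
      0 < firstCoord n (extChartAt (𝓡∂ n) c x) := by
    constructor
    · intro h
      have h3 := interior_mono (extChartAt_target_subset_range (I := 𝓡∂ n) c) h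
      rw [interior_range_modelWithCornersEuclideanHalfSpace] at h3
      exact h3
    · intro h
      rw [mem_interior_iff_mem_nhds, ← nhdsWithin_eq_nhds.2 (halfSpace_mem_nhds h)]
      exact extChartAt_target_mem hy
  have h3 : x ∈ (𝓡∂ n).boundary M ↔ ¬ (𝓡∂ n).IsInteriorPoint x := by
    rw [(𝓡∂ n).isInteriorPoint_iff_not_isBoundaryPoint, not_not]; rfl
  rw [h3, h1, h2, not_lt]
  exact ⟨fun h => le_antisymm h hH, fun h => h.le⟩

lemma contDiffOn_chartField {L : (x : M) → TangentSpace (𝓡∂ n) x}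
    (hL : ContMDiff (𝓡∂ n) (𝓡∂ n).tangent ∞ (fun x => (⟨x, L x⟩ : TangentBundle (𝓡∂ n) M)))
    (c : M) : ContDiffOn ℝ ∞ (chartField L c) (extChartAt (𝓡∂ n) c).target := by
  rw [← contMDiffOn_iff_contDiffOn]
  set e := trivializationAt (EuclideanSpace ℝ (Fin n)) (TangentSpace (𝓡∂ n) (M := M)) c with he
  have h1 : ContMDiffOn (𝓡∂ n) 𝓘(ℝ, EuclideanSpace ℝ (Fin n)) ∞ (fun x => (e ⟨x, L x⟩).2)
      (extChartAt (𝓡∂ n) c).source := by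
    intro x hx
    refine ((e.contMDiffAt_section_iff ?_).1 (hL x)).contMDiffWithinAt
    simpa [he] using hx
  refine (h1.comp (contMDiffOn_extChartAt_symm c) fun y hy =>
    (extChartAt (𝓡∂ n) c).map_target hy).congr fun y hy => ?_
  have hy' := (extChartAt (𝓡∂ n) c).map_target hy
  rw [extChartAt_source] at hy'
  have := TangentBundle.continuousLinearMapAt_trivializationAt (I := 𝓡∂ n) (𝕜 := ℝ) hy'
  unfold chartField
  rw [← this]
  simp only [Function.comp_apply]
  exact Bundle.Trivialization.continuousLinearMapAt_apply_of_mem (R := ℝ) e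
    (by simpa [he] using hy') (L ((extChartAt (𝓡∂ n) c).symm y))

omit [NeZero n] [TopologicalSpace M] [ChartedSpace (EuclideanHalfSpace n) M]
  [IsManifold (𝓡∂ n) ∞ M] in
lemma hasMFDerivWithinAt_iff_hasDerivWithinAt {F : Type*} [NormedAddCommGroup F] [NormedSpace ℝ F]
    {f : ℝ → F} {f' : F} {J : Set ℝ} {t : ℝ}
    {A : TangentSpace 𝓘(ℝ, ℝ) t →L[ℝ] TangentSpace 𝓘(ℝ, F) (f t)} (hA : A (1 : ℝ) = f') :
    HasMFDerivWithinAt 𝓘(ℝ, ℝ) 𝓘(ℝ, F) f J t A ↔ HasDerivWithinAt f f' J t := by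
  have h1 : HasMFDerivWithinAt 𝓘(ℝ, ℝ) 𝓘(ℝ, F) f J t A ↔
      HasFDerivWithinAt f (A : ℝ →L[ℝ] F) J t := hasMFDerivWithinAt_iff_hasFDerivWithinAt
  have h2 : (A : ℝ →L[ℝ] F) = ContinuousLinearMap.toSpanSingleton ℝ f' := by
    ext
    exact hA.trans (one_smul ℝ f').symm
  rw [h1, h2, hasDerivWithinAt_iff_hasFDerivWithinAt]
  exact Iff.rfl

/-- In a chart, an integral curve solves the corresponding ordinary differential equation. -/
lemma hasDerivWithinAt_chart {L : (x : M) → TangentSpace (𝓡∂ n) x} {γ : ℝ → M} {J : Set ℝ}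
    (hγ : IsMIntegralCurveOn γ L J) {c : M} {t : ℝ} (ht : t ∈ J)
    (hc : γ t ∈ (extChartAt (𝓡∂ n) c).source) :
    HasDerivWithinAt (fun s => extChartAt (𝓡∂ n) c (γ s))
      (chartField L c (extChartAt (𝓡∂ n) c (γ t))) J t := by
  rw [chartField_apply L hc]
  rw [extChartAt_source] at hc
  have h1 := (mdifferentiableAt_extChartAt (I := 𝓡∂ n) hc).hasMFDerivAt
  refine (hasMFDerivWithinAt_iff_hasDerivWithinAt ?_).1 (h1.comp_hasMFDerivWithinAt t (hγ t ht))
  exact congrArg (mfderiv (𝓡∂ n) 𝓘(ℝ, EuclideanSpace ℝ (Fin n)) (extChartAt (𝓡∂ n) c) (γ t))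
    (one_smul ℝ (L (γ t)))

lemma isCurveOn_chart {L : (x : M) → TangentSpace (𝓡∂ n) x} {γ : ℝ → M} {s t : ℝ}
    (hγ : IsMIntegralCurveOn γ L (Icc s t)) {c : M}
    (hc : ∀ τ ∈ Icc s t, γ τ ∈ (extChartAt (𝓡∂ n) c).source) :
    IsCurveOn (chartField L c) (fun τ => extChartAt (𝓡∂ n) c (γ τ)) s t :=
  fun τ hτ => hasDerivWithinAt_chart hγ hτ (hc τ hτ)

lemma hasMFDerivWithinAt_of_chart {L : (x : M) → TangentSpace (𝓡∂ n) x} {γ : ℝ → M} {J : Set ℝ}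
    {c : M} {t : ℝ} (hγ : ContinuousWithinAt γ J t)
    (hc : γ t ∈ (extChartAt (𝓡∂ n) c).source)
    (h : HasDerivWithinAt (fun s => extChartAt (𝓡∂ n) c (γ s))
      (chartField L c (extChartAt (𝓡∂ n) c (γ t))) J t) :
    HasMFDerivWithinAt 𝓘(ℝ, ℝ) (𝓡∂ n) γ J t ((1 : ℝ →L[ℝ] ℝ).smulRight (L (γ t))) := by
  have hy := (extChartAt (𝓡∂ n) c).map_source hc
  set J' := J ∩ γ ⁻¹' (extChartAt (𝓡∂ n) c).source with hJ'
  have hJn : J' ∈ 𝓝[J] t := inter_mem self_mem_nhdsWithin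
    (hγ.preimage_mem_nhdsWithin ((isOpen_extChartAt_source c).mem_nhds hc))
  have h0 : HasMFDerivWithinAt 𝓘(ℝ, ℝ) 𝓘(ℝ, EuclideanSpace ℝ (Fin n))
      (fun s => extChartAt (𝓡∂ n) c (γ s)) J' t ((1 : ℝ →L[ℝ] ℝ).smulRight
        (chartField L c (extChartAt (𝓡∂ n) c (γ t)))) := by
    exact (hasMFDerivWithinAt_iff_hasDerivWithinAt (one_smul ℝ _)).2 (h.mono inter_subset_left)
  have h1 := (mdifferentiableWithinAt_extChartAt_symm (I := 𝓡∂ n) hy).hasMFDerivWithinAt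
  have hsub : J' ⊆ (fun s => extChartAt (𝓡∂ n) c (γ s)) ⁻¹' range (𝓡∂ n) := fun s hs =>
    extChartAt_target_subset_range c ((extChartAt (𝓡∂ n) c).map_source hs.2)
  have h2 := HasMFDerivWithinAt.comp t h1 h0 hsub
  have h3 : HasMFDerivWithinAt 𝓘(ℝ, ℝ) (𝓡∂ n) γ J' t _ := h2.congr_of_eventuallyEq
    (eventually_nhdsWithin_of_forall fun s hs => ((extChartAt (𝓡∂ n) c).left_inv hs.2).symm)
    ((extChartAt (𝓡∂ n) c).left_inv hc).symm
  have h4 : HasMFDerivWithinAt 𝓘(ℝ, ℝ) (𝓡∂ n) γ J t _ := h3.mono_of_mem_nhdsWithin hJn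
  refine h4.congr_mfderiv (ContinuousLinearMap.ext fun a : ℝ => ?_)
  have := DFunLike.congr_fun
    (mfderivWithin_extChartAt_symm_comp_mfderiv_extChartAt' (I := 𝓡∂ n) hc) (L (γ t))
  rw [chartField_apply L hc]
  refine (map_smul (mfderivWithin 𝓘(ℝ, EuclideanSpace ℝ (Fin n)) (𝓡∂ n)
    (extChartAt (𝓡∂ n) c).symm (range (𝓡∂ n)) (extChartAt (𝓡∂ n) c (γ t))) a _).trans ?_
  exact congrArg (fun v : EuclideanSpace ℝ (Fin n) => a • v) this

lemma contMDiffAt_iff_chart {F : Type*} [NormedAddCommGroup F] [NormedSpace ℝ F] {f : M → F}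
    {k : WithTop ℕ∞} (hk : k ≤ ((⊤ : ℕ∞) : WithTop ℕ∞)) {c x : M}
    (hx : x ∈ (extChartAt (𝓡∂ n) c).source) :
    ContMDiffAt (𝓡∂ n) 𝓘(ℝ, F) k f x ↔
      ContDiffWithinAt ℝ k (fun y => f ((extChartAt (𝓡∂ n) c).symm y)) (halfSpace (firstCoord n))
        (extChartAt (𝓡∂ n) c x) := by
  have : IsManifold (𝓡∂ n) k M := IsManifold.of_le hk
  rw [extChartAt_source] at hx
  rw [contMDiffAt_iff_source_of_mem_source hx, contMDiffWithinAt_iff_contDiffWithinAt,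
    range_model_eq]
  rfl

lemma contDiffOn_chart {F : Type*} [NormedAddCommGroup F] [NormedSpace ℝ F] {f : M → F}
    (hf : ContMDiff (𝓡∂ n) 𝓘(ℝ, F) ∞ f) (c : M) :
    ContDiffOn ℝ ∞ (fun y => f ((extChartAt (𝓡∂ n) c).symm y)) (extChartAt (𝓡∂ n) c).target := by
  intro y hy
  have h := (contMDiffAt_iff_chart le_rfl ((extChartAt (𝓡∂ n) c).map_target hy)).1
    (hf ((extChartAt (𝓡∂ n) c).symm y))
  rw [(extChartAt (𝓡∂ n) c).right_inv hy] at h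
  exact h.mono (extChartAt_target_subset c)

/-- The derivative along a vector field in a chart. -/
lemma fderivWithin_chartField {F : Type*} [NormedAddCommGroup F] [NormedSpace ℝ F] {f : M → F}
    (L : (x : M) → TangentSpace (𝓡∂ n) x) {c x : M} (hx : x ∈ (extChartAt (𝓡∂ n) c).source)
    (hf : MDifferentiableAt (𝓡∂ n) 𝓘(ℝ, F) f x) :
    fderivWithin ℝ (fun y => f ((extChartAt (𝓡∂ n) c).symm y)) (halfSpace (firstCoord n))
        (extChartAt (𝓡∂ n) c x) (chartField L c (extChartAt (𝓡∂ n) c x)) = lieDeriv L f x := by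
  have hy := (extChartAt (𝓡∂ n) c).map_source hx
  have h1 := (mdifferentiableWithinAt_extChartAt_symm (I := 𝓡∂ n) hy).hasMFDerivWithinAt
  have hf' : HasMFDerivAt (𝓡∂ n) 𝓘(ℝ, F) f ((extChartAt (𝓡∂ n) c).symm (extChartAt (𝓡∂ n) c x))
      (mfderiv (𝓡∂ n) 𝓘(ℝ, F) f ((extChartAt (𝓡∂ n) c).symm (extChartAt (𝓡∂ n) c x))) := by
    rw [(extChartAt (𝓡∂ n) c).left_inv hx]
    exact hf.hasMFDerivAt
  let A : EuclideanSpace ℝ (Fin n) →L[ℝ] F := ContinuousLinearMap.comp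
    (mfderiv (𝓡∂ n) 𝓘(ℝ, F) f ((extChartAt (𝓡∂ n) c).symm (extChartAt (𝓡∂ n) c x)))
    (mfderivWithin 𝓘(ℝ, EuclideanSpace ℝ (Fin n)) (𝓡∂ n) (extChartAt (𝓡∂ n) c).symm
      (range (𝓡∂ n)) (extChartAt (𝓡∂ n) c x))
  have h2 : HasFDerivWithinAt (fun y => f ((extChartAt (𝓡∂ n) c).symm y)) A (range (𝓡∂ n))
      (extChartAt (𝓡∂ n) c x) := (hf'.comp_hasMFDerivWithinAt _ h1).hasFDerivWithinAt
  rw [range_model_eq] at h2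
  have hu : UniqueDiffWithinAt ℝ (halfSpace (firstCoord n)) (extChartAt (𝓡∂ n) c x) :=
    uniqueDiffOn_halfSpace firstCoord_inwardVector _ (extChartAt_target_subset c hy)
  have h3 := h2.fderivWithin hu
  rw [h3, chartField_apply L hx]
  have h5 := DFunLike.congr_fun
    (mfderivWithin_extChartAt_symm_comp_mfderiv_extChartAt' (I := 𝓡∂ n) hx) (L x)
  have h6 := (extChartAt (𝓡∂ n) c).left_inv hx
  unfold lieDeriv
  refine (congrArg (mfderiv (𝓡∂ n) 𝓘(ℝ, F) f
    ((extChartAt (𝓡∂ n) c).symm (extChartAt (𝓡∂ n) c x))) h5).trans ?_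
  rw [h6]
  rfl

omit [IsManifold (𝓡∂ n) ∞ M] in
/-- The derivative of a function along an integral curve. -/
lemma hasDerivWithinAt_comp_curve {F : Type*} [NormedAddCommGroup F] [NormedSpace ℝ F] {f : M → F}
    {L : (x : M) → TangentSpace (𝓡∂ n) x} {γ : ℝ → M} {J : Set ℝ} {t : ℝ}
    (hγ : IsMIntegralCurveOn γ L J) (ht : t ∈ J)
    (hf : MDifferentiableAt (𝓡∂ n) 𝓘(ℝ, F) f (γ t)) :
    HasDerivWithinAt (fun s => f (γ s)) (lieDeriv L f (γ t)) J t := by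
  refine (hasMFDerivWithinAt_iff_hasDerivWithinAt ?_).1
    (hf.hasMFDerivAt.comp_hasMFDerivWithinAt t (hγ t ht))
  exact congrArg (mfderiv (𝓡∂ n) 𝓘(ℝ, F) f (γ t)) (one_smul ℝ (L (γ t)))

end Charts

/-! ### Strict convexity in charts -/

section Convexity

variable {n : ℕ} [NeZero n] {M : Type*} [TopologicalSpace M]
  [ChartedSpace (EuclideanHalfSpace n) M] [IsManifold (𝓡∂ n) ∞ M]

lemma hasFDerivWithinAt_chart_of_mfderiv_eq_zero {F : Type*} [NormedAddCommGroup F]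
    [NormedSpace ℝ F] {f : M → F} {c x : M} (hx : x ∈ (extChartAt (𝓡∂ n) c).source)
    (hf : MDifferentiableAt (𝓡∂ n) 𝓘(ℝ, F) f x) (h0 : mfderiv (𝓡∂ n) 𝓘(ℝ, F) f x = 0) :
    HasFDerivWithinAt (fun y => f ((extChartAt (𝓡∂ n) c).symm y))
      (0 : EuclideanSpace ℝ (Fin n) →L[ℝ] F) (halfSpace (firstCoord n))
      (extChartAt (𝓡∂ n) c x) := by
  have hy := (extChartAt (𝓡∂ n) c).map_source hx
  have h1 := (mdifferentiableWithinAt_extChartAt_symm (I := 𝓡∂ n) hy).hasMFDerivWithinAt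
  have hf' : HasMFDerivAt (𝓡∂ n) 𝓘(ℝ, F) f ((extChartAt (𝓡∂ n) c).symm (extChartAt (𝓡∂ n) c x))
      0 := by
    rw [(extChartAt (𝓡∂ n) c).left_inv hx]
    have := hf.hasMFDerivAt
    rwa [h0] at this
  have h2 := (hf'.comp_hasMFDerivWithinAt _ h1).hasFDerivWithinAt
  rw [range_model_eq] at h2
  refine HasFDerivWithinAt.congr_fderiv h2 ?_
  ext
  rfl

/-- There is a boundary defining function which near a given point is the first coordinate of a
given chart. -/
theorem exists_isBoundaryDefining [T2Space M] [CompactSpace M] {c x₀ : M}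
    (hx₀ : x₀ ∈ (extChartAt (𝓡∂ n) c).source) :
    ∃ ρ : M → ℝ, IsBoundaryDefining (n := n) ρ ∧
      ∀ᶠ x in 𝓝 x₀, ρ x = firstCoord n (extChartAt (𝓡∂ n) c x) := by
  obtain ⟨K, hK, hKc, hKS⟩ := exists_mem_nhds_isClosed_subset
    ((isOpen_extChartAt_source (I := 𝓡∂ n) c).mem_nhds hx₀)
  -- Only the chart at `c` is used on the neighbourhood `K` of `x₀`.
  let κ : Option M → M := fun i => i.elim c id
  let U : Option M → Set M := fun i => i.elim (extChartAt (𝓡∂ n) c).source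
    fun i => (extChartAt (𝓡∂ n) i).source ∩ Kᶜ
  have hUo : ∀ i, IsOpen (U i) := by
    rintro (_ | i)
    · exact isOpen_extChartAt_source c
    · exact (isOpen_extChartAt_source i).inter hKc.isOpen_compl
  have hUκ : ∀ i, U i ⊆ (extChartAt (𝓡∂ n) (κ i)).source := by
    rintro (_ | i)
    · exact subset_rfl
    · exact inter_subset_left
  have hcov : (univ : Set M) ⊆ ⋃ i, U i := by
    intro x _
    by_cases hx : x ∈ K
    · exact mem_iUnion.2 ⟨none, hKS hx⟩
    · exact mem_iUnion.2 ⟨some x, mem_extChartAt_source x, hx⟩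
  obtain ⟨f, hf⟩ := SmoothPartitionOfUnity.exists_isSubordinate (𝓡∂ n) isClosed_univ U hUo hcov
  have hfU : ∀ i x, f i x ≠ 0 → x ∈ (extChartAt (𝓡∂ n) (κ i)).source := fun i x hx =>
    hUκ i (hf i (subset_tsupport _ hx))
  let g : Option M → M → ℝ := fun i x => firstCoord n (extChartAt (𝓡∂ n) (κ i) x)
  have hg0 : ∀ i x, f i x ≠ 0 → 0 ≤ g i x := fun i x hx =>
    extChartAt_target_subset _ ((extChartAt (𝓡∂ n) (κ i)).map_source (hfU i x hx))
  have hgb : ∀ i x, f i x ≠ 0 → (x ∈ (𝓡∂ n).boundary M ↔ g i x = 0) := fun i x hx =>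
    mem_boundary_iff (hfU i x hx)
  let ρ : M → ℝ := fun x => ∑ᶠ i, f i x • g i x
  have hρs : ContMDiff (𝓡∂ n) 𝓘(ℝ, ℝ) ∞ ρ := by
    refine hf.contMDiff_finsum_smul hUo fun i => ?_
    refine (firstCoord n).contMDiff.comp_contMDiffOn ?_
    refine (contMDiffOn_extChartAt (x := κ i)).mono ?_
    rw [← extChartAt_source (𝓡∂ n)]
    exact hUκ i
  have hρn : ∀ x, 0 ≤ ρ x := fun x =>
    f.finsum_smul_mem_convex (mem_univ x) (fun i hi => hg0 i x hi) (convex_Ici 0)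
  have hρb : ∀ x ∈ (𝓡∂ n).boundary M, ρ x = 0 := fun x hx =>
    f.finsum_smul_mem_convex (t := {0}) (mem_univ x) (fun i hi => (hgb i x hi).1 hx)
      (convex_singleton 0)
  have hρi : ∀ x ∉ (𝓡∂ n).boundary M, 0 < ρ x := fun x hx =>
    f.finsum_smul_mem_convex (mem_univ x) (fun i hi => lt_of_le_of_ne (hg0 i x hi)
      fun h => hx ((hgb i x hi).2 h.symm)) (convex_Ioi 0)
  have hρge : ∀ i x, f i x * g i x ≤ ρ x := by
    intro i x
    have hfin : (Function.support fun i => f i x • g i x).Finite :=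
      (f.locallyFinite.point_finite x).subset fun j hj => by
        simp only [Function.mem_support, ne_eq, smul_eq_zero, not_or] at hj
        exact hj.1
    refine single_le_finsum i hfin fun j => ?_
    by_cases hj : f j x = 0
    · simp [hj]
    · exact mul_nonneg (f.nonneg j x) (hg0 j x hj)
  refine ⟨ρ, ⟨hρs, hρn, fun x => ⟨fun h => ?_, hρb x⟩, fun x hx h0 => ?_⟩, ?_⟩
  · by_contra hx
    exact (hρi x hx).ne' h
  · obtain ⟨i, hi⟩ := f.exists_pos_of_mem (mem_univ x)
    have hxs := hfU i x hi.ne'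
    set φ := extChartAt (𝓡∂ n) (κ i) with hφ
    have hφ0 : firstCoord n (φ x) = 0 := (hgb i x hi.ne').1 hx
    have hd := hasFDerivWithinAt_chart_of_mfderiv_eq_zero hxs
      (hρs.mdifferentiableAt (by simp)) h0
    have hline : HasDerivWithinAt (fun t : ℝ => φ x + t • inwardVector n) (inwardVector n)
        (Ici 0) 0 := by
      simpa using (((hasDerivAt_id (0 : ℝ)).smul_const (inwardVector n)).const_add
        (φ x)).hasDerivWithinAt
    have hlineH : MapsTo (fun t : ℝ => φ x + t • inwardVector n) (Ici 0)
        (halfSpace (firstCoord n)) := fun t ht => by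
      have : 0 ≤ t := ht
      simpa [halfSpace, hφ0, firstCoord_inwardVector] using this
    have hx0 : φ x + (0 : ℝ) • inwardVector n = φ x := by simp
    have hs : HasDerivWithinAt (fun t : ℝ => ρ (φ.symm (φ x + t • inwardVector n))) 0 (Ici 0) 0 := by
      have hd' := hd
      rw [← hx0] at hd'
      exact hd'.comp_hasDerivWithinAt (0 : ℝ) hline hlineH
    have hslope := hasDerivWithinAt_iff_tendsto_slope' (by simp) |>.1 hs.Ioi_of_Ici
    have htend : Tendsto (fun t : ℝ => φ x + t • inwardVector n) (𝓝[>] 0)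
        (𝓝[halfSpace (firstCoord n)] (φ x)) := by
      refine tendsto_nhdsWithin_iff.2 ⟨?_, ?_⟩
      · have h1 := hline.continuousWithinAt.tendsto
        rw [hx0] at h1
        exact h1.mono_left (nhdsWithin_mono _ Ioi_subset_Ici_self)
      · filter_upwards [self_mem_nhdsWithin] with t ht using hlineH (Ioi_subset_Ici_self ht)
    have hxt := φ.map_source hxs
    have htar : ∀ᶠ t in 𝓝[>] (0 : ℝ), φ x + t • inwardVector n ∈ φ.target :=
      htend.eventually (extChartAt_target_mem hxt)
    have hfi : Tendsto (fun t : ℝ => f i (φ.symm (φ x + t • inwardVector n))) (𝓝[>] 0)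
        (𝓝 (f i x)) := by
      have h1 : ContinuousWithinAt (fun y => f i (φ.symm y)) (halfSpace (firstCoord n)) (φ x) :=
        ((contMDiffAt_iff_chart le_rfl hxs).1 ((f i).contMDiff x)).continuousWithinAt
      have h2 := h1.tendsto.comp htend
      rwa [φ.left_inv hxs] at h2
    have hle : f i x - 0 ≤ 0 := by
      refine le_of_tendsto (hfi.sub hslope) ?_
      filter_upwards [htar, self_mem_nhdsWithin] with t ht ht0
      have ht0' : 0 < t := ht0
      have e1 : g i (φ.symm (φ x + t • inwardVector n)) = t := by
        change firstCoord n (φ (φ.symm (φ x + t • inwardVector n))) = t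
        rw [φ.right_inv ht]
        simp [hφ0, firstCoord_inwardVector]
      have e2 := hρge i (φ.symm (φ x + t • inwardVector n))
      rw [e1] at e2
      rw [slope_def_field, hx0, φ.left_inv hxs, hρb x hx, sub_zero, sub_zero, sub_nonpos,
        le_div_iff₀ ht0']
      exact e2
    linarith
  · filter_upwards [hK] with x hx
    have h1 : ∀ i, i ≠ none → f i x = 0 := by
      rintro (_ | i) hi
      · exact absurd rfl hi
      · by_contra h
        exact (hf (some i) (subset_tsupport _ h)).2 hx
    have h2 : f none x = 1 := by
      rw [← f.sum_eq_one (mem_univ x)]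
      exact (finsum_eq_single _ none h1).symm
    change ∑ᶠ i, f i x • g i x = _
    rw [finsum_eq_single _ none fun i hi => by simp [h1 i hi], h2, one_smul]
    rfl

/-- Strict convexity in the coordinates of a chart. -/
theorem IsStrictlyConvex.chartField [T2Space M] [CompactSpace M]
    {L : (x : M) → TangentSpace (𝓡∂ n) x} (h : IsStrictlyConvex L)
    (hL : ContMDiff (𝓡∂ n) (𝓡∂ n).tangent ∞ (fun x => (⟨x, L x⟩ : TangentBundle (𝓡∂ n) M)))
    {c x : M} (hx : x ∈ (extChartAt (𝓡∂ n) c).source) (hxb : x ∈ (𝓡∂ n).boundary M)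
    (h0 : firstCoord n (chartField L c (extChartAt (𝓡∂ n) c x)) = 0) :
    firstCoord n (fderivWithin ℝ (RealPrincipalType.chartField L c) (halfSpace (firstCoord n))
      (extChartAt (𝓡∂ n) c x) (RealPrincipalType.chartField L c (extChartAt (𝓡∂ n) c x))) < 0 := by
  obtain ⟨ρ, hρ, hρc⟩ := exists_isBoundaryDefining hx
  set φ := extChartAt (𝓡∂ n) c with hφ
  have hu := uniqueDiffOn_halfSpace (firstCoord_inwardVector (n := n))
  have hsrc : ∀ᶠ z in 𝓝 x, z ∈ φ.source := (isOpen_extChartAt_source c).mem_nhds hx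
  -- The chart expression of a function which is given near `z` by a formula in the chart.
  have hchart : ∀ {z : M} {f : M → ℝ} {f' : EuclideanSpace ℝ (Fin n) → ℝ}, z ∈ φ.source →
      (∀ᶠ z' in 𝓝 z, f z' = f' (φ z')) →
      (fun y => f (φ.symm y)) =ᶠ[𝓝[halfSpace (firstCoord n)] (φ z)] f' := by
    intro z f f' hz hf
    have hzt := φ.map_source hz
    have h1 : Tendsto φ.symm (𝓝[halfSpace (firstCoord n)] (φ z)) (𝓝 z) := by
      have := (continuousOn_extChartAt_symm (I := 𝓡∂ n) c (φ z) hzt).mono_of_mem_nhdsWithin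
        (extChartAt_target_mem hzt)
      have := this.tendsto
      rwa [φ.left_inv hz] at this
    filter_upwards [h1.eventually hf, extChartAt_target_mem hzt] with y hy hyt
    rw [hy, φ.right_inv hyt]
  have hlie : ∀ {z : M} {f : M → ℝ} {f' : EuclideanSpace ℝ (Fin n) → ℝ}, z ∈ φ.source →
      (∀ᶠ z' in 𝓝 z, f z' = f' (φ z')) → MDifferentiableAt (𝓡∂ n) 𝓘(ℝ, ℝ) f z →
      lieDeriv L f z = fderivWithin ℝ f' (halfSpace (firstCoord n)) (φ z)
        (RealPrincipalType.chartField L c (φ z)) := by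
    intro z f f' hz hf hfd
    rw [← fderivWithin_chartField L hz hfd]
    have h1 := hchart hz hf
    rw [h1.fderivWithin_eq_of_mem (extChartAt_target_subset c (φ.map_source hz))]
  have h1 : ∀ᶠ z in 𝓝 x, lieDeriv L ρ z =
      firstCoord n (RealPrincipalType.chartField L c (φ z)) := by
    filter_upwards [hρc.eventually_nhds, hsrc] with z hz hzs
    rw [hlie hzs hz (hρ.smooth.mdifferentiableAt (by simp)),
      (firstCoord n).hasFDerivWithinAt.fderivWithin
        (hu _ (extChartAt_target_subset c (φ.map_source hzs)))]
  have hd : DifferentiableWithinAt ℝ (RealPrincipalType.chartField L c)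
      (halfSpace (firstCoord n)) (φ x) :=
    (((contDiffOn_chartField hL c) _ (φ.map_source hx)).mono_of_mem_nhdsWithin
      (extChartAt_target_mem (φ.map_source hx))).differentiableWithinAt (by simp)
  have hC : ContDiffWithinAt ℝ 1 (fun y => firstCoord n (RealPrincipalType.chartField L c y))
      (halfSpace (firstCoord n)) (φ x) := by
    refine (firstCoord n).contDiff.comp_contDiffWithinAt ((((contDiffOn_chartField hL c) _
      (φ.map_source hx)).mono_of_mem_nhdsWithin
      (extChartAt_target_mem (φ.map_source hx))).of_le (by exact_mod_cast le_top))
  have hMd : MDifferentiableAt (𝓡∂ n) 𝓘(ℝ, ℝ) (lieDeriv L ρ) x := by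
    refine ContMDiffAt.mdifferentiableAt (n := 1) ?_ (by simp)
    rw [contMDiffAt_iff_chart (by exact_mod_cast le_top) hx]
    exact hC.congr_of_eventuallyEq (hchart
      (f' := fun y => firstCoord n (RealPrincipalType.chartField L c y)) hx h1)
      (by rw [φ.left_inv hx]; exact h1.self_of_nhds)
  have h2 := h ρ hρ x hxb (by rw [h1.self_of_nhds]; exact h0)
  rw [hlie (f' := fun y => firstCoord n (RealPrincipalType.chartField L c y)) hx h1 hMd] at h2
  have h3 := ((firstCoord n).hasFDerivAt.comp_hasFDerivWithinAt (φ x)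
    hd.hasFDerivWithinAt).fderivWithin (hu _ (extChartAt_target_subset c (φ.map_source hx)))
  simp only [Function.comp_def] at h3
  rw [h3] at h2
  exact h2

end Convexity

/-! ### Integral curves in a manifold with boundary -/

section IntegralCurves

lemma forall_mem_Icc_of_isOpen_isClosed {P : ℝ → Prop} {s t τ₀ : ℝ} (hτ₀ : τ₀ ∈ Icc s t)
    (h0 : P τ₀) (hopen : ∀ τ ∈ Icc s t, P τ → ∀ᶠ y in 𝓝[Icc s t] τ, P y)
    (hclosed : ∀ τ ∈ Icc s t, (∃ᶠ y in 𝓝[Icc s t] τ, P y) → P τ) : ∀ τ ∈ Icc s t, P τ := by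
  intro τ hτ
  refine isPreconnected_Icc.induction₂' (fun a b => P a → P b) (fun x hx => ?_)
    (fun x y z _ _ _ h h' hx => h' (h hx)) hτ₀ hτ h0
  by_cases hP : P x
  · filter_upwards [hopen x hx hP] with y hy using ⟨fun _ => hy, fun _ => hP⟩
  · have := mt (hclosed x hx) hP
    rw [not_frequently] at this
    filter_upwards [this] with y hy using ⟨fun h => absurd h hP, fun h => absurd h hy⟩

lemma exists_uIcc_subset_of_eventually {P : ℝ → Prop} {s t τ : ℝ} (hτ : τ ∈ Icc s t)
    (h : ∀ᶠ y in 𝓝[Icc s t] τ, P y) :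
    ∀ᶠ y in 𝓝[Icc s t] τ, ∀ z ∈ Icc (min τ y) (max τ y), z ∈ Icc s t ∧ P z := by
  obtain ⟨δ, hδ, hP⟩ := Metric.mem_nhdsWithin_iff.1 h
  filter_upwards [self_mem_nhdsWithin, mem_nhdsWithin_of_mem_nhds (Metric.ball_mem_nhds τ hδ)]
    with y hy hyb z hz
  have hz1 : z ∈ Icc s t := ⟨(le_min hτ.1 hy.1).trans hz.1, hz.2.trans (max_le hτ.2 hy.2)⟩
  refine ⟨hz1, hP ⟨?_, hz1⟩⟩
  rw [Metric.mem_ball, Real.dist_eq] at hyb ⊢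
  rw [abs_lt] at hyb ⊢
  rcases le_total τ y with h | h
  · rw [min_eq_left h, max_eq_right h] at hz
    constructor <;> linarith [hz.1, hz.2]
  · rw [min_eq_right h, max_eq_left h] at hz
    constructor <;> linarith [hz.1, hz.2]

variable {n : ℕ} [NeZero n] {M : Type*} [TopologicalSpace M]
  [ChartedSpace (EuclideanHalfSpace n) M] [IsManifold (𝓡∂ n) ∞ M]
  {L : (x : M) → TangentSpace (𝓡∂ n) x}

lemma exists_chart_extension
    (hL : ContMDiff (𝓡∂ n) (𝓡∂ n).tangent ∞ (fun x => (⟨x, L x⟩ : TangentBundle (𝓡∂ n) M)))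
    (k : ℕ) (c : M) : ∃ L' : EuclideanSpace ℝ (Fin n) → EuclideanSpace ℝ (Fin n), ∃ W,
      ContDiff ℝ k L' ∧ IsOpen W ∧ extChartAt (𝓡∂ n) c c ∈ W ∧
      ∀ y ∈ W, y ∈ halfSpace (firstCoord n) →
        y ∈ (extChartAt (𝓡∂ n) c).target ∧ chartField L c y = L' y := by
  have hc := mem_extChartAt_target (I := 𝓡∂ n) c
  obtain ⟨L', hL', h⟩ := exists_contDiff_extension (firstCoord_inwardVector (n := n))
    (extChartAt_target_subset c hc) k ((((contDiffOn_chartField hL c) _ hc).mono_of_mem_nhdsWithin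
      (extChartAt_target_mem hc)).of_le (by exact_mod_cast le_top))
  obtain ⟨W, hW, hcW, hWs⟩ := mem_nhdsWithin.1 (inter_mem h (extChartAt_target_mem hc))
  refine ⟨L', W, hL', hW, hcW, fun y hy hyH => ?_⟩
  obtain ⟨h1, h2⟩ := hWs ⟨hy, hyH⟩
  exact ⟨h2, h1.symm⟩

variable [T2Space M]
  (hL : ContMDiff (𝓡∂ n) (𝓡∂ n).tangent ∞ (fun x => (⟨x, L x⟩ : TangentBundle (𝓡∂ n) M)))
include hL

/-- Uniqueness of integral curves. -/
theorem eqOn_of_isMIntegralCurveOn {γ₁ γ₂ : ℝ → M} {s t τ₀ : ℝ}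
    (h₁ : IsMIntegralCurveOn γ₁ L (Icc s t)) (h₂ : IsMIntegralCurveOn γ₂ L (Icc s t))
    (hτ₀ : τ₀ ∈ Icc s t) (h0 : γ₁ τ₀ = γ₂ τ₀) : EqOn γ₁ γ₂ (Icc s t) := by
  refine forall_mem_Icc_of_isOpen_isClosed (P := fun τ => γ₁ τ = γ₂ τ) hτ₀ h0
    (fun τ hτ hP => ?_) fun τ hτ hf => ?_
  · obtain ⟨L', W, hL', hW, hcW, hWt⟩ := exists_chart_extension hL 1 (γ₁ τ)
    set φ := extChartAt (𝓡∂ n) (γ₁ τ) with hφ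
    have hO : φ.source ∩ φ ⁻¹' W ∈ 𝓝 (γ₁ τ) := inter_mem (extChartAt_source_mem_nhds _)
      ((continuousAt_extChartAt _).preimage_mem_nhds (hW.mem_nhds hcW))
    have e1 := (h₁ τ hτ).1.eventually hO
    have e2 := (h₂ τ hτ).1.eventually (hP ▸ hO)
    filter_upwards [exists_uIcc_subset_of_eventually hτ (e1.and e2)] with y hy
    have hsub : Icc (min τ y) (max τ y) ⊆ Icc s t := fun z hz => (hy z hz).1
    have hcurve : ∀ γ : ℝ → M, IsMIntegralCurveOn γ L (Icc s t) →
        (∀ z ∈ Icc (min τ y) (max τ y), γ z ∈ φ.source ∩ φ ⁻¹' W) →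
        IsCurveOn L' (fun σ => φ (γ σ)) (min τ y) (max τ y) := fun γ hγ hγO =>
      (isCurveOn_chart (hγ.mono hsub) fun z hz => (hγO z hz).1).congr_field fun z hz =>
        (hWt _ (hγO z hz).2 (extChartAt_target_subset _ (φ.map_source (hγO z hz).1))).2
    have hy' : y ∈ Icc (min τ y) (max τ y) := ⟨min_le_right _ _, le_max_right _ _⟩
    have := (hcurve γ₁ h₁ fun z hz => (hy z hz).2.1).eqOn (by exact_mod_cast hL')
      (hcurve γ₂ h₂ fun z hz => (hy z hz).2.2) (τ₀ := τ) ⟨min_le_left _ _, le_max_left _ _⟩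
      (by rw [hP]) hy'
    exact φ.injOn (hy y hy').2.1.1 (hy y hy').2.2.1 this
  · have h3 : Tendsto (fun y => (γ₁ y, γ₂ y)) (𝓝[Icc s t] τ) (𝓝 (γ₁ τ, γ₂ τ)) :=
      (h₁ τ hτ).1.tendsto.prodMk_nhds (h₂ τ hτ).1.tendsto
    exact isClosed_diagonal.mem_of_frequently_of_tendsto (s := diagonal M) hf h3

/-- The local flow of `L` in the chart at `c`, extended across the boundary; its trajectories are
integral curves of `L` as long as they stay in the half-space, and all integral curves arise in this
way. -/
theorem exists_chart_flow (c : M) :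
    ∃ (L' : EuclideanSpace ℝ (Fin n) → EuclideanSpace ℝ (Fin n))
      (Φ : ℝ × EuclideanSpace ℝ (Fin n) → EuclideanSpace ℝ (Fin n)), ∃ ε > 0, ∃ U ∈ 𝓝 c,
      Continuous L' ∧ L' (extChartAt (𝓡∂ n) c c) = chartField L c (extChartAt (𝓡∂ n) c c) ∧
      U ⊆ (extChartAt (𝓡∂ n) c).source ∧ ∀ x ∈ U,
        Φ (0, extChartAt (𝓡∂ n) c x) = extChartAt (𝓡∂ n) c x ∧
        IsCurveOn L' (fun τ => Φ (τ, extChartAt (𝓡∂ n) c x)) (-ε) ε ∧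
        ∀ s t, s ≤ 0 → 0 ≤ t → -ε ≤ s → t ≤ ε →
          ((∀ τ ∈ Icc s t, 0 ≤ firstCoord n (Φ (τ, extChartAt (𝓡∂ n) c x))) →
            IsMIntegralCurveOn (fun τ => (extChartAt (𝓡∂ n) c).symm
              (Φ (τ, extChartAt (𝓡∂ n) c x))) L (Icc s t)) ∧
          ∀ γ : ℝ → M, IsMIntegralCurveOn γ L (Icc s t) → γ 0 = x → ∀ τ ∈ Icc s t,
            Φ (τ, extChartAt (𝓡∂ n) c x) ∈ (extChartAt (𝓡∂ n) c).target ∧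
            γ τ = (extChartAt (𝓡∂ n) c).symm (Φ (τ, extChartAt (𝓡∂ n) c x)) := by
  obtain ⟨L', W, hL', hW, hcW, hWt⟩ := exists_chart_extension hL 1 c
  have hL'1 : ContDiff ℝ 1 L' := by exact_mod_cast hL'
  set φ := extChartAt (𝓡∂ n) c with hφ
  obtain ⟨Φ, ε, hε, r, hr, hΦ⟩ := exists_local_flow (k := 1) one_ne_zero hL' (φ c)
    (hW.mem_nhds hcW)
  refine ⟨L', Φ, ε, hε, φ.source ∩ φ ⁻¹' Metric.closedBall (φ c) r,
    inter_mem (extChartAt_source_mem_nhds _) ((continuousAt_extChartAt _).preimage_mem_nhds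
      (Metric.closedBall_mem_nhds _ hr)), hL'1.continuous,
    ((hWt _ hcW (extChartAt_target_subset c (mem_extChartAt_target c))).2).symm,
    inter_subset_left, fun x hx => ?_⟩
  obtain ⟨hΦ0, hΦW, hΦc, -⟩ := hΦ (φ x) hx.2
  refine ⟨hΦ0, hΦc, fun s t hs ht hs' ht' => ?_⟩
  set Z : ℝ → EuclideanSpace ℝ (Fin n) := fun τ => Φ (τ, φ x) with hZ
  have hZc : IsCurveOn L' Z s t := hΦc.mono hs' ht'
  have hZW : ∀ τ ∈ Icc s t, Z τ ∈ W := fun τ hτ =>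
    (hΦW τ ⟨hs'.trans hτ.1, hτ.2.trans ht'⟩).2
  refine ⟨fun hpos τ hτ => ?_, fun γ hγ hγ0 => ?_⟩
  · have hZt : ∀ σ ∈ Icc s t, Z σ ∈ φ.target ∧ chartField L c (Z σ) = L' (Z σ) := fun σ hσ =>
      hWt _ (hZW σ hσ) (hpos σ hσ)
    have hcont : ContinuousWithinAt (fun τ => φ.symm (Z τ)) (Icc s t) τ :=
      (continuousOn_extChartAt_symm c (Z τ) (hZt τ hτ).1).comp (hZc.continuousOn τ hτ)
        fun σ hσ => (hZt σ hσ).1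
    refine hasMFDerivWithinAt_of_chart (c := c) hcont (φ.map_target (hZt τ hτ).1) ?_
    simp only [← hφ]
    rw [φ.right_inv (hZt τ hτ).1, (hZt τ hτ).2]
    exact (hZc τ hτ).congr_of_mem (fun σ hσ => φ.right_inv (hZt σ hσ).1) hτ
  · suffices h : ∀ τ ∈ Icc s t, γ τ ∈ φ.source ∧ φ (γ τ) = Z τ by
      intro τ hτ
      obtain ⟨h1, h2⟩ := h τ hτ
      change Z τ ∈ _ ∧ _ = φ.symm (Z τ)
      rw [← h2]
      exact ⟨φ.map_source h1, (φ.left_inv h1).symm⟩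
    refine forall_mem_Icc_of_isOpen_isClosed ⟨hs, ht⟩ ⟨by rw [hγ0]; exact hx.1, ?_⟩
      (fun τ hτ hP => ?_) fun τ hτ hf => ?_
    · rw [hγ0]; exact hΦ0.symm
    · have hO : φ.source ∩ φ ⁻¹' W ∈ 𝓝 (γ τ) := inter_mem
        ((isOpen_extChartAt_source c).mem_nhds hP.1)
        ((continuousAt_extChartAt' hP.1).preimage_mem_nhds (hW.mem_nhds
          (by rw [← hφ, hP.2]; exact hZW τ hτ)))
      filter_upwards [exists_uIcc_subset_of_eventually hτ ((hγ τ hτ).1.eventually hO)] with y hy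
      have hsub : Icc (min τ y) (max τ y) ⊆ Icc s t := fun z hz => (hy z hz).1
      have hcurve : IsCurveOn L' (fun σ => φ (γ σ)) (min τ y) (max τ y) :=
        (isCurveOn_chart (hγ.mono hsub) fun z hz => (hy z hz).2.1).congr_field fun z hz =>
          (hWt _ (hy z hz).2.2 (extChartAt_target_subset _ (φ.map_source (hy z hz).2.1))).2
      have hy' : y ∈ Icc (min τ y) (max τ y) := ⟨min_le_right _ _, le_max_right _ _⟩
      have hτ' : τ ∈ Icc (min τ y) (max τ y) := ⟨min_le_left _ _, le_max_left _ _⟩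
      exact ⟨(hy y hy').2.1, hcurve.eqOn hL'1 (fun σ hσ => (hZc σ (hsub hσ)).mono hsub) hτ' hP.2
        hy'⟩
    · set S : Set ℝ := {y | y ∈ Icc s t ∧ γ y ∈ φ.source ∧ φ (γ y) = Z y} with hS
      have hSI : S ⊆ Icc s t := fun y hy => hy.1
      have hne : (𝓝[S] τ).NeBot := by
        rw [← mem_closure_iff_nhdsWithin_neBot, mem_closure_iff_frequently]
        rw [frequently_nhdsWithin_iff] at hf
        exact hf.mono fun y hy => ⟨hy.2, hy.1⟩
      have hZτ : Tendsto Z (𝓝[S] τ) (𝓝 (Z τ)) :=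
        ((hZc.continuousOn τ hτ).mono hSI).tendsto
      have hSt : ∀ y ∈ S, Z y ∈ φ.target := fun y hy => by
        rw [← hy.2.2]; exact φ.map_source hy.2.1
      have hpos : Z τ ∈ halfSpace (firstCoord n) :=
        (isClosed_halfSpace _).mem_of_tendsto hZτ (eventually_nhdsWithin_of_forall fun y hy =>
          extChartAt_target_subset c (hSt y hy))
      have hτt := (hWt _ (hZW τ hτ) hpos).1
      have h1 : Tendsto (fun y => φ.symm (Z y)) (𝓝[S] τ) (𝓝 (φ.symm (Z τ))) :=
        (continuousOn_extChartAt_symm c (Z τ) hτt).tendsto.comp (tendsto_nhdsWithin_iff.2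
          ⟨hZτ, eventually_nhdsWithin_of_forall hSt⟩)
      have h2 : Tendsto γ (𝓝[S] τ) (𝓝 (γ τ)) := ((hγ τ hτ).1.mono hSI).tendsto
      have h3 : γ τ = φ.symm (Z τ) := by
        refine tendsto_nhds_unique (h2.congr' ?_) h1
        filter_upwards [self_mem_nhdsWithin] with y hy
        rw [← hy.2.2, φ.left_inv hy.2.1]
      rw [h3]
      exact ⟨φ.map_target hτt, φ.right_inv hτt⟩

end IntegralCurves

/-! ### Integral curves and the boundary -/

section CurvesAndBoundary

/-- Curves characterized by a local condition can be concatenated. -/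
lemma exists_concat {X : Type*} {D : (ℝ → X) → Set ℝ → ℝ → Prop}
    (hcongr : ∀ γ γ' J t, t ∈ J → EqOn γ' γ J → D γ J t → D γ' J t)
    (hnhds : ∀ γ J J' t, J ∈ 𝓝[J'] t → t ∈ J → D γ J t → D γ J' t)
    (hunion : ∀ γ J J' t, D γ J t → D γ J' t → D γ (J ∪ J') t) {γ₁ γ₂ : ℝ → X} {a b c : ℝ}
    (hab : a ≤ b) (hbc : b ≤ c) (h₁ : ∀ t ∈ Icc a b, D γ₁ (Icc a b) t)
    (h₂ : ∀ t ∈ Icc b c, D γ₂ (Icc b c) t) (hb : γ₁ b = γ₂ b) :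
    ∃ γ, (∀ t ∈ Icc a c, D γ (Icc a c) t) ∧ EqOn γ γ₁ (Icc a b) ∧ EqOn γ γ₂ (Icc b c) := by
  classical
  let γ : ℝ → X := fun t => if t ≤ b then γ₁ t else γ₂ t
  have e₁ : EqOn γ γ₁ (Icc a b) := fun t ht => if_pos ht.2
  have e₂ : EqOn γ γ₂ (Icc b c) := by
    intro t ht
    rcases ht.1.eq_or_lt with h | h
    · rw [← h]; exact (if_pos le_rfl).trans hb
    · exact if_neg h.not_ge
  refine ⟨γ, fun t ht => ?_, e₁, e₂⟩
  have d₁ : ∀ t ∈ Icc a b, D γ (Icc a b) t := fun t ht => hcongr _ _ _ _ ht e₁ (h₁ t ht)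
  have d₂ : ∀ t ∈ Icc b c, D γ (Icc b c) t := fun t ht => hcongr _ _ _ _ ht e₂ (h₂ t ht)
  rcases lt_trichotomy t b with h | h | h
  · refine hnhds γ (Icc a b) _ t ?_ ⟨ht.1, h.le⟩ (d₁ t ⟨ht.1, h.le⟩)
    filter_upwards [self_mem_nhdsWithin, mem_nhdsWithin_of_mem_nhds (Iio_mem_nhds h)]
      with s hs hs' using ⟨hs.1, le_of_lt hs'⟩
  · subst h
    rw [← Icc_union_Icc_eq_Icc hab hbc]
    exact hunion _ _ _ _ (d₁ t ⟨hab, le_rfl⟩) (d₂ t ⟨le_rfl, hbc⟩)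
  · refine hnhds γ (Icc b c) _ t ?_ ⟨h.le, ht.2⟩ (d₂ t ⟨h.le, ht.2⟩)
    filter_upwards [self_mem_nhdsWithin, mem_nhdsWithin_of_mem_nhds (Ioi_mem_nhds h)]
      with s hs hs' using ⟨le_of_lt hs', hs.2⟩

lemma deriv_pos_of_strictly_concave_start {f m : ℝ → ℝ} {a b m' : ℝ} (hab : a < b)
    (hf : ∀ τ ∈ Icc a b, HasDerivWithinAt f (m τ) (Icc a b) τ)
    (hm : HasDerivWithinAt m m' (Icc a b) a) (ha : f a = 0) (hnn : ∀ τ ∈ Icc a b, 0 ≤ f τ)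
    (hm' : m a = 0 → m' < 0) : 0 < m a := by
  by_contra hle
  have hev : ∀ᶠ τ in 𝓝[>] a, m τ < 0 := by
    have hnh : 𝓝[>] a ≤ 𝓝[Icc a b \ {a}] a := by
      rw [nhdsWithin_le_iff]
      filter_upwards [Ioc_mem_nhdsGT hab] with τ hτ using ⟨⟨hτ.1.le, hτ.2⟩, hτ.1.ne'⟩
    rcases (not_lt.1 hle).lt_or_eq with h | h
    · exact ((hm.continuousWithinAt.eventually_lt continuousWithinAt_const h).filter_mono
        (nhdsWithin_mono _ sdiff_subset)).filter_mono hnh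
    · have h1 := ((hasDerivWithinAt_iff_tendsto_slope.1 hm).eventually
        (gt_mem_nhds (hm' h))).filter_mono hnh
      filter_upwards [h1, self_mem_nhdsWithin] with τ h2 h3
      have h3' : a < τ := h3
      rw [slope_def_field, h, sub_zero, div_neg_iff] at h2
      rcases h2 with h2 | h2 <;> linarith [h2.1, h2.2]
  obtain ⟨u, hu, hu'⟩ := mem_nhdsGT_iff_exists_Ioc_subset.1 (inter_mem hev (Ioc_mem_nhdsGT hab))
  have hu0 : a < u := hu
  have hub : u ≤ b := (hu' ⟨hu0, le_rfl⟩).2.2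
  have hanti : StrictAntiOn f (Icc a u) := by
    refine strictAntiOn_of_deriv_neg (convex_Icc _ _)
      (fun τ hτ => ((hf τ ⟨hτ.1, hτ.2.trans hub⟩).continuousWithinAt).mono
        (Icc_subset_Icc_right hub)) fun τ hτ => ?_
    rw [interior_Icc] at hτ
    rw [((hf τ ⟨hτ.1.le, hτ.2.le.trans hub⟩).hasDerivAt
      (Icc_mem_nhds hτ.1 (hτ.2.trans_le hub))).deriv]
    exact (hu' ⟨hτ.1, hτ.2.le⟩).1
  have := hanti ⟨le_rfl, hu0.le⟩ ⟨hu0.le, le_rfl⟩ hu0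
  linarith [hnn u ⟨hu0.le, hub⟩]

lemma deriv_neg_of_strictly_concave_end {f m : ℝ → ℝ} {a b m' : ℝ} (hab : a < b)
    (hf : ∀ τ ∈ Icc a b, HasDerivWithinAt f (m τ) (Icc a b) τ)
    (hm : HasDerivWithinAt m m' (Icc a b) b) (hb : f b = 0) (hnn : ∀ τ ∈ Icc a b, 0 ≤ f τ)
    (hm' : m b = 0 → m' < 0) : m b < 0 := by
  have hmaps : MapsTo (fun τ : ℝ => -τ) (Icc (-b) (-a)) (Icc a b) := fun τ hτ =>
    ⟨by linarith [hτ.2], by linarith [hτ.1]⟩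
  have hneg : ∀ {g : ℝ → ℝ} {g' τ : ℝ}, HasDerivWithinAt g g' (Icc a b) (-τ) →
      HasDerivWithinAt (fun τ => g (-τ)) (-g') (Icc (-b) (-a)) τ := by
    intro g g' τ hg
    have := hg.comp τ (hasDerivAt_neg τ).hasDerivWithinAt hmaps
    simpa [Function.comp_def] using this
  have h := deriv_pos_of_strictly_concave_start (f := fun τ => f (-τ)) (m := fun τ => -m (-τ))
    (m' := m') (neg_lt_neg hab) (fun τ hτ => hneg (hf (-τ) (hmaps hτ)))
    (by simpa using (hneg (g := m) (τ := -b) (by simpa using hm)).fun_neg) (by simpa using hb)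
    (fun τ hτ => hnn _ (hmaps hτ)) (by simpa using hm')
  simpa using h

variable {n : ℕ} [NeZero n] {M : Type*} [TopologicalSpace M]
  [ChartedSpace (EuclideanHalfSpace n) M] {L : (x : M) → TangentSpace (𝓡∂ n) x}

lemma exists_concat_integralCurve {γ₁ γ₂ : ℝ → M} {a b c : ℝ} (hab : a ≤ b) (hbc : b ≤ c)
    (h₁ : IsMIntegralCurveOn γ₁ L (Icc a b)) (h₂ : IsMIntegralCurveOn γ₂ L (Icc b c))
    (hb : γ₁ b = γ₂ b) :
    ∃ γ, IsMIntegralCurveOn γ L (Icc a c) ∧ EqOn γ γ₁ (Icc a b) ∧ EqOn γ γ₂ (Icc b c) := by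
  refine exists_concat (D := fun γ J t => HasMFDerivWithinAt 𝓘(ℝ, ℝ) (𝓡∂ n) γ J t
    ((1 : ℝ →L[ℝ] ℝ).smulRight (L (γ t)))) (fun γ γ' J t ht he h => ?_)
    (fun γ J J' t hJ ht h => h.mono_of_mem_nhdsWithin hJ) (fun γ J J' t h h' => h.union h')
    hab hbc h₁ h₂ hb
  have h2 := h.congr_of_eventuallyEq (eventually_nhdsWithin_of_forall he) (he ht)
  rw [he ht]
  exact h2

lemma IsMIntegralCurveOn.shift {γ : ℝ → M} {s t : ℝ} (d : ℝ)
    (h : IsMIntegralCurveOn γ L (Icc (s + d) (t + d))) :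
    IsMIntegralCurveOn (fun τ => γ (τ + d)) L (Icc s t) := by
  refine (h.comp_add d).mono fun τ hτ => ?_
  exact ⟨by linarith [hτ.1], by linarith [hτ.2]⟩

variable [IsManifold (𝓡∂ n) ∞ M]

/-- By strict convexity, integral curves meet the boundary transversally. -/
theorem transversal_of_integralCurve [T2Space M] [CompactSpace M]
    (hL : ContMDiff (𝓡∂ n) (𝓡∂ n).tangent ∞ (fun x => (⟨x, L x⟩ : TangentBundle (𝓡∂ n) M)))
    (hconv : IsStrictlyConvex L) {γ : ℝ → M} {a b t₀ : ℝ} (hγ : IsMIntegralCurveOn γ L (Icc a b))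
    (ht₀ : t₀ ∈ Icc a b) (hbd : γ t₀ ∈ (𝓡∂ n).boundary M) {c : M}
    (hc : γ t₀ ∈ (extChartAt (𝓡∂ n) c).source) :
    (t₀ < b → 0 < firstCoord n (chartField L c (extChartAt (𝓡∂ n) c (γ t₀)))) ∧
      (a < t₀ → firstCoord n (chartField L c (extChartAt (𝓡∂ n) c (γ t₀))) < 0) := by
  set φ := extChartAt (𝓡∂ n) c with hφ
  have hev : ∀ᶠ τ in 𝓝[Icc a b] t₀, γ τ ∈ φ.source :=
    (hγ t₀ ht₀).1.eventually ((isOpen_extChartAt_source c).mem_nhds hc)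
  obtain ⟨δ, hδ, hsrc⟩ := Metric.mem_nhdsWithin_iff.1 hev
  let f : ℝ → ℝ := fun τ => firstCoord n (φ (γ τ))
  let m : ℝ → ℝ := fun τ => firstCoord n (chartField L c (φ (γ τ)))
  have hf0 : f t₀ = 0 := (mem_boundary_iff hc).1 hbd
  have hyt := φ.map_source hc
  have hLd : DifferentiableWithinAt ℝ (chartField L c) (halfSpace (firstCoord n)) (φ (γ t₀)) :=
    (((contDiffOn_chartField hL c) _ hyt).mono_of_mem_nhdsWithin
      (extChartAt_target_mem hyt)).differentiableWithinAt (by simp)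
  have key : ∀ s t, s ≤ t → t₀ ∈ Icc s t → (∀ τ ∈ Icc s t, τ ∈ Icc a b ∧ |τ - t₀| < δ) →
      (∀ τ ∈ Icc s t, HasDerivWithinAt f (m τ) (Icc s t) τ) ∧ (∀ τ ∈ Icc s t, 0 ≤ f τ) ∧
      HasDerivWithinAt m (firstCoord n (fderivWithin ℝ (chartField L c) (halfSpace (firstCoord n))
        (φ (γ t₀)) (chartField L c (φ (γ t₀))))) (Icc s t) t₀ := by
    intro s t hst ht₀' hsub
    have hs : ∀ τ ∈ Icc s t, γ τ ∈ φ.source := fun τ hτ =>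
      hsrc ⟨by rw [Metric.mem_ball, Real.dist_eq]; exact (hsub τ hτ).2, (hsub τ hτ).1⟩
    have hd : ∀ τ ∈ Icc s t, HasDerivWithinAt (fun τ => φ (γ τ)) (chartField L c (φ (γ τ)))
        (Icc s t) τ := fun τ hτ =>
      hasDerivWithinAt_chart (hγ.mono fun σ hσ => (hsub σ hσ).1) hτ (hs τ hτ)
    have hH : ∀ τ ∈ Icc s t, φ (γ τ) ∈ halfSpace (firstCoord n) := fun τ hτ =>
      extChartAt_target_subset c (φ.map_source (hs τ hτ))
    refine ⟨fun τ hτ => (firstCoord n).hasFDerivAt.comp_hasDerivWithinAt τ (hd τ hτ), hH, ?_⟩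
    have h1 := hLd.hasFDerivWithinAt.comp_hasDerivWithinAt (s := Icc s t)
      (f := fun τ => φ (γ τ)) t₀ (hd t₀ ht₀') hH
    exact (firstCoord n).hasFDerivAt.comp_hasDerivWithinAt t₀ h1
  have hcv := hconv.chartField hL hc hbd
  constructor
  · intro hlt
    have hlt' : t₀ < min b (t₀ + δ / 2) := lt_min hlt (by linarith)
    obtain ⟨k1, k2, k3⟩ := key t₀ (min b (t₀ + δ / 2)) hlt'.le ⟨le_rfl, hlt'.le⟩ fun τ hτ => by
      have h1 := hτ.2.trans (min_le_left _ _)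
      have h2 := hτ.2.trans (min_le_right _ _)
      refine ⟨⟨ht₀.1.trans hτ.1, h1⟩, ?_⟩
      rw [abs_of_nonneg (by linarith [hτ.1])]
      linarith
    exact deriv_pos_of_strictly_concave_start hlt' k1 k3 hf0 k2 hcv
  · intro hlt
    have hlt' : max a (t₀ - δ / 2) < t₀ := max_lt hlt (by linarith)
    obtain ⟨k1, k2, k3⟩ := key (max a (t₀ - δ / 2)) t₀ hlt'.le ⟨hlt'.le, le_rfl⟩ fun τ hτ => by
      have h1 := (le_max_left _ _).trans hτ.1
      have h2 := (le_max_right _ _).trans hτ.1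
      refine ⟨⟨h1, hτ.2.trans ht₀.2⟩, ?_⟩
      rw [abs_of_nonpos (by linarith [hτ.2])]
      linarith
    exact deriv_neg_of_strictly_concave_end hlt' k1 k3 hf0 k2 hcv

/-- Only the end points of an integral curve can lie on the boundary. -/
lemma notMem_boundary_of_integralCurve [T2Space M] [CompactSpace M]
    (hL : ContMDiff (𝓡∂ n) (𝓡∂ n).tangent ∞ (fun x => (⟨x, L x⟩ : TangentBundle (𝓡∂ n) M)))
    (hconv : IsStrictlyConvex L) {γ : ℝ → M} {a b t₀ : ℝ} (hγ : IsMIntegralCurveOn γ L (Icc a b))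
    (ht₀ : t₀ ∈ Ioo a b) : γ t₀ ∉ (𝓡∂ n).boundary M := fun hbd => by
  obtain ⟨h1, h2⟩ := transversal_of_integralCurve hL hconv hγ (Ioo_subset_Icc_self ht₀) hbd
    (mem_extChartAt_source (γ t₀))
  exact absurd (h1 ht₀.2) (h2 ht₀.1).not_gt

lemma isMIntegralCurveOn_const_singleton (x : M) :
    IsMIntegralCurveOn (fun _ => x) L (Icc (0 : ℝ) 0) := by
  rw [Icc_self]
  intro t ht
  refine hasMFDerivWithinAt_of_chart (c := x) continuousWithinAt_const (mem_extChartAt_source x) ?_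
  rw [mem_singleton_iff.1 ht, hasDerivWithinAt_iff_hasFDerivWithinAt]
  exact HasFDerivWithinAt.of_subsingleton subsingleton_singleton

/-- The times for which the backward integral curve of `L` from `x` exists. -/
def backwardTimes (L : (x : M) → TangentSpace (𝓡∂ n) x) (x : M) : Set ℝ :=
  {T | 0 ≤ T ∧ ∃ γ : ℝ → M, IsMIntegralCurveOn γ L (Icc (-T) 0) ∧ γ 0 = x}

lemma zero_mem_backwardTimes (x : M) : (0 : ℝ) ∈ backwardTimes L x :=
  ⟨le_rfl, fun _ => x, by simpa using isMIntegralCurveOn_const_singleton x, rfl⟩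

omit [IsManifold (𝓡∂ n) ∞ M] in
lemma backwardTimes_of_le {x : M} {s t : ℝ} (ht : t ∈ backwardTimes L x) (hs : 0 ≤ s)
    (hst : s ≤ t) : s ∈ backwardTimes L x := by
  obtain ⟨-, γ, hγ, h0⟩ := ht
  exact ⟨hs, γ, hγ.mono (Icc_subset_Icc_left (by linarith)), h0⟩

omit [IsManifold (𝓡∂ n) ∞ M] in
lemma add_mem_backwardTimes {γ : ℝ → M} {a b t : ℝ} (hab : a ≤ b)
    (hγ : IsMIntegralCurveOn γ L (Icc a b)) (ht : t ∈ backwardTimes L (γ a)) :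
    t + (b - a) ∈ backwardTimes L (γ b) := by
  obtain ⟨ht0, β, hβ, hβ0⟩ := ht
  have h1 : IsMIntegralCurveOn (fun τ => γ (τ + b)) L (Icc (-(b - a)) 0) := by
    refine IsMIntegralCurveOn.shift b ?_
    rwa [neg_sub, sub_add_cancel, zero_add]
  have h2 : IsMIntegralCurveOn (fun τ => β (τ + (b - a))) L (Icc (-(t + (b - a))) (-(b - a))) := by
    refine IsMIntegralCurveOn.shift (b - a) ?_
    have e1 : -(t + (b - a)) + (b - a) = -t := by ring
    rwa [e1, neg_add_cancel]
  obtain ⟨η, hη, -, hη2⟩ := exists_concat_integralCurve (by linarith) (by linarith) h2 h1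
    (by simp [hβ0])
  refine ⟨by linarith, η, hη, ?_⟩
  rw [hη2 ⟨by linarith, le_rfl⟩]
  simp only [zero_add]

variable [T2Space M]
  (hL : ContMDiff (𝓡∂ n) (𝓡∂ n).tangent ∞ (fun x => (⟨x, L x⟩ : TangentBundle (𝓡∂ n) M)))
include hL

lemma sub_mem_backwardTimes {γ : ℝ → M} {a b t : ℝ} (hab : a ≤ b)
    (hγ : IsMIntegralCurveOn γ L (Icc a b)) (ht : t ∈ backwardTimes L (γ b)) (hle : b - a ≤ t) :
    t - (b - a) ∈ backwardTimes L (γ a) := by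
  obtain ⟨-, β, hβ, hβ0⟩ := ht
  have h1 : IsMIntegralCurveOn (fun τ => γ (τ + b)) L (Icc (-(b - a)) 0) := by
    refine IsMIntegralCurveOn.shift b ?_
    rwa [neg_sub, sub_add_cancel, zero_add]
  have he := eqOn_of_isMIntegralCurveOn hL h1
    (hβ.mono (Icc_subset_Icc_left (by linarith))) (τ₀ := 0) ⟨by linarith, le_rfl⟩ (by simp [hβ0])
  have he' := he ⟨le_rfl, by linarith⟩
  simp only [neg_sub, sub_add_cancel] at he'
  refine ⟨by linarith, fun τ => β (τ + (a - b)), ?_, by simp only [zero_add, ← he']⟩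
  refine IsMIntegralCurveOn.shift (a - b) (hβ.mono (Icc_subset_Icc ?_ ?_)) <;> linarith

/-- Integral curves through interior points can be extended in both directions. -/
lemma exists_integralCurve_of_notMem_boundary {x : M} (hx : x ∉ (𝓡∂ n).boundary M) :
    ∃ ε > 0, ∃ γ : ℝ → M, IsMIntegralCurveOn γ L (Icc (-ε) ε) ∧ γ 0 = x := by
  obtain ⟨L', Φ, ε, hε, U, hU, -, -, hUs, h⟩ := exists_chart_flow hL x
  obtain ⟨h0, hc, hflow⟩ := h x (mem_of_mem_nhds hU)
  set φ := extChartAt (𝓡∂ n) x with hφ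
  have hxs : x ∈ φ.source := mem_extChartAt_source x
  have hpos : 0 < firstCoord n (φ x) :=
    lt_of_le_of_ne (extChartAt_target_subset x (φ.map_source hxs))
      fun h => hx ((mem_boundary_iff hxs).2 h.symm)
  have hcont : ContinuousAt (fun τ => firstCoord n (Φ (τ, φ x))) 0 :=
    (firstCoord n).continuous.continuousAt.comp ((hc.continuousOn).continuousAt
      (Icc_mem_nhds (by linarith) hε))
  have hev : ∀ᶠ τ in 𝓝 (0 : ℝ), 0 < firstCoord n (Φ (τ, φ x)) :=
    hcont.eventually (lt_mem_nhds (by simp only [h0]; exact hpos))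
  obtain ⟨δ, hδ, hδ'⟩ := Metric.eventually_nhds_iff.1 hev
  have hm : 0 < min ε (δ / 2) := lt_min hε (by linarith)
  refine ⟨min ε (δ / 2), hm, _, (hflow _ _ (neg_nonpos.2 hm.le) hm.le
    (neg_le_neg (min_le_left _ _)) (min_le_left _ _)).1 fun τ hτ => (hδ' ?_).le, ?_⟩
  · rw [Real.dist_eq, sub_zero]
    refine lt_of_le_of_lt (abs_le.2 hτ) ((min_le_right _ _).trans_lt (by linarith))
  · simp only [h0, φ.left_inv hxs]

/-- `γ` is the complete backward integral curve of `L` from `x`; it exists for the time `T`. -/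
structure IsEntryCurve (L : (x : M) → TangentSpace (𝓡∂ n) x) (x : M) (T : ℝ) (γ : ℝ → M) :
    Prop where
  nonneg : 0 ≤ T
  curve : IsMIntegralCurveOn γ L (Icc (-T) 0)
  apply_zero : γ 0 = x
  le : ∀ t ∈ backwardTimes L x, t ≤ T

/-- If the backward integral curve from `x` does not exist for all times, then it reaches an end
point. -/
theorem exists_isEntryCurve [CompactSpace M] {x : M} (hb : BddAbove (backwardTimes L x)) :
    ∃ T γ, IsEntryCurve L x T γ := by
  set T := sSup (backwardTimes L x) with hT
  have hne : (backwardTimes L x).Nonempty := ⟨0, zero_mem_backwardTimes x⟩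
  have hle : ∀ t ∈ backwardTimes L x, t ≤ T := fun t ht => le_csSup hb ht
  have hT0 : 0 ≤ T := hle 0 (zero_mem_backwardTimes x)
  suffices hTm : T ∈ backwardTimes L x by
    obtain ⟨-, γ, hγ, hγ0⟩ := hTm
    exact ⟨T, γ, hT0, hγ, hγ0, hle⟩
  obtain ⟨u, -, hu, hum⟩ := exists_seq_tendsto_sSup hne hb
  choose hu0 γ hγ hγ0 using hum
  -- A limit point of the end points of longer and longer backward curves.
  obtain ⟨y, -, hy⟩ := isCompact_univ.exists_mapClusterPt_of_frequently (l := atTop)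
    (f := fun k => γ k (-u k)) (Frequently.of_forall fun _ => mem_univ _)
  obtain ⟨L', Φ, ε, hε, U, hU, -, -, hUs, hflow⟩ := exists_chart_flow hL y
  obtain ⟨k, hkU, hkT⟩ := ((hy.frequently hU).and_eventually
    (hu.eventually (lt_mem_nhds (show T - ε < T by linarith)))).exists
  set z := γ k (-u k) with hz
  set d := T - u k with hd
  have hd0 : 0 ≤ d := sub_nonneg.2 (hle _ ⟨hu0 k, γ k, hγ k, hγ0 k⟩)
  have hdz : ∀ t, 0 ≤ t → t < d → t ∈ backwardTimes L z := by
    intro t ht htd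
    obtain ⟨s, hs, hst⟩ := exists_lt_of_lt_csSup hne (show u k + t < T by linarith)
    have h1 := sub_mem_backwardTimes hL (γ := γ k) (a := -u k) (b := 0) (by linarith [hu0 k]) (hγ k)
      (by rw [hγ0 k]; exact hs) (by linarith)
    exact backwardTimes_of_le h1 ht (by linarith)
  obtain ⟨h0, hc, hfl⟩ := hflow z hkU
  have hpos : ∀ τ ∈ Icc (-d) 0, 0 ≤ firstCoord n (Φ (τ, extChartAt (𝓡∂ n) y z)) := by
    have hopen : ∀ τ ∈ Ioc (-d) 0, 0 ≤ firstCoord n (Φ (τ, extChartAt (𝓡∂ n) y z)) := by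
      intro τ hτ
      obtain ⟨-, β, hβ, hβ0⟩ := hdz (-τ) (by linarith [hτ.2]) (by linarith [hτ.1])
      rw [neg_neg] at hβ
      exact extChartAt_target_subset y (((hfl τ 0 hτ.2 le_rfl (by linarith [hτ.1]) hε.le).2 β hβ
        hβ0 τ ⟨le_rfl, hτ.2⟩).1)
    intro τ hτ
    rcases hτ.1.eq_or_lt with h | h
    · rcases hd0.eq_or_lt with hd' | hd'
      · have hτ0 : τ = 0 := by linarith
        rw [hτ0, h0]
        exact extChartAt_target_subset y ((extChartAt (𝓡∂ n) y).map_source (hUs hkU))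
      · have hcl : τ ∈ closure (Ioc (-d) 0) := by
          rw [closure_Ioc (by linarith)]; exact hτ
        have hcont : ContinuousWithinAt (fun τ => firstCoord n (Φ (τ, extChartAt (𝓡∂ n) y z)))
            (Ioc (-d) 0) τ :=
          ((firstCoord n).continuous.comp_continuousOn (hc.continuousOn.mono
            (Icc_subset_Icc (by linarith) hε.le)) τ hτ).mono Ioc_subset_Icc_self
        have hsub : (fun τ => firstCoord n (Φ (τ, extChartAt (𝓡∂ n) y z))) '' Ioc (-d) 0 ⊆
            Ici 0 := by
          rintro _ ⟨σ, hσ, rfl⟩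
          exact hopen σ hσ
        exact isClosed_Ici.closure_subset_iff.2 hsub (hcont.mem_closure_image hcl)
    · exact hopen τ ⟨h, hτ.2⟩
  have hdm : d ∈ backwardTimes L z := by
    refine ⟨hd0, _, (hfl (-d) 0 (by linarith) le_rfl (by linarith) hε.le).1 hpos, ?_⟩
    simp only [h0]
    exact (extChartAt (𝓡∂ n) y).left_inv (hUs hkU)
  have := add_mem_backwardTimes (γ := γ k) (a := -u k) (b := 0) (by linarith [hu0 k]) (hγ k) hdm
  rw [hγ0 k] at this
  convert this using 1
  ring

end CurvesAndBoundary

/-! ### Lifting integral curves to null bicharacteristics -/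

section Lifts

variable {n : ℕ} [NeZero n] {M : Type*} [TopologicalSpace M]
  [ChartedSpace (EuclideanHalfSpace n) M] {L : (x : M) → TangentSpace (𝓡∂ n) x}

/-- The function `(x, ξ) ↦ ξ(L(x))` on the cotangent bundle. -/
noncomputable def fieldSymbol (L : (x : M) → TangentSpace (𝓡∂ n) x) (z : Cotangent (n := n) M) : ℝ :=
  z.2 (L z.1)

lemma fderiv_fieldSymbol_ofCoord (c : M) (y : EuclideanSpace ℝ (Fin n))
    (η ζ : EuclideanSpace ℝ (Fin n) →L[ℝ] ℝ) :
    fderiv ℝ (fun η => fieldSymbol L (ofCoord c y η)) η ζ = ζ (chartField L c y) := by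
  have : (fun η => fieldSymbol L (ofCoord c y η)) =
      ContinuousLinearMap.apply ℝ ℝ (chartField L c y) := rfl
  rw [this, ContinuousLinearMap.fderiv]
  rfl

lemma fderivWithin_fieldSymbol_ofCoord {c : M} {y : EuclideanSpace ℝ (Fin n)}
    (η : EuclideanSpace ℝ (Fin n) →L[ℝ] ℝ) (hy : y ∈ halfSpace (firstCoord n))
    (hd : DifferentiableWithinAt ℝ (chartField L c) (halfSpace (firstCoord n)) y) :
    fderivWithin ℝ (fun y => fieldSymbol L (ofCoord c y η)) (range (𝓡∂ n)) y =
      η.comp (fderivWithin ℝ (chartField L c) (halfSpace (firstCoord n)) y) := by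
  rw [range_model_eq]
  have : (fun y => fieldSymbol L (ofCoord c y η)) = fun y => η (chartField L c y) := rfl
  rw [this]
  exact (η.hasFDerivAt.comp_hasFDerivWithinAt y hd.hasFDerivWithinAt).fderivWithin
    (uniqueDiffOn_halfSpace firstCoord_inwardVector y hy)

variable [IsManifold (𝓡∂ n) ∞ M]

/-- Bicharacteristics of `ξ(L(x))` project to integral curves of `L`. -/
theorem IsBicharacteristicOn.isMIntegralCurveOn {γ : ℝ → Cotangent (n := n) M} {J : Set ℝ}
    (h : IsBicharacteristicOn (fieldSymbol L) γ J) :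
    IsMIntegralCurveOn (fun t => (γ t).1) L J := by
  intro t ht
  refine hasMFDerivWithinAt_of_chart (c := (γ t).1) (h.continuousOn_proj t ht)
    (mem_extChartAt_source _) ?_
  rw [hasDerivWithinAt_iff_hasFDerivWithinAt, hasFDerivWithinAt_euclidean]
  intro i
  have := h.deriv_position t ht (EuclideanSpace.proj i)
  rw [fderiv_fieldSymbol_ofCoord] at this
  refine this.hasFDerivWithinAt.congr_fderiv ?_
  ext
  simp

lemma mfderiv_comp_mfderivWithin_symm {c c' z : M} (hc : z ∈ (extChartAt (𝓡∂ n) c).source)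
    (hc' : z ∈ (extChartAt (𝓡∂ n) c').source) (v : EuclideanSpace ℝ (Fin n)) :
    mfderiv (𝓡∂ n) 𝓘(ℝ, EuclideanSpace ℝ (Fin n)) (extChartAt (𝓡∂ n) c) z
      (mfderivWithin 𝓘(ℝ, EuclideanSpace ℝ (Fin n)) (𝓡∂ n) (extChartAt (𝓡∂ n) c').symm
        (range (𝓡∂ n)) (extChartAt (𝓡∂ n) c' z) v) =
    fderivWithin ℝ (fun y => extChartAt (𝓡∂ n) c ((extChartAt (𝓡∂ n) c').symm y))
      (halfSpace (firstCoord n)) (extChartAt (𝓡∂ n) c' z) v := by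
  have hy := (extChartAt (𝓡∂ n) c').map_source hc'
  have h1 := (mdifferentiableWithinAt_extChartAt_symm (I := 𝓡∂ n) hy).hasMFDerivWithinAt
  have hcs := hc
  rw [extChartAt_source] at hcs
  have h2 : HasMFDerivAt (𝓡∂ n) 𝓘(ℝ, EuclideanSpace ℝ (Fin n)) (extChartAt (𝓡∂ n) c)
      ((extChartAt (𝓡∂ n) c').symm (extChartAt (𝓡∂ n) c' z))
      (mfderiv (𝓡∂ n) 𝓘(ℝ, EuclideanSpace ℝ (Fin n)) (extChartAt (𝓡∂ n) c)
        ((extChartAt (𝓡∂ n) c').symm (extChartAt (𝓡∂ n) c' z))) := by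
    rw [(extChartAt (𝓡∂ n) c').left_inv hc']
    exact (mdifferentiableAt_extChartAt hcs).hasMFDerivAt
  let A : EuclideanSpace ℝ (Fin n) →L[ℝ] EuclideanSpace ℝ (Fin n) := ContinuousLinearMap.comp
    (mfderiv (𝓡∂ n) 𝓘(ℝ, EuclideanSpace ℝ (Fin n)) (extChartAt (𝓡∂ n) c)
      ((extChartAt (𝓡∂ n) c').symm (extChartAt (𝓡∂ n) c' z)))
    (mfderivWithin 𝓘(ℝ, EuclideanSpace ℝ (Fin n)) (𝓡∂ n) (extChartAt (𝓡∂ n) c').symm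
      (range (𝓡∂ n)) (extChartAt (𝓡∂ n) c' z))
  have h3 : HasFDerivWithinAt (fun y => extChartAt (𝓡∂ n) c ((extChartAt (𝓡∂ n) c').symm y)) A
      (range (𝓡∂ n)) (extChartAt (𝓡∂ n) c' z) :=
    (h2.comp_hasMFDerivWithinAt _ h1).hasFDerivWithinAt
  rw [range_model_eq] at h3
  rw [h3.fderivWithin (uniqueDiffOn_halfSpace firstCoord_inwardVector _
    (extChartAt_target_subset c' hy))]
  have h4 := (extChartAt (𝓡∂ n) c').left_inv hc'
  change _ = mfderiv (𝓡∂ n) 𝓘(ℝ, EuclideanSpace ℝ (Fin n)) (extChartAt (𝓡∂ n) c)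
    ((extChartAt (𝓡∂ n) c').symm (extChartAt (𝓡∂ n) c' z)) _
  rw [h4]
  rfl

/-- The covector at `x` with momentum coordinates `η` in the chart centred at `c`. -/
noncomputable def chartCovector (c x : M) (η : EuclideanSpace ℝ (Fin n) →L[ℝ] ℝ) :
    Cotangent (n := n) M :=
  ⟨x, η.comp (mfderiv (𝓡∂ n) 𝓘(ℝ, EuclideanSpace ℝ (Fin n)) (extChartAt (𝓡∂ n) c) x)⟩

lemma momentum_chartCovector {c c' x : M} (hc : x ∈ (extChartAt (𝓡∂ n) c).source)
    (hc' : x ∈ (extChartAt (𝓡∂ n) c').source) (η : EuclideanSpace ℝ (Fin n) →L[ℝ] ℝ) :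
    momentum c' (chartCovector c x η) =
      η.comp (fderivWithin ℝ (fun y => extChartAt (𝓡∂ n) c ((extChartAt (𝓡∂ n) c').symm y))
        (halfSpace (firstCoord n)) (extChartAt (𝓡∂ n) c' x)) :=
  ContinuousLinearMap.ext fun v => congrArg η (mfderiv_comp_mfderivWithin_symm hc hc' v)

lemma chartField_coord_change {c c' z : M} (hc : z ∈ (extChartAt (𝓡∂ n) c).source)
    (hc' : z ∈ (extChartAt (𝓡∂ n) c').source) :
    chartField L c (extChartAt (𝓡∂ n) c z) =
      fderivWithin ℝ (fun y => extChartAt (𝓡∂ n) c ((extChartAt (𝓡∂ n) c').symm y))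
        (halfSpace (firstCoord n)) (extChartAt (𝓡∂ n) c' z)
        (chartField L c' (extChartAt (𝓡∂ n) c' z)) := by
  rw [← mfderiv_comp_mfderivWithin_symm hc hc', chartField_apply L hc, chartField_apply L hc']
  have h5 := DFunLike.congr_fun
    (mfderivWithin_extChartAt_symm_comp_mfderiv_extChartAt' (I := 𝓡∂ n) hc') (L z)
  exact (congrArg (mfderiv (𝓡∂ n) 𝓘(ℝ, EuclideanSpace ℝ (Fin n)) (extChartAt (𝓡∂ n) c) z) h5).symm

/-- If the momentum coordinates in one chart solve Hamilton's equations, then they do so in all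
charts. -/
theorem isBicharacteristicOn_of_chart
    (hL : ContMDiff (𝓡∂ n) (𝓡∂ n).tangent ∞ (fun x => (⟨x, L x⟩ : TangentBundle (𝓡∂ n) M)))
    {x : ℝ → M} {J : Set ℝ} (hx : IsMIntegralCurveOn x L J) {c : M}
    (hc : ∀ τ ∈ J, x τ ∈ (extChartAt (𝓡∂ n) c).source)
    {η : ℝ → EuclideanSpace ℝ (Fin n) →L[ℝ] ℝ}
    (hη : ∀ τ ∈ J, HasDerivWithinAt η (-(η τ).comp (fderivWithin ℝ (chartField L c)
      (halfSpace (firstCoord n)) (extChartAt (𝓡∂ n) c (x τ)))) J τ) :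
    IsBicharacteristicOn (fieldSymbol L) (fun τ => chartCovector c (x τ) (η τ)) J := by
  refine ⟨hx.continuousOn, fun t ht ζ => ?_, fun t ht => ?_⟩
  · rw [fderiv_fieldSymbol_ofCoord]
    exact ζ.hasFDerivAt.comp_hasDerivWithinAt t
      (hasDerivWithinAt_chart hx ht (mem_extChartAt_source _))
  · change HasDerivWithinAt (fun s => momentum (x t) (chartCovector c (x s) (η s))) _ J t
    change HasDerivWithinAt _ (-fderivWithin ℝ (fun y => fieldSymbol L (ofCoord (x t) y
      (momentum (x t) (chartCovector c (x t) (η t))))) (range (𝓡∂ n))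
      (extChartAt (𝓡∂ n) (x t) (x t))) J t
    set c' := x t with hc'
    set φ := extChartAt (𝓡∂ n) c with hφ
    set φ' := extChartAt (𝓡∂ n) c' with hφ'
    set H := halfSpace (firstCoord n) with hH
    set y₀ := φ' c' with hy₀
    have hcc : c' ∈ φ.source := hc t ht
    have hcc' : c' ∈ φ'.source := mem_extChartAt_source c'
    have hyt : y₀ ∈ φ'.target := φ'.map_source hcc'
    have hyH : y₀ ∈ H := extChartAt_target_subset c' hyt
    have hu : UniqueDiffOn ℝ H := uniqueDiffOn_halfSpace firstCoord_inwardVector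
    -- The transition map `θ` and its derivative `A`.
    set θ : EuclideanSpace ℝ (Fin n) → EuclideanSpace ℝ (Fin n) := fun y => φ (φ'.symm y) with hθ
    have hsymm : Tendsto φ'.symm (𝓝[H] y₀) (𝓝 c') := by
      have := ((continuousOn_extChartAt_symm (I := 𝓡∂ n) c' y₀ hyt).mono_of_mem_nhdsWithin
        (extChartAt_target_mem hyt)).tendsto
      rwa [← hφ', hy₀, φ'.left_inv hcc'] at this
    have hD : ∀ᶠ y in 𝓝[H] y₀, y ∈ φ'.target ∧ φ'.symm y ∈ φ.source :=
      (eventually_mem_set.2 (extChartAt_target_mem hyt)).and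
        (hsymm.eventually ((isOpen_extChartAt_source c).mem_nhds hcc))
    have hθs : ContDiffWithinAt ℝ ∞ θ H y₀ := by
      have h1 : ContMDiffAt (𝓡∂ n) 𝓘(ℝ, EuclideanSpace ℝ (Fin n)) ∞ φ c' := by
        refine contMDiffAt_extChartAt' ?_
        rwa [← extChartAt_source (𝓡∂ n)]
      exact (contMDiffAt_iff_chart le_rfl hcc').1 h1
    set A : EuclideanSpace ℝ (Fin n) → EuclideanSpace ℝ (Fin n) →L[ℝ] EuclideanSpace ℝ (Fin n) :=
      fderivWithin ℝ θ H with hA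
    have hAs : DifferentiableWithinAt ℝ A H y₀ :=
      (hθs.fderivWithin_right hu (m := 1) (WithTop.coe_le_coe.2 le_top) hyH).differentiableWithinAt
        (by simp)
    have hθ0 : θ y₀ = φ c' := by rw [hθ, hy₀]; simp only [φ'.left_inv hcc']
    have hLd : ∀ {a : M}, c' ∈ (extChartAt (𝓡∂ n) a).source →
        DifferentiableWithinAt ℝ (chartField L a) H (extChartAt (𝓡∂ n) a c') := by
      intro a ha
      have hat := (extChartAt (𝓡∂ n) a).map_source ha
      exact (((contDiffOn_chartField hL a) _ hat).mono_of_mem_nhdsWithin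
        (extChartAt_target_mem hat)).differentiableWithinAt (by simp)
    have hθd : DifferentiableWithinAt ℝ θ H y₀ := hθs.differentiableWithinAt (by simp)
    -- Differentiate the transformation rule of the vector field.
    have hrule : ∀ v, fderivWithin ℝ (chartField L c) H (φ c') (A y₀ v) =
        fderivWithin ℝ A H y₀ v (chartField L c' y₀) +
          A y₀ (fderivWithin ℝ (chartField L c') H y₀ v) := by
      intro v
      have e1 : HasFDerivWithinAt (fun y => A y (chartField L c' y)) _ H y₀ :=
        hAs.hasFDerivWithinAt.clm_apply (hLd hcc').hasFDerivWithinAt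
      have e2 : HasFDerivWithinAt (fun y => chartField L c (θ y))
          ((fderivWithin ℝ (chartField L c) H (φ c')).comp (A y₀)) (H ∩ θ ⁻¹' H) y₀ := by
        have := (hLd hcc).hasFDerivWithinAt
        rw [← hφ, ← hθ0] at this
        have h2 := this.comp y₀ (hθd.hasFDerivWithinAt.mono inter_subset_left)
          (fun y hy => hy.2 : MapsTo θ (H ∩ θ ⁻¹' H) H)
        rwa [hθ0] at h2
      have e3 : HasFDerivWithinAt (fun y => chartField L c (θ y))
          ((fderivWithin ℝ (chartField L c) H (φ c')).comp (A y₀)) H y₀ := by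
        refine e2.mono_of_mem_nhdsWithin ?_
        filter_upwards [hD, self_mem_nhdsWithin] with y hy hyH
        exact ⟨hyH, extChartAt_target_subset c (φ.map_source hy.2)⟩
      have e4 : (fun y => chartField L c (θ y)) =ᶠ[𝓝[H] y₀] fun y => A y (chartField L c' y) := by
        filter_upwards [hD] with y hy
        have := chartField_coord_change (L := L) hy.2 (φ'.map_target hy.1)
        rw [← hφ', φ'.right_inv hy.1] at this
        exact this
      have e5 := (hu y₀ hyH).eq e3 (e1.congr_of_eventuallyEq e4 (e4.self_of_nhdsWithin hyH))
      have e6 := DFunLike.congr_fun e5 v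
      simp only [ContinuousLinearMap.comp_apply, add_apply, ContinuousLinearMap.flip_apply] at e6
      rw [e6]
      exact add_comm _ _
    have hint : y₀ ∈ closure (interior H) := by
      rw [(convex_halfSpace (firstCoord n)).closure_interior_eq_closure_of_nonempty_interior]
      · exact subset_closure hyH
      · exact ⟨inwardVector n, mem_interior_iff_mem_nhds.2
          (halfSpace_mem_nhds (by rw [firstCoord_inwardVector]; exact one_pos))⟩
    have hsym : ∀ v w, fderivWithin ℝ A H y₀ v w = fderivWithin ℝ A H y₀ w v := fun v w =>
      (hθs.isSymmSndFDerivWithinAt (by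
        rw [minSmoothness_of_isRCLikeNormedField]
        exact WithTop.coe_le_coe.2 le_top) hu hint hyH).eq v w
    -- Differentiate the transformation rule of covectors along the curve.
    have hY : HasDerivWithinAt (fun s => φ' (x s)) (chartField L c' y₀) J t :=
      hasDerivWithinAt_chart hx ht hcc'
    have hJ : ∀ᶠ s in 𝓝[J] t, s ∈ J ∧ x s ∈ φ'.source := (eventually_mem_nhdsWithin).and
      ((hx.continuousOn t ht).eventually ((isOpen_extChartAt_source c').mem_nhds hcc'))
    have hAY : HasDerivWithinAt (fun s => A (φ' (x s))) (fderivWithin ℝ A H y₀ (chartField L c' y₀))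
        J t := by
      have h1 : HasDerivWithinAt (fun s => A (φ' (x s)))
          (fderivWithin ℝ A H y₀ (chartField L c' y₀)) {s | s ∈ J ∧ x s ∈ φ'.source} t :=
        HasFDerivWithinAt.comp_hasDerivWithinAt (f := fun s => φ' (x s)) t hAs.hasFDerivWithinAt
          (hY.mono fun s hs => hs.1)
          fun s hs => extChartAt_target_subset c' (φ'.map_source hs.2)
      exact h1.mono_of_mem_nhdsWithin hJ
    have hprod := (hη t ht).clm_comp hAY
    rw [fderivWithin_fieldSymbol_ofCoord _ hyH (hLd hcc'), momentum_chartCovector hcc hcc']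
    refine (hprod.congr_deriv ?_).congr_of_eventuallyEq ?_ ?_
    · ext v
      have := hrule v
      simp only [add_apply, ContinuousLinearMap.comp_apply, neg_apply,
        ← hc', ← hφ, ← hφ', ← hy₀, ← hθ, ← hA, ← hH]
      rw [this, map_add, hsym v]
      ring
    · filter_upwards [hJ] with s hs
      exact momentum_chartCovector (hc s hs.1) hs.2 (η s)
    · exact momentum_chartCovector hcc hcc' (η t)

section Linear

variable {G : Type*} [NormedAddCommGroup G] [NormedSpace ℝ G]

/-- A solution of a linear equation on a short interval has no zeros, unless it vanishes
identically. -/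
lemma ne_zero_of_norm_deriv_le {η η' : ℝ → G} {s t K b : ℝ}
    (hK : K * (t - s) < 1) (hη : ∀ τ ∈ Icc s t, HasDerivWithinAt η (η' τ) (Icc s t) τ)
    (hb : b ∈ Icc s t) (h : ∀ τ ∈ Icc s t, ‖η' τ‖ ≤ K * ‖η τ‖) (h0 : η b ≠ 0) :
    ∀ τ ∈ Icc s t, η τ ≠ 0 := by
  intro σ hσ hσ0
  obtain ⟨m, hm, hmax⟩ := isCompact_Icc.exists_isMaxOn ⟨b, hb⟩
    (f := fun τ => ‖η τ‖) fun τ hτ => (hη τ hτ).continuousWithinAt.norm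
  have hpos : 0 < ‖η m‖ := (norm_pos_iff.2 h0).trans_le (hmax hb)
  have hK0 : 0 ≤ K := by
    by_contra hneg
    have := (norm_nonneg _).trans (h m hm)
    nlinarith
  have h1 := (convex_Icc s t).norm_image_sub_le_of_norm_hasDerivWithin_le hη
    (C := K * ‖η m‖) (fun τ hτ => (h τ hτ).trans (mul_le_mul_of_nonneg_left (hmax hτ) hK0)) hσ hm
  rw [hσ0, sub_zero, Real.norm_eq_abs] at h1
  have h2 : |m - σ| ≤ t - s := abs_sub_le_iff.2 ⟨by linarith [hm.2, hσ.1], by linarith [hm.1, hσ.2]⟩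
  have h3 := mul_le_mul_of_nonneg_left h2 (mul_nonneg hK0 hpos.le)
  nlinarith

lemma exists_linear_solution [CompleteSpace G] {A : ℝ → G →L[ℝ] G} {s t K b : ℝ}
    (hA : ContinuousOn A (Icc s t)) (hAK : ∀ τ ∈ Icc s t, ‖A τ‖ ≤ K) (hK : 2 * K * (t - s) ≤ 1)
    (hb : b ∈ Icc s t) {η₀ : G} (h0 : η₀ ≠ 0) :
    ∃ η : ℝ → G, η b = η₀ ∧ ∀ τ ∈ Icc s t, HasDerivWithinAt η (A τ (η τ)) (Icc s t) τ := by
  have hK0 : 0 ≤ K := (norm_nonneg _).trans (hAK b hb)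
  lift K to ℝ≥0 using hK0
  have hPL : IsPicardLindelof (fun τ η => A τ η) (⟨b, hb⟩ : Icc s t) η₀ ‖η₀‖₊ 0
      (K * (2 * ‖η₀‖₊)) K := by
    refine ⟨fun τ hτ => ?_, fun η _ => hA.clm_apply continuousOn_const, fun τ hτ η hη => ?_, ?_⟩
    · exact ((A τ).lipschitz.weaken (hAK τ hτ)).lipschitzOnWith
    · refine ((A τ).le_opNorm η).trans ?_
      rw [mem_closedBall_iff_norm] at hη
      have : ‖η‖ ≤ 2 * ‖η₀‖ := by
        have := norm_le_norm_add_norm_sub' η η₀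
        rw [coe_nnnorm] at hη
        linarith
      exact mul_le_mul (hAK τ hτ) this (norm_nonneg _) K.2
    · have : max (t - b) (b - s) ≤ t - s := max_le (by linarith [hb.1]) (by linarith [hb.2])
      push_cast
      have h1 := mul_le_mul_of_nonneg_left this (show 0 ≤ (K : ℝ) * (2 * ‖η₀‖) by positivity)
      have h2 := mul_le_mul_of_nonneg_right hK (norm_nonneg η₀)
      simp only [sub_zero]
      nlinarith
  obtain ⟨η, h1, h2⟩ := hPL.exists_eq_forall_mem_Icc_hasDerivWithinAt₀
  exact ⟨η, h1, h2⟩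

end Linear

end Lifts

section GlobalLifts

variable {n : ℕ} [NeZero n] {M : Type*} [TopologicalSpace M]
  [ChartedSpace (EuclideanHalfSpace n) M] {L : (x : M) → TangentSpace (𝓡∂ n) x}

lemma isNullBicharacteristicOn_iff {p : Cotangent (n := n) M → ℝ} {γ : ℝ → Cotangent (n := n) M}
    {J : Set ℝ} : IsNullBicharacteristicOn p γ J ↔ ∀ t ∈ J,
      ContinuousWithinAt (fun s => (γ s).1) J t ∧
      (∀ ζ : EuclideanSpace ℝ (Fin n) →L[ℝ] ℝ,
        HasDerivWithinAt (fun s => ζ (extChartAt (𝓡∂ n) (γ t).1 (γ s).1))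
          (fderiv ℝ (fun η => p (ofCoord (γ t).1 (extChartAt (𝓡∂ n) (γ t).1 (γ t).1) η))
            (momentum (γ t).1 (γ t)) ζ) J t) ∧
      HasDerivWithinAt (fun s => momentum (γ t).1 (γ s))
        (-fderivWithin ℝ (fun y => p (ofCoord (γ t).1 y (momentum (γ t).1 (γ t))))
          (range (𝓡∂ n)) (extChartAt (𝓡∂ n) (γ t).1 (γ t).1)) J t ∧ γ t ∈ charSet p := by
  constructor
  · rintro ⟨⟨h1, h2, h3⟩, h4⟩ t ht
    exact ⟨h1 t ht, h2 t ht, h3 t ht, h4 t ht⟩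
  · intro h
    exact ⟨⟨fun t ht => (h t ht).1, fun t ht => (h t ht).2.1, fun t ht => (h t ht).2.2.1⟩,
      fun t ht => (h t ht).2.2.2⟩

lemma IsNullBicharacteristicOn.mono {p : Cotangent (n := n) M → ℝ}
    {γ : ℝ → Cotangent (n := n) M} {J J' : Set ℝ} (h : IsNullBicharacteristicOn p γ J')
    (hJ : J ⊆ J') : IsNullBicharacteristicOn p γ J := by
  rw [isNullBicharacteristicOn_iff] at h ⊢
  intro t ht
  obtain ⟨h1, h2, h3, h4⟩ := h t (hJ ht)
  exact ⟨h1.mono hJ, fun ζ => (h2 ζ).mono hJ, h3.mono hJ, h4⟩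

lemma exists_concat_nullBicharacteristic {p : Cotangent (n := n) M → ℝ}
    {γ₁ γ₂ : ℝ → Cotangent (n := n) M} {a b c : ℝ} (hab : a ≤ b) (hbc : b ≤ c)
    (h₁ : IsNullBicharacteristicOn p γ₁ (Icc a b)) (h₂ : IsNullBicharacteristicOn p γ₂ (Icc b c))
    (hb : γ₁ b = γ₂ b) :
    ∃ γ, IsNullBicharacteristicOn p γ (Icc a c) ∧ EqOn γ γ₁ (Icc a b) ∧ EqOn γ γ₂ (Icc b c) := by
  simp only [isNullBicharacteristicOn_iff] at h₁ h₂ ⊢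
  refine exists_concat (D := fun (γ : ℝ → Cotangent (n := n) M) J t =>
      ContinuousWithinAt (fun s => (γ s).1) J t ∧
      (∀ ζ : EuclideanSpace ℝ (Fin n) →L[ℝ] ℝ,
        HasDerivWithinAt (fun s => ζ (extChartAt (𝓡∂ n) (γ t).1 (γ s).1))
          (fderiv ℝ (fun η => p (ofCoord (γ t).1 (extChartAt (𝓡∂ n) (γ t).1 (γ t).1) η))
            (momentum (γ t).1 (γ t)) ζ) J t) ∧
      HasDerivWithinAt (fun s => momentum (γ t).1 (γ s))
        (-fderivWithin ℝ (fun y => p (ofCoord (γ t).1 y (momentum (γ t).1 (γ t))))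
          (range (𝓡∂ n)) (extChartAt (𝓡∂ n) (γ t).1 (γ t).1)) J t ∧ γ t ∈ charSet p)
    ?_ ?_ ?_ hab hbc h₁ h₂ hb
  · rintro γ γ' J t ht he ⟨h1, h2, h3, h4⟩
    rw [he ht]
    exact ⟨h1.congr_of_mem (fun s hs => by rw [he hs]) ht,
      fun ζ => (h2 ζ).congr_of_mem (fun s hs => by rw [he hs]) ht,
      h3.congr_of_mem (fun s hs => by rw [he hs]) ht, h4⟩
  · rintro γ J J' t hJ ht ⟨h1, h2, h3, h4⟩
    exact ⟨h1.mono_of_mem_nhdsWithin hJ, fun ζ => (h2 ζ).mono_of_mem_nhdsWithin hJ,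
      h3.mono_of_mem_nhdsWithin hJ, h4⟩
  · rintro γ J J' t ⟨h1, h2, h3, h4⟩ ⟨h1', h2', h3', -⟩
    exact ⟨h1.union h1', fun ζ => (h2 ζ).union (h2' ζ), h3.union h3', h4⟩

variable [IsManifold (𝓡∂ n) ∞ M]

lemma chartCovector_momentum {c : M} {z : Cotangent (n := n) M}
    (hz : z.1 ∈ (extChartAt (𝓡∂ n) c).source) : chartCovector c z.1 (momentum c z) = z := by
  obtain ⟨x, ξ⟩ := z
  have h : ∀ v, mfderivWithin 𝓘(ℝ, EuclideanSpace ℝ (Fin n)) (𝓡∂ n) (extChartAt (𝓡∂ n) c).symm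
      (range (𝓡∂ n)) (extChartAt (𝓡∂ n) c x)
      (mfderiv (𝓡∂ n) 𝓘(ℝ, EuclideanSpace ℝ (Fin n)) (extChartAt (𝓡∂ n) c) x v) = v :=
    DFunLike.congr_fun (mfderivWithin_extChartAt_symm_comp_mfderiv_extChartAt' (I := 𝓡∂ n) hz)
  have h2 : (chartCovector c x (momentum c ⟨x, ξ⟩)).2 = ξ :=
    ContinuousLinearMap.ext fun v => congrArg ξ (h v)
  exact congrArg (Bundle.TotalSpace.mk x) h2

lemma chartCovector_ne_zero {c x : M} (hx : x ∈ (extChartAt (𝓡∂ n) c).source)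
    {η : EuclideanSpace ℝ (Fin n) →L[ℝ] ℝ} (hη : η ≠ 0) : (chartCovector c x η).2 ≠ 0 := by
  intro h
  refine hη (ContinuousLinearMap.ext fun v => ?_)
  have h1 := DFunLike.congr_fun
    (mfderiv_extChartAt_comp_mfderivWithin_extChartAt_symm' (I := 𝓡∂ n) hx) v
  have h2 := DFunLike.congr_fun h (mfderivWithin 𝓘(ℝ, EuclideanSpace ℝ (Fin n)) (𝓡∂ n)
    (extChartAt (𝓡∂ n) c).symm (range (𝓡∂ n)) (extChartAt (𝓡∂ n) c x) v)
  exact (congrArg η h1).symm.trans h2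

omit [IsManifold (𝓡∂ n) ∞ M] in
lemma fieldSymbol_chartCovector {c x : M} (hx : x ∈ (extChartAt (𝓡∂ n) c).source)
    (η : EuclideanSpace ℝ (Fin n) →L[ℝ] ℝ) :
    fieldSymbol L (chartCovector c x η) = η (chartField L c (extChartAt (𝓡∂ n) c x)) := by
  rw [chartField_apply L hx]
  rfl

variable (hL : ContMDiff (𝓡∂ n) (𝓡∂ n).tangent ∞ (fun x => (⟨x, L x⟩ : TangentBundle (𝓡∂ n) M)))
include hL

/-- Hamilton's equations for the momentum are linear, so that short pieces of integral curves can
be lifted with any initial covector; the lift of a null covector stays in the characteristic set. -/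
lemma exists_local_lift (c : M) : ∃ ε > 0, ∃ U ∈ 𝓝 c, ∀ (x : ℝ → M) (s t b : ℝ), b ∈ Icc s t →
    t - s ≤ ε → IsMIntegralCurveOn x L (Icc s t) → (∀ τ ∈ Icc s t, x τ ∈ U) →
    ∀ z ∈ charSet (fieldSymbol L), z.1 = x b →
      ∃ γ, IsNullBicharacteristicOn (fieldSymbol L) γ (Icc s t) ∧
        (∀ τ ∈ Icc s t, (γ τ).1 = x τ) ∧ γ b = z := by
  obtain ⟨L', W, hL', hW, hcW, hWt⟩ := exists_chart_extension hL 1 c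
  have hL'1 : ContDiff ℝ 1 L' := by exact_mod_cast hL'
  set φ := extChartAt (𝓡∂ n) c with hφ
  have hcont : Continuous (fderiv ℝ L') := hL'1.continuous_fderiv one_ne_zero
  set K := ‖fderiv ℝ L' (φ c)‖ + 1 with hK
  have hKpos : 0 < K := by positivity
  have hO : IsOpen (W ∩ {y | ‖fderiv ℝ L' y‖ < K}) :=
    hW.inter (isOpen_lt hcont.norm continuous_const)
  refine ⟨1 / (2 * K), by positivity, φ.source ∩ φ ⁻¹' (W ∩ {y | ‖fderiv ℝ L' y‖ < K}),
    inter_mem (extChartAt_source_mem_nhds _) ((continuousAt_extChartAt _).preimage_mem_nhds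
      (hO.mem_nhds ⟨hcW, show ‖fderiv ℝ L' (φ c)‖ < K from lt_add_one _⟩)), ?_⟩
  intro x s t b hb hts hx hxU z hz hzx
  have hts' : 2 * K * (t - s) ≤ 1 := by
    rw [le_div_iff₀ (by positivity)] at hts
    linarith
  let B : (EuclideanSpace ℝ (Fin n) →L[ℝ] EuclideanSpace ℝ (Fin n)) →L[ℝ]
      (EuclideanSpace ℝ (Fin n) →L[ℝ] ℝ) →L[ℝ] (EuclideanSpace ℝ (Fin n) →L[ℝ] ℝ) :=
    -(ContinuousLinearMap.compL ℝ (EuclideanSpace ℝ (Fin n)) (EuclideanSpace ℝ (Fin n)) ℝ).flip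
  have hB : ∀ T η, B T η = -(η.comp T) := fun T η => rfl
  have hBn : ∀ T, ‖B T‖ ≤ ‖T‖ := fun T => by
    refine ContinuousLinearMap.opNorm_le_bound _ (norm_nonneg _) fun η => ?_
    rw [hB, norm_neg, mul_comm]
    exact η.opNorm_comp_le T
  have hxc : ContinuousOn (fun τ => φ (x τ)) (Icc s t) := fun τ hτ =>
    (hasDerivWithinAt_chart hx hτ (hxU τ hτ).1).continuousWithinAt
  have hη₀ : momentum c z ≠ 0 := by
    intro h
    have h1 := chartCovector_momentum (c := c) (z := z) (by rw [hzx]; exact (hxU b hb).1)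
    refine hz.1 ?_
    rw [← h1, h]
    exact ContinuousLinearMap.zero_comp _
  obtain ⟨η, hηb, hη⟩ := exists_linear_solution (A := fun τ => B (fderiv ℝ L' (φ (x τ))))
    (B.continuous.comp_continuousOn (hcont.comp_continuousOn hxc))
    (fun τ hτ => (hBn _).trans (hxU τ hτ).2.2.le) hts' hb hη₀
  have hη0 := ne_zero_of_norm_deriv_le (K := K) (by nlinarith) hη hb (fun τ hτ =>
    ((B _).le_opNorm _).trans (mul_le_mul_of_nonneg_right
      ((hBn _).trans (hxU τ hτ).2.2.le) (norm_nonneg _))) (by rwa [hηb])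
  have hxH : ∀ τ ∈ Icc s t, φ (x τ) ∈ halfSpace (firstCoord n) := fun τ hτ =>
    extChartAt_target_subset c (φ.map_source (hxU τ hτ).1)
  have hLL : ∀ τ ∈ Icc s t, chartField L c (φ (x τ)) = L' (φ (x τ)) := fun τ hτ =>
    (hWt _ (hxU τ hτ).2.1 (hxH τ hτ)).2
  have hfd : ∀ τ ∈ Icc s t, fderivWithin ℝ (chartField L c) (halfSpace (firstCoord n)) (φ (x τ)) =
      fderiv ℝ L' (φ (x τ)) := fun τ hτ => by
    have he : chartField L c =ᶠ[𝓝[halfSpace (firstCoord n)] (φ (x τ))] L' := by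
      filter_upwards [self_mem_nhdsWithin, mem_nhdsWithin_of_mem_nhds
        (hW.mem_nhds (hxU τ hτ).2.1)] with y hy hyW using (hWt y hyW hy).2
    rw [he.fderivWithin_eq (hLL τ hτ)]
    exact (hL'1.differentiable one_ne_zero _).fderivWithin
      (uniqueDiffOn_halfSpace firstCoord_inwardVector _ (hxH τ hτ))
  have hnull : ∀ τ ∈ Icc s t, η τ (L' (φ (x τ))) = 0 := by
    have hd : ∀ τ ∈ Icc s t, HasDerivWithinAt (fun τ => η τ (L' (φ (x τ)))) 0 (Icc s t) τ := by
      intro τ hτ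
      have h1 := hasDerivWithinAt_chart hx hτ (hxU τ hτ).1
      rw [← hφ, hLL τ hτ] at h1
      have h2 := ((hL'1.differentiable one_ne_zero
        (φ (x τ))).hasFDerivAt).comp_hasDerivWithinAt (f := fun τ => φ (x τ)) τ h1
      refine ((hη τ hτ).clm_apply h2).congr_deriv ?_
      simp only [hB, neg_apply, ContinuousLinearMap.comp_apply]
      exact neg_add_cancel _
    intro τ hτ
    have h1 := (convex_Icc s t).norm_image_sub_le_of_norm_hasDerivWithin_le hd (C := 0)
      (fun τ _ => by simp) hb hτ
    rw [zero_mul, norm_le_zero_iff, sub_eq_zero] at h1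
    rw [h1, hηb, ← hLL b hb, ← fieldSymbol_chartCovector (hxU b hb).1, ← hzx,
      chartCovector_momentum (by rw [hzx]; exact (hxU b hb).1)]
    exact hz.2
  refine ⟨fun τ => chartCovector c (x τ) (η τ),
    ⟨isBicharacteristicOn_of_chart hL hx (fun τ hτ => (hxU τ hτ).1) fun τ hτ => ?_,
      fun τ hτ => ⟨chartCovector_ne_zero (hxU τ hτ).1 (hη0 τ hτ), ?_⟩⟩, fun τ _ => rfl, ?_⟩
  · rw [← hφ, hfd τ hτ]
    exact hη τ hτ
  · rw [fieldSymbol_chartCovector (hxU τ hτ).1, ← hφ, hLL τ hτ]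
    exact hnull τ hτ
  · simp only [hηb, ← hzx]
    exact chartCovector_momentum (by rw [hzx]; exact (hxU b hb).1)

lemma eventually_exists_lift {x : ℝ → M} {a b τ : ℝ} (hx : IsMIntegralCurveOn x L (Icc a b))
    (hτ : τ ∈ Icc a b) : ∀ᶠ y in 𝓝[Icc a b] τ, ∀ d ∈ Icc (min τ y) (max τ y),
      ∀ z ∈ charSet (fieldSymbol L), z.1 = x d →
        ∃ γ, IsNullBicharacteristicOn (fieldSymbol L) γ (Icc (min τ y) (max τ y)) ∧
          (∀ σ ∈ Icc (min τ y) (max τ y), (γ σ).1 = x σ) ∧ γ d = z := by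
  obtain ⟨ε, hε, U, hU, h⟩ := exists_local_lift hL (x τ)
  filter_upwards [exists_uIcc_subset_of_eventually hτ ((hx τ hτ).1.eventually hU),
    mem_nhdsWithin_of_mem_nhds (Metric.closedBall_mem_nhds τ hε)] with y hy hyε d hd z hz hzx
  refine h x _ _ d hd ?_ (hx.mono fun σ hσ => (hy σ hσ).1) (fun σ hσ => (hy σ hσ).2) z hz hzx
  rw [max_sub_min_eq_abs]
  rwa [mem_closedBall_iff_norm] at hyε

/-- Integral curves of `L` lift to null bicharacteristics with prescribed initial covector. -/
theorem exists_lift_of_left {x : ℝ → M} {a b : ℝ} (hab : a ≤ b)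
    (hx : IsMIntegralCurveOn x L (Icc a b)) {z : Cotangent (n := n) M}
    (hz : z ∈ charSet (fieldSymbol L)) (hzx : z.1 = x a) :
    ∃ γ, IsNullBicharacteristicOn (fieldSymbol L) γ (Icc a b) ∧
      (∀ τ ∈ Icc a b, (γ τ).1 = x τ) ∧ γ a = z := by
  let P : ℝ → Prop := fun t => ∃ γ, IsNullBicharacteristicOn (fieldSymbol L) γ (Icc a t) ∧
      (∀ τ ∈ Icc a t, (γ τ).1 = x τ) ∧ γ a = z
  have hmono : ∀ t t', t' ≤ t → P t → P t' := fun t t' h ⟨γ, h1, h2, h3⟩ =>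
    ⟨γ, h1.mono (Icc_subset_Icc_right h), fun τ hτ => h2 τ ⟨hτ.1, hτ.2.trans h⟩, h3⟩
  have hext : ∀ t t', a ≤ t → t ≤ t' → (∀ z ∈ charSet (fieldSymbol L), z.1 = x t →
      ∃ γ, IsNullBicharacteristicOn (fieldSymbol L) γ (Icc t t') ∧
        (∀ σ ∈ Icc t t', (γ σ).1 = x σ) ∧ γ t = z) → P t → P t' := by
    rintro t t' hat htt h ⟨γ, h1, h2, h3⟩
    obtain ⟨γ', h1', h2', h3'⟩ := h (γ t) (h1.2 t ⟨hat, le_rfl⟩) (h2 t ⟨hat, le_rfl⟩)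
    obtain ⟨β, hβ, e1, e2⟩ := exists_concat_nullBicharacteristic hat htt h1 h1' h3'.symm
    refine ⟨β, hβ, fun τ hτ => ?_, by rw [e1 ⟨le_rfl, hat⟩, h3]⟩
    rcases le_total τ t with hle | hle
    · rw [e1 ⟨hτ.1, hle⟩, h2 τ ⟨hτ.1, hle⟩]
    · rw [e2 ⟨hle, hτ.2⟩, h2' τ ⟨hle, hτ.2⟩]
  have hnear : ∀ τ ∈ Icc a b, ∀ᶠ y in 𝓝[Icc a b] τ, P τ ↔ P y := by
    intro τ hτ
    filter_upwards [eventually_exists_lift hL hx hτ, self_mem_nhdsWithin] with y hy hyI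
    rcases le_total τ y with hle | hle
    · rw [min_eq_left hle, max_eq_right hle] at hy
      exact ⟨hext τ y hτ.1 hle (hy τ ⟨le_rfl, hle⟩), hmono _ _ hle⟩
    · rw [min_eq_right hle, max_eq_left hle] at hy
      exact ⟨hmono _ _ hle, hext y τ hyI.1 hle (hy y ⟨le_rfl, hle⟩)⟩
  refine forall_mem_Icc_of_isOpen_isClosed (P := P) ⟨le_rfl, hab⟩ ?_
    (fun τ hτ h => (hnear τ hτ).mono fun y hy => hy.1 h)
    (fun τ hτ h => ?_) b ⟨hab, le_rfl⟩
  · obtain ⟨ε, hε, U, hU, h⟩ := exists_local_lift hL (x a)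
    refine h x a a a ⟨le_rfl, le_rfl⟩ (by linarith) (hx.mono (Icc_subset_Icc_right hab))
      (fun τ hτ => ?_) z hz hzx
    rw [Icc_self, mem_singleton_iff] at hτ
    rw [hτ]
    exact mem_of_mem_nhds hU
  · obtain ⟨y, hy1, hy2⟩ := (h.and_eventually (hnear τ hτ)).exists
    exact hy2.2 hy1

/-- Integral curves of `L` lift to null bicharacteristics with prescribed final covector. -/
theorem exists_lift_of_right {x : ℝ → M} {a b : ℝ} (hab : a ≤ b)
    (hx : IsMIntegralCurveOn x L (Icc a b)) {z : Cotangent (n := n) M}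
    (hz : z ∈ charSet (fieldSymbol L)) (hzx : z.1 = x b) :
    ∃ γ, IsNullBicharacteristicOn (fieldSymbol L) γ (Icc a b) ∧
      (∀ τ ∈ Icc a b, (γ τ).1 = x τ) ∧ γ b = z := by
  let P : ℝ → Prop := fun t => ∃ γ, IsNullBicharacteristicOn (fieldSymbol L) γ (Icc t b) ∧
      (∀ τ ∈ Icc t b, (γ τ).1 = x τ) ∧ γ b = z
  have hmono : ∀ t t', t ≤ t' → P t → P t' := fun t t' h ⟨γ, h1, h2, h3⟩ =>
    ⟨γ, h1.mono (Icc_subset_Icc_left h), fun τ hτ => h2 τ ⟨h.trans hτ.1, hτ.2⟩, h3⟩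
  have hext : ∀ t t', t ≤ b → t' ≤ t → (∀ z ∈ charSet (fieldSymbol L), z.1 = x t →
      ∃ γ, IsNullBicharacteristicOn (fieldSymbol L) γ (Icc t' t) ∧
        (∀ σ ∈ Icc t' t, (γ σ).1 = x σ) ∧ γ t = z) → P t → P t' := by
    rintro t t' htb htt h ⟨γ, h1, h2, h3⟩
    obtain ⟨γ', h1', h2', h3'⟩ := h (γ t) (h1.2 t ⟨le_rfl, htb⟩) (h2 t ⟨le_rfl, htb⟩)
    obtain ⟨β, hβ, e1, e2⟩ := exists_concat_nullBicharacteristic htt htb h1' h1 h3'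
    refine ⟨β, hβ, fun τ hτ => ?_, by rw [e2 ⟨htb, le_rfl⟩, h3]⟩
    rcases le_total τ t with hle | hle
    · rw [e1 ⟨hτ.1, hle⟩, h2' τ ⟨hτ.1, hle⟩]
    · rw [e2 ⟨hle, hτ.2⟩, h2 τ ⟨hle, hτ.2⟩]
  have hnear : ∀ τ ∈ Icc a b, ∀ᶠ y in 𝓝[Icc a b] τ, P τ ↔ P y := by
    intro τ hτ
    filter_upwards [eventually_exists_lift hL hx hτ, self_mem_nhdsWithin] with y hy hyI
    rcases le_total τ y with hle | hle
    · rw [min_eq_left hle, max_eq_right hle] at hy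
      exact ⟨hmono _ _ hle, hext y τ hyI.2 hle (hy y ⟨hle, le_rfl⟩)⟩
    · rw [min_eq_right hle, max_eq_left hle] at hy
      exact ⟨hext τ y hτ.2 hle (hy τ ⟨hle, le_rfl⟩), hmono _ _ hle⟩
  refine forall_mem_Icc_of_isOpen_isClosed (P := P) ⟨hab, le_rfl⟩ ?_
    (fun τ hτ h => (hnear τ hτ).mono fun y hy => hy.1 h)
    (fun τ hτ h => ?_) a ⟨le_rfl, hab⟩
  · obtain ⟨ε, hε, U, hU, h⟩ := exists_local_lift hL (x b)
    refine h x b b b ⟨le_rfl, le_rfl⟩ (by linarith) (hx.mono (Icc_subset_Icc_left hab))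
      (fun τ hτ => ?_) z hz hzx
    rw [Icc_self, mem_singleton_iff] at hτ
    rw [hτ]
    exact mem_of_mem_nhds hU
  · obtain ⟨y, hy1, hy2⟩ := (h.and_eventually (hnear τ hτ)).exists
    exact hy2.2 hy1

end GlobalLifts

/-! ### Maximal integral curves and the scattering relation -/

section Scattering

lemma ofReal_le_forwardTime {X : Type*} {C : (ℝ → X) → Set ℝ → Prop} {γ : ℝ → X} {T : ℝ}
    (hT : 0 ≤ T) (hγ : C γ (Icc 0 T)) : ENNReal.ofReal T ≤ forwardTime C (γ 0) :=
  le_iSup₂_of_le (f := fun (T : ℝ≥0) (_ : ∃ γ' : ℝ → X, C γ' (Icc 0 (T : ℝ)) ∧ γ' 0 = γ 0) =>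
    (T : ℝ≥0∞)) T.toNNReal ⟨γ, by rwa [Real.coe_toNNReal T hT], rfl⟩ le_rfl

lemma ofReal_le_backwardTime {X : Type*} {C : (ℝ → X) → Set ℝ → Prop} {γ : ℝ → X} {T : ℝ}
    (hT : 0 ≤ T) (hγ : C γ (Icc (-T) 0)) : ENNReal.ofReal T ≤ backwardTime C (γ 0) :=
  le_iSup₂_of_le (f := fun (T : ℝ≥0) (_ : ∃ γ' : ℝ → X, C γ' (Icc (-(T : ℝ)) 0) ∧ γ' 0 = γ 0) =>
    (T : ℝ≥0∞)) T.toNNReal ⟨γ, by rwa [Real.coe_toNNReal T hT], rfl⟩ le_rfl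

lemma forwardTime_le {X : Type*} {C : (ℝ → X) → Set ℝ → Prop} {x : X} {S : ℝ}
    (h : ∀ (T : ℝ) (γ : ℝ → X), 0 ≤ T → C γ (Icc 0 T) → γ 0 = x → T ≤ S) :
    forwardTime C x ≤ ENNReal.ofReal S := by
  refine iSup₂_le fun T ⟨γ, hγ, h0⟩ => ?_
  rw [← ENNReal.ofReal_coe_nnreal]
  exact ENNReal.ofReal_le_ofReal (h T γ T.2 hγ h0)

lemma backwardTime_le {X : Type*} {C : (ℝ → X) → Set ℝ → Prop} {x : X} {S : ℝ}
    (h : ∀ (T : ℝ) (γ : ℝ → X), 0 ≤ T → C γ (Icc (-T) 0) → γ 0 = x → T ≤ S) :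
    backwardTime C x ≤ ENNReal.ofReal S := by
  refine iSup₂_le fun T ⟨γ, hγ, h0⟩ => ?_
  rw [← ENNReal.ofReal_coe_nnreal]
  exact ENNReal.ofReal_le_ofReal (h T γ T.2 hγ h0)

variable {n : ℕ} [NeZero n]

/-- In dimension at least two every vector is annihilated by a nonzero covector. -/
lemma exists_ne_zero_apply_eq_zero (v : EuclideanSpace ℝ (Fin n)) (h : 2 ≤ n ∨ v = 0) :
    ∃ ξ : EuclideanSpace ℝ (Fin n) →L[ℝ] ℝ, ξ ≠ 0 ∧ ξ v = 0 := by
  have hfc : firstCoord n ≠ 0 := fun h0 => by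
    have := firstCoord_inwardVector (n := n)
    rw [h0] at this
    exact zero_ne_one this
  rcases h with h | h
  · by_cases hv : firstCoord n v = 0
    · exact ⟨firstCoord n, hfc, hv⟩
    · let i : Fin n := ⟨1, h⟩
      refine ⟨v i • firstCoord n - firstCoord n v • EuclideanSpace.proj i, fun h0 => hv ?_, ?_⟩
      · have := DFunLike.congr_fun h0 (EuclideanSpace.single i 1)
        have hi : (0 : Fin n) ≠ i := fun h => by
          have := congrArg Fin.val h
          simp [i] at this
        simpa [firstCoord, hi] using this
      · simp [mul_comm]
  · exact ⟨firstCoord n, hfc, by rw [h, map_zero]⟩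

variable {M : Type*} [TopologicalSpace M]
  [ChartedSpace (EuclideanHalfSpace n) M] {L : (x : M) → TangentSpace (𝓡∂ n) x}

lemma exists_mem_charSet (x : M) (h : 2 ≤ n ∨ L x = 0) :
    ∃ z ∈ charSet (fieldSymbol L), z.1 = x := by
  obtain ⟨ξ, h1, h2⟩ := exists_ne_zero_apply_eq_zero (L x) h
  exact ⟨⟨x, ξ⟩, ⟨h1, h2⟩, rfl⟩

variable [IsManifold (𝓡∂ n) ∞ M]

section Lifetimes

variable (hL : ContMDiff (𝓡∂ n) (𝓡∂ n).tangent ∞ (fun x => (⟨x, L x⟩ : TangentBundle (𝓡∂ n) M)))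
include hL

/-- The life times of null bicharacteristics bound those of the integral curves below them. -/
lemma ofReal_le_forwardTime_of_integralCurve {x : ℝ → M} {T : ℝ} (hT : 0 ≤ T)
    (hx : IsMIntegralCurveOn x L (Icc 0 T)) {z : Cotangent (n := n) M}
    (hz : z ∈ charSet (fieldSymbol L)) (hzx : z.1 = x 0) :
    ENNReal.ofReal T ≤ forwardTime (IsNullBicharacteristicOn (fieldSymbol L)) z := by
  obtain ⟨γ, hγ, -, rfl⟩ := exists_lift_of_left hL hT hx hz hzx
  exact ofReal_le_forwardTime hT hγ

lemma ofReal_le_backwardTime_of_integralCurve {x : ℝ → M} {T : ℝ} (hT : 0 ≤ T)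
    (hx : IsMIntegralCurveOn x L (Icc (-T) 0)) {z : Cotangent (n := n) M}
    (hz : z ∈ charSet (fieldSymbol L)) (hzx : z.1 = x 0) :
    ENNReal.ofReal T ≤ backwardTime (IsNullBicharacteristicOn (fieldSymbol L)) z := by
  obtain ⟨γ, hγ, -, rfl⟩ := exists_lift_of_right hL (by linarith) hx hz hzx
  exact ofReal_le_backwardTime hT hγ

/-- A zero of `L` would be a trapped integral curve. -/
lemma IsNontrapping.field_ne_zero (h : IsNontrapping (fieldSymbol L)) (x : M) : L x ≠ 0 := by
  intro h0
  obtain ⟨z, hz, rfl⟩ := exists_mem_charSet x (Or.inr h0)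
  refine (h z hz).1.ne (ENNReal.eq_top_of_forall_nnreal_le fun r => ?_)
  rw [← ENNReal.ofReal_coe_nnreal]
  refine ofReal_le_forwardTime_of_integralCurve hL r.2
    (x := fun _ => z.1) (fun t _ => ?_) hz rfl
  rw [h0]
  refine (hasMFDerivWithinAt_const z.1 _ _).congr_mfderiv ?_
  ext
  simp
  rfl

lemma IsNontrapping.bddAbove_backwardTimes (h : IsNontrapping (fieldSymbol L)) (hn : 2 ≤ n)
    (x : M) : BddAbove (backwardTimes L x) := by
  obtain ⟨z, hz, rfl⟩ := exists_mem_charSet (L := L) x (Or.inl hn)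
  refine ⟨(backwardTime (IsNullBicharacteristicOn (fieldSymbol L)) z).toReal, ?_⟩
  rintro T ⟨hT, γ, hγ, h0⟩
  have := ofReal_le_backwardTime_of_integralCurve hL hT hγ hz h0.symm
  exact (ENNReal.ofReal_le_iff_le_toReal (h z hz).2.ne).1 this

end Lifetimes

section Maximal

variable {x : ℝ → M} {T : ℝ}

omit [IsManifold (𝓡∂ n) ∞ M] in
lemma IsMaximalIntegralCurve.curve (h : IsMaximalIntegralCurve L x T) :
    IsMIntegralCurveOn x L (Icc 0 T) := h.2.1

omit [IsManifold (𝓡∂ n) ∞ M] in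
lemma IsMaximalIntegralCurve.eq_zero_of_backward (h : IsMaximalIntegralCurve L x T) {γ : ℝ → M}
    {t : ℝ} (ht : 0 ≤ t) (hγ : IsMIntegralCurveOn γ L (Icc (-t) 0)) (h0 : γ 0 = x 0) : t = 0 := by
  obtain ⟨β, hβ, -, h2⟩ := exists_concat_integralCurve (by linarith) h.1 hγ h.curve h0
  have := (h.2.2 (-t) T β (by linarith) le_rfl hβ h2).1
  linarith

variable [T2Space M]
  (hL : ContMDiff (𝓡∂ n) (𝓡∂ n).tangent ∞ (fun x => (⟨x, L x⟩ : TangentBundle (𝓡∂ n) M)))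
include hL

lemma IsMaximalIntegralCurve.le_of_forward (h : IsMaximalIntegralCurve L x T) {γ : ℝ → M}
    {t : ℝ} (hγ : IsMIntegralCurveOn γ L (Icc 0 t)) (h0 : γ 0 = x 0) : t ≤ T := by
  by_contra! hlt
  have he := eqOn_of_isMIntegralCurveOn hL (hγ.mono (Icc_subset_Icc_right hlt.le)) h.curve
    ⟨le_rfl, h.1⟩ h0
  exact hlt.ne' (h.2.2 0 t γ le_rfl hlt.le hγ he).2

lemma IsMaximalIntegralCurve.forwardTime_eq (h : IsMaximalIntegralCurve L x T)
    {z : Cotangent (n := n) M} (hz : z ∈ charSet (fieldSymbol L)) (hzx : z.1 = x 0) :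
    forwardTime (IsNullBicharacteristicOn (fieldSymbol L)) z = ENNReal.ofReal T := by
  refine le_antisymm (forwardTime_le fun t γ _ hγ h0 => ?_)
    (ofReal_le_forwardTime_of_integralCurve hL h.1 h.curve hz hzx)
  exact h.le_of_forward hL hγ.1.isMIntegralCurveOn (by rw [h0, hzx])

omit [T2Space M] hL in
lemma IsMaximalIntegralCurve.backwardTime_eq (h : IsMaximalIntegralCurve L x T)
    {z : Cotangent (n := n) M} (hzx : z.1 = x 0) :
    backwardTime (IsNullBicharacteristicOn (fieldSymbol L)) z = 0 := by
  rw [← nonpos_iff_eq_zero, ← ENNReal.ofReal_zero]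
  exact backwardTime_le fun t γ ht hγ h0 =>
    (h.eq_zero_of_backward ht hγ.1.isMIntegralCurveOn (by rw [h0, hzx])).le

omit hL in
/-- In dimension at least two the scattering relation determines the end points of the maximal
integral curves. -/
lemma IsMaximalIntegralCurve.apply_end_eq {L₁ L₂ : (x : M) → TangentSpace (𝓡∂ n) x}
    (hL₁ : ContMDiff (𝓡∂ n) (𝓡∂ n).tangent ∞ (fun x => (⟨x, L₁ x⟩ : TangentBundle (𝓡∂ n) M)))
    (hL₂ : ContMDiff (𝓡∂ n) (𝓡∂ n).tangent ∞ (fun x => (⟨x, L₂ x⟩ : TangentBundle (𝓡∂ n) M)))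
    (hn : 2 ≤ n)
    (hα : scatteringRelation (fieldSymbol L₁) = scatteringRelation (fieldSymbol L₂))
    {x₁ x₂ : ℝ → M} {T₁ T₂ : ℝ} (h₁ : IsMaximalIntegralCurve L₁ x₁ T₁)
    (h₂ : IsMaximalIntegralCurve L₂ x₂ T₂) (h0 : x₁ 0 = x₂ 0) : x₁ T₁ = x₂ T₂ := by
  obtain ⟨z, hz, hzx⟩ := exists_mem_charSet (L := L₁) (x₁ 0) (Or.inl hn)
  obtain ⟨γ, hγ, hγx, hγz⟩ := exists_lift_of_left hL₁ h₁.1 h₁.curve hz hzx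
  have hT₁ : (forwardTime (IsNullBicharacteristicOn (fieldSymbol L₁)) z).toReal = T₁ := by
    rw [h₁.forwardTime_eq hL₁ hz hzx, ENNReal.toReal_ofReal h₁.1]
  have hmem : (z, γ T₁) ∈ scatteringRelation (fieldSymbol L₁) :=
    Or.inl ⟨⟨hz, h₁.backwardTime_eq hzx⟩, γ, by rwa [hT₁], hγz, by rw [hT₁]⟩
  rw [hα] at hmem
  have hzx₂ : z.1 = x₂ 0 := hzx.trans h0
  have hend := hγx T₁ ⟨h₁.1, le_rfl⟩
  rcases hmem with ⟨⟨hz₂, -⟩, β, hβ, hβ0, hβT⟩ | ⟨⟨hz₂, hf⟩, β, hβ, hβ0, hβT⟩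
  · have hT₂ : (forwardTime (IsNullBicharacteristicOn (fieldSymbol L₂)) z).toReal = T₂ := by
      rw [h₂.forwardTime_eq hL₂ hz₂ hzx₂, ENNReal.toReal_ofReal h₂.1]
    simp only [hT₂] at hβ hβT
    have he := eqOn_of_isMIntegralCurveOn hL₂ hβ.1.isMIntegralCurveOn h₂.curve ⟨le_rfl, h₂.1⟩
      (by simp only [hβ0, hzx₂]) ⟨h₂.1, le_rfl⟩
    rw [← hend, ← hβT]
    exact he
  · simp only at hf hβT hβ0
    rw [h₂.forwardTime_eq hL₂ hz₂ hzx₂, ENNReal.ofReal_eq_zero] at hf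
    have hT₂ : T₂ = 0 := le_antisymm hf h₂.1
    rw [h₂.backwardTime_eq hzx₂, ENNReal.toReal_zero, neg_zero, hβ0] at hβT
    rw [← hend, ← hβT, hT₂, hzx₂]

end Maximal

section Entry

variable [T2Space M]
  (hL : ContMDiff (𝓡∂ n) (𝓡∂ n).tangent ∞ (fun x => (⟨x, L x⟩ : TangentBundle (𝓡∂ n) M)))
  {x : M} {γ : ℝ → M} {T : ℝ}
include hL

lemma IsEntryCurve.mem_boundary (h : IsEntryCurve L x T γ) : γ (-T) ∈ (𝓡∂ n).boundary M := by
  by_contra hb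
  obtain ⟨ε, hε, β, hβ, hβ0⟩ := exists_integralCurve_of_notMem_boundary hL hb
  have h1 : ε ∈ backwardTimes L (γ (-T)) :=
    ⟨hε.le, β, hβ.mono (Icc_subset_Icc_right hε.le), hβ0⟩
  have h2 := add_mem_backwardTimes (by linarith [h.nonneg]) h.curve h1
  rw [h.apply_zero] at h2
  linarith [h.le _ h2]

/-- The integral curve which arrives at a boundary point is maximal. -/
lemma IsEntryCurve.isMaximalIntegralCurve [CompactSpace M] (hconv : IsStrictlyConvex L)
    (h : IsEntryCurve L x T γ) (hx : x ∈ (𝓡∂ n).boundary M) (hT : 0 < T) :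
    IsMaximalIntegralCurve L (fun t => γ (t + -T)) T := by
  refine ⟨h.nonneg, IsMIntegralCurveOn.shift (-T) ?_, fun a b γ' ha hb hγ' he => ?_⟩
  · rw [zero_add, add_neg_cancel]
    exact h.curve
  have heT : γ' T = x := by
    rw [he ⟨h.nonneg, le_rfl⟩]
    simp only [add_neg_cancel, h.apply_zero]
  have h1 : b = T := by
    by_contra hne
    refine notMem_boundary_of_integralCurve hL hconv hγ'
      ⟨ha.trans_lt hT, lt_of_le_of_ne hb (Ne.symm hne)⟩ ?_
    rwa [heT]
  subst h1
  have h2 : b - a ∈ backwardTimes L x := by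
    refine ⟨by linarith, fun t => γ' (t + b), IsMIntegralCurveOn.shift b ?_, by simpa using heT⟩
    rwa [neg_sub, sub_add_cancel, zero_add]
  exact ⟨by linarith [h.le _ h2], rfl⟩

end Entry

end Scattering

/-! ### Orbits in dimension one -/

section OneDimensional

variable {n : ℕ} [NeZero n]

lemma firstCoord_injective (hn : n = 1) : Function.Injective (firstCoord n) := by
  intro y y' h
  ext i
  have hi : i = 0 := Fin.ext (by have := i.2; simp only [Fin.val_zero]; omega)
  rw [hi]
  exact h

variable {M : Type*} [TopologicalSpace M]
  [ChartedSpace (EuclideanHalfSpace n) M] {L : (x : M) → TangentSpace (𝓡∂ n) x}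

lemma IsMIntegralCurveOn.congr_of_eqOn {γ γ' : ℝ → M} {J : Set ℝ} (h : IsMIntegralCurveOn γ L J)
    (he : EqOn γ' γ J) : IsMIntegralCurveOn γ' L J := by
  intro t ht
  have h1 := (h t ht).congr_of_eventuallyEq (eventually_nhdsWithin_of_forall he) (he ht)
  rw [he ht]
  exact h1

variable [IsManifold (𝓡∂ n) ∞ M]

lemma chartField_ne_zero {c x : M} (hx : x ∈ (extChartAt (𝓡∂ n) c).source) (h : L x ≠ 0) :
    chartField L c (extChartAt (𝓡∂ n) c x) ≠ 0 := by
  intro h0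
  rw [chartField_apply L hx] at h0
  refine h ?_
  have h1 := DFunLike.congr_fun
    (mfderivWithin_extChartAt_symm_comp_mfderiv_extChartAt' (I := 𝓡∂ n) hx) (L x)
  refine h1.symm.trans ((congrArg (mfderivWithin 𝓘(ℝ, EuclideanSpace ℝ (Fin n)) (𝓡∂ n)
    (extChartAt (𝓡∂ n) c).symm (range (𝓡∂ n)) (extChartAt (𝓡∂ n) c x)) h0).trans ?_)
  exact map_zero _

variable [T2Space M]
  (hL : ContMDiff (𝓡∂ n) (𝓡∂ n).tangent ∞ (fun x => (⟨x, L x⟩ : TangentBundle (𝓡∂ n) M)))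
include hL

/-- In dimension one the points near a point `z` lie on short integral curves through `z`. -/
lemma eventually_mem_integralCurve (hn : n = 1) {z : M} (hz : L z ≠ 0) {ε : ℝ} (hε : 0 < ε) :
    ∀ᶠ x in 𝓝 z, ∃ τ, |τ| ≤ ε ∧ ∃ η : ℝ → M,
      IsMIntegralCurveOn η L (Icc (min 0 τ) (max 0 τ)) ∧ η 0 = z ∧ η τ = x := by
  obtain ⟨L', Φ, ε₀, hε₀, U, hU, hL'c, hL'z, hUs, h⟩ := exists_chart_flow hL z
  obtain ⟨hΦ0, hΦc, hfl⟩ := h z (mem_of_mem_nhds hU)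
  set φ := extChartAt (𝓡∂ n) z with hφ
  have hzs : z ∈ φ.source := mem_extChartAt_source z
  set Z : ℝ → EuclideanSpace ℝ (Fin n) := fun τ => Φ (τ, φ z) with hZ
  have hZ0 : Z 0 = φ z := hΦ0
  have hZc : ContinuousAt Z 0 := (hΦc.continuousOn).continuousAt
    (Icc_mem_nhds (by linarith) hε₀)
  set g₀ := firstCoord n (L' (φ z)) with hg₀
  have hg₀ne : g₀ ≠ 0 := fun h0 => by
    rw [hg₀, hL'z, ← map_zero (firstCoord n)] at h0
    exact chartField_ne_zero hzs hz (firstCoord_injective hn h0)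
  have hev : ∀ᶠ τ in 𝓝 (0 : ℝ), 0 < g₀ * firstCoord n (L' (Z τ)) := by
    have hc : ContinuousAt (fun τ => g₀ * firstCoord n (L' (Z τ))) 0 :=
      continuousAt_const.mul ((firstCoord n).continuous.continuousAt.comp
        (hL'c.continuousAt.comp hZc))
    refine hc.eventually (lt_mem_nhds ?_)
    simp only [hZ0]
    exact mul_self_pos.2 hg₀ne
  obtain ⟨δ₁, hδ₁, hpos⟩ := Metric.eventually_nhds_iff.1 hev
  obtain ⟨δ, hδ, hδε, hδε₀, hδδ₁⟩ : ∃ δ > 0, δ ≤ ε ∧ δ ≤ ε₀ ∧ δ < δ₁ :=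
    ⟨min (min ε ε₀) (δ₁ / 2), by positivity, (min_le_left _ _).trans (min_le_left _ _),
      (min_le_left _ _).trans (min_le_right _ _), (min_le_right _ _).trans_lt (by linarith)⟩
  set F : ℝ → ℝ := fun τ => g₀ * firstCoord n (Z τ) with hF
  have hFd : ∀ τ ∈ Icc (-δ) δ, HasDerivWithinAt F (g₀ * firstCoord n (L' (Z τ)))
      (Icc (-δ) δ) τ := fun τ hτ =>
    ((firstCoord n).hasFDerivAt.comp_hasDerivWithinAt τ
      (hΦc.mono (neg_le_neg hδε₀) hδε₀ τ hτ)).const_mul g₀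
  have hFc : ContinuousOn F (Icc (-δ) δ) := fun τ hτ => (hFd τ hτ).continuousWithinAt
  have hmono : StrictMonoOn F (Icc (-δ) δ) := by
    refine strictMonoOn_of_deriv_pos (convex_Icc _ _) hFc fun τ hτ => ?_
    rw [interior_Icc] at hτ
    rw [((hFd τ (Ioo_subset_Icc_self hτ)).hasDerivAt (Icc_mem_nhds hτ.1 hτ.2)).deriv]
    refine hpos ?_
    rw [Real.dist_eq, sub_zero]
    exact (abs_lt.2 hτ).trans hδδ₁
  have h0m : (0 : ℝ) ∈ Icc (-δ) δ := ⟨by linarith, hδ.le⟩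
  have hF0 : F 0 = g₀ * firstCoord n (φ z) := by rw [hF]; simp only [hZ0]
  have hcx : ContinuousAt (fun x => g₀ * firstCoord n (φ x)) z :=
    continuousAt_const.mul ((firstCoord n).continuous.continuousAt.comp
      (continuousAt_extChartAt z))
  have e1 : ∀ᶠ x in 𝓝 z, F (-δ) < g₀ * firstCoord n (φ x) :=
    hcx.eventually (lt_mem_nhds (by
      simp only [← hF0]
      exact hmono ⟨le_rfl, by linarith⟩ h0m (by linarith)))
  have e2 : ∀ᶠ x in 𝓝 z, g₀ * firstCoord n (φ x) < F δ :=
    hcx.eventually (gt_mem_nhds (by simp only [← hF0]; exact hmono h0m ⟨by linarith, le_rfl⟩ hδ))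
  filter_upwards [e1, e2, hU] with x hx1 hx2 hxU
  have hxs := hUs hxU
  obtain ⟨τ, hτ, hτx⟩ := intermediate_value_Icc (by linarith) hFc ⟨hx1.le, hx2.le⟩
  have hZx : Z τ = φ x := firstCoord_injective hn (mul_left_cancel₀ hg₀ne hτx)
  have hz0 : 0 ≤ firstCoord n (φ z) := extChartAt_target_subset z (φ.map_source hzs)
  have hx0 : 0 ≤ firstCoord n (φ x) := extChartAt_target_subset z (φ.map_source hxs)
  refine ⟨τ, (abs_le.2 hτ).trans hδε, fun τ => φ.symm (Z τ),
    (hfl _ _ (min_le_left _ _) (le_max_left _ _)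
      (le_min (by linarith) (by linarith [hτ.1])) (max_le hε₀.le (by linarith [hτ.2]))).1
      fun σ hσ => ?_, ?_, ?_⟩
  · change 0 ≤ firstCoord n (Z σ)
    have hσm : σ ∈ Icc (-δ) δ := ⟨(le_min h0m.1 hτ.1).trans hσ.1, hσ.2.trans (max_le h0m.2 hτ.2)⟩
    have hle : min (F 0) (F τ) ≤ F σ ∧ F σ ≤ max (F 0) (F τ) := by
      have hm := hmono.monotoneOn
      rcases le_total 0 τ with h0 | h0
      · rw [min_eq_left h0, max_eq_right h0] at hσ
        exact ⟨min_le_of_left_le (hm h0m hσm hσ.1), le_max_of_le_right (hm hσm hτ hσ.2)⟩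
      · rw [min_eq_right h0, max_eq_left h0] at hσ
        exact ⟨min_le_of_right_le (hm hτ hσm hσ.1), le_max_of_le_left (hm hσm h0m hσ.2)⟩
    have hFσ : F σ = g₀ * firstCoord n (Z σ) := rfl
    rw [hF0, hτx] at hle
    rw [hFσ] at hle
    rcases hg₀ne.lt_or_gt with hneg | hpos'
    · have h1 : g₀ * firstCoord n (Z σ) ≤ 0 := hle.2.trans
        (max_le (mul_nonpos_of_nonpos_of_nonneg hneg.le hz0)
          (mul_nonpos_of_nonpos_of_nonneg hneg.le hx0))
      nlinarith
    · have h1 : 0 ≤ g₀ * firstCoord n (Z σ) := (le_min (mul_nonneg hpos'.le hz0)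
        (mul_nonneg hpos'.le hx0)).trans hle.1
      exact nonneg_of_mul_nonneg_right h1 hpos'
  · simp only [hZ0, φ.left_inv hzs]
  · simp only [hZx, φ.left_inv hxs]

section Complete

variable {β : ℝ → M} {J : Set ℝ}
  (hJ : ∀ t ∈ J, ∀ (s : ℝ) (η : ℝ → M), IsMIntegralCurveOn η L (Icc (min t s) (max t s)) →
    η t = β t → s ∈ J ∧ η s = β s)
include hJ

/-- The points near a point of an inextendible curve lie on that curve, at nearby times. -/
lemma eventually_mem_image_of_complete (hn : n = 1) {t : ℝ} (ht : t ∈ J) (hz : L (β t) ≠ 0) {ε : ℝ}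
    (hε : 0 < ε) : ∀ᶠ x in 𝓝 (β t), ∃ s ∈ J, |s - t| ≤ ε ∧ β s = x := by
  filter_upwards [eventually_mem_integralCurve hL hn hz hε] with x ⟨τ, hτ, η, hη, h0, hx⟩
  have h1 : IsMIntegralCurveOn (fun σ => η (σ + -t)) L (Icc (min t (t + τ)) (max t (t + τ))) := by
    refine IsMIntegralCurveOn.shift (-t) ?_
    rwa [← min_add_add_right, ← max_add_add_right, add_neg_cancel, add_comm t, add_neg_cancel_right]
  obtain ⟨h2, h3⟩ := hJ t ht (t + τ) _ h1 (by simpa using h0)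
  refine ⟨t + τ, h2, by rwa [add_sub_cancel_left], ?_⟩
  rw [← h3, ← hx]
  simp

lemma isClopen_image_of_complete (hn : n = 1) (hne : ∀ x, L x ≠ 0) : IsClopen (β '' J) := by
  refine ⟨isClosed_of_closure_subset fun z hz => ?_, isOpen_iff_mem_nhds.2 ?_⟩
  · obtain ⟨-, ⟨t, ht, rfl⟩, τ, -, η, hη, h0, hx⟩ :=
      ((mem_closure_iff_frequently.1 hz).and_eventually
        (eventually_mem_integralCurve hL hn (hne z) one_pos)).exists
    have h1 : IsMIntegralCurveOn (fun σ => η (σ + (τ - t))) L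
        (Icc (min t (t - τ)) (max t (t - τ))) := by
      refine IsMIntegralCurveOn.shift (τ - t) ?_
      rw [← min_add_add_right, ← max_add_add_right, add_sub_cancel]
      rw [show t - τ + (τ - t) = 0 by ring, min_comm, max_comm]
      exact hη
    obtain ⟨h2, h3⟩ := hJ t ht (t - τ) _ h1 (by simpa using hx)
    refine ⟨t - τ, h2, ?_⟩
    rw [← h3, ← h0]
    simp
  · rintro - ⟨t, ht, rfl⟩
    filter_upwards [eventually_mem_image_of_complete hL hJ hn ht (hne _) one_pos]
      with x ⟨s, hs, _, hx⟩ using ⟨s, hs, hx⟩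

end Complete

omit [T2Space M] in
/-- The end point of a maximal integral curve lies on the boundary. -/
lemma IsMaximalIntegralCurve.apply_end_mem_boundary [T2Space M] {x : ℝ → M} {T : ℝ}
    (h : IsMaximalIntegralCurve L x T) : x T ∈ (𝓡∂ n).boundary M := by
  by_contra hb
  obtain ⟨ε, hε, β, hβ, hβ0⟩ := exists_integralCurve_of_notMem_boundary hL hb
  have h1 : IsMIntegralCurveOn (fun t => β (t + -T)) L (Icc T (T + ε)) := by
    refine IsMIntegralCurveOn.shift (-T) ?_
    rw [add_neg_cancel, add_comm T, add_neg_cancel_right]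
    exact hβ.mono (Icc_subset_Icc_left (by linarith))
  obtain ⟨γ, hγ, he, -⟩ := exists_concat_integralCurve h.1 (by linarith) h.curve h1
    (by simp [hβ0])
  have := (h.2.2 0 (T + ε) γ le_rfl (by linarith) hγ he).2
  linarith

lemma IsMaximalIntegralCurve.complete {x : ℝ → M} {T : ℝ} (h : IsMaximalIntegralCurve L x T) :
    ∀ t ∈ Icc 0 T, ∀ (s : ℝ) (η : ℝ → M), IsMIntegralCurveOn η L (Icc (min t s) (max t s)) →
      η t = x t → s ∈ Icc 0 T ∧ η s = x s := by
  intro t ht s η hη he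
  suffices hs : s ∈ Icc 0 T by
    refine ⟨hs, eqOn_of_isMIntegralCurveOn hL hη (h.curve.mono (Icc_subset_Icc (le_min ht.1 hs.1)
      (max_le ht.2 hs.2))) ⟨min_le_left _ _, le_max_left _ _⟩ he ⟨min_le_right _ _,
        le_max_right _ _⟩⟩
  constructor
  · by_contra! hs
    have hst : s ≤ t := hs.le.trans ht.1
    rw [min_eq_right hst, max_eq_left hst] at hη
    obtain ⟨κ, hκ, -, e2⟩ := exists_concat_integralCurve hst ht.2 hη
      (h.curve.mono (Icc_subset_Icc_left ht.1)) he
    have e3 := eqOn_of_isMIntegralCurveOn hL (hκ.mono (Icc_subset_Icc_left hs.le)) h.curve ht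
      (e2 ⟨le_rfl, ht.2⟩)
    exact hs.ne (h.2.2 s T κ hs.le le_rfl hκ e3).1
  · by_contra! hs
    have hst : t ≤ s := ht.2.trans hs.le
    rw [min_eq_left hst, max_eq_right hst] at hη
    obtain ⟨κ, hκ, e1, -⟩ := exists_concat_integralCurve ht.1 hst
      (h.curve.mono (Icc_subset_Icc_right ht.2)) hη he.symm
    have e3 := eqOn_of_isMIntegralCurveOn hL (hκ.mono (Icc_subset_Icc_right hs.le)) h.curve ht
      (e1 ⟨ht.1, le_rfl⟩)
    exact hs.ne' (h.2.2 0 s κ le_rfl hs.le hκ e3).2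

omit [T2Space M] hL in
/-- In dimension one maximal integral curves with the same initial point have the same image, and
hence the same end points. -/
lemma IsMaximalIntegralCurve.apply_end_eq_of_dim_one [T2Space M] [CompactSpace M]
    {L₁ L₂ : (x : M) → TangentSpace (𝓡∂ n) x}
    (hL₁ : ContMDiff (𝓡∂ n) (𝓡∂ n).tangent ∞ (fun x => (⟨x, L₁ x⟩ : TangentBundle (𝓡∂ n) M)))
    (hL₂ : ContMDiff (𝓡∂ n) (𝓡∂ n).tangent ∞ (fun x => (⟨x, L₂ x⟩ : TangentBundle (𝓡∂ n) M)))
    (hn : n = 1) (hconv₁ : IsStrictlyConvex L₁) (hconv₂ : IsStrictlyConvex L₂)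
    (hne : ∀ x, L₁ x ≠ 0) {x₁ x₂ : ℝ → M} {T₁ T₂ : ℝ} (h₁ : IsMaximalIntegralCurve L₁ x₁ T₁)
    (h₂ : IsMaximalIntegralCurve L₂ x₂ T₂) (h0 : x₁ 0 = x₂ 0) (hT₂ : 0 < T₂) : x₁ T₁ = x₂ T₂ := by
  have hsub : x₂ '' Icc 0 T₂ ⊆ x₁ '' Icc 0 T₁ :=
    (isPreconnected_Icc.image _ h₂.curve.continuousOn).subset_isClopen
      (isClopen_image_of_complete hL₁ (h₁.complete hL₁) hn hne)
      ⟨x₂ 0, ⟨0, ⟨le_rfl, h₂.1⟩, rfl⟩, ⟨0, ⟨le_rfl, h₁.1⟩, h0⟩⟩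
  have hbd := h₂.apply_end_mem_boundary hL₂
  obtain ⟨t, ht, hte⟩ := hsub ⟨T₂, ⟨h₂.1, le_rfl⟩, rfl⟩
  rcases ht.2.eq_or_lt with h | hlt
  · rw [← h, hte]
  · exfalso
    rcases ht.1.eq_or_lt with h | hlt'
    · -- The field `L₂` would point inwards and outwards at the common initial and end point.
      rw [← h, h0] at hte
      have e1 := (transversal_of_integralCurve hL₂ hconv₂ h₂.curve ⟨le_rfl, h₂.1⟩
        (by rw [hte]; exact hbd) (mem_extChartAt_source (x₂ 0))).1 hT₂
      have e2 := (transversal_of_integralCurve hL₂ hconv₂ h₂.curve ⟨h₂.1, le_rfl⟩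
        hbd (c := x₂ 0) (by rw [← hte]; exact mem_extChartAt_source (x₂ 0))).2 hT₂
      rw [← hte] at e2
      exact e1.not_gt e2
    · refine notMem_boundary_of_integralCurve hL₁ hconv₁ h₁.curve ⟨hlt', hlt⟩ ?_
      rwa [hte]

omit [IsManifold (𝓡∂ n) ∞ M] [T2Space M] hL in
lemma not_bddAbove_iff_forall_mem {x : M} :
    ¬BddAbove (backwardTimes L x) ↔ ∀ t, 0 ≤ t → t ∈ backwardTimes L x := by
  constructor
  · intro h t ht
    obtain ⟨s, hs, hts⟩ := not_bddAbove_iff.1 h t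
    exact backwardTimes_of_le hs ht hts.le
  · rintro h ⟨b, hb⟩
    have := hb (h (max 0 b + 1) (by positivity))
    linarith [le_max_right 0 b]

lemma eventually_not_bddAbove_backwardTimes (hn : n = 1) {x : M} (hx : L x ≠ 0)
    (h : ¬BddAbove (backwardTimes L x)) :
    ∀ᶠ x' in 𝓝 x, ¬BddAbove (backwardTimes L x') := by
  rw [not_bddAbove_iff_forall_mem] at h
  filter_upwards [eventually_mem_integralCurve hL hn hx one_pos] with x' ⟨τ, _, η, hη, h0, hx'⟩
  rw [not_bddAbove_iff_forall_mem]
  intro t ht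
  rcases le_total 0 τ with hτ | hτ
  · rw [min_eq_left hτ, max_eq_right hτ] at hη
    have := add_mem_backwardTimes hτ hη (t := t) (by rw [h0]; exact h t ht)
    rw [hx'] at this
    exact backwardTimes_of_le this ht (by linarith)
  · rw [min_eq_right hτ, max_eq_left hτ] at hη
    have := sub_mem_backwardTimes hL hτ hη (t := t + (0 - τ))
      (by rw [h0]; exact h _ (by linarith)) (by linarith)
    rwa [hx', add_sub_cancel_right] at this

/-- In dimension one the backward integral curve from a boundary point leaves the manifold: as its
image is compact and open, it would otherwise be periodic, and return to the boundary. -/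
lemma bddAbove_backwardTimes_of_mem_boundary [CompactSpace M] (hn : n = 1)
    (hconv : IsStrictlyConvex L) (hne : ∀ x, L x ≠ 0) {x : M} (hx : x ∈ (𝓡∂ n).boundary M) :
    BddAbove (backwardTimes L x) := by
  by_contra hb
  rw [not_bddAbove_iff_forall_mem] at hb
  choose γ hγ hγ0 using fun k : ℕ => (hb k k.cast_nonneg).2
  let β : ℝ → M := fun t => γ ⌈-t⌉₊ t
  have hβγ : ∀ k : ℕ, EqOn β (γ k) (Icc (-k) 0) := by
    intro k t ht
    have h1 : ⌈-t⌉₊ ≤ k := Nat.ceil_le.2 (by linarith [ht.1])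
    have h2 : -((⌈-t⌉₊ : ℕ) : ℝ) ≤ t := by linarith [Nat.le_ceil (-t)]
    exact eqOn_of_isMIntegralCurveOn hL (hγ _) ((hγ k).mono (Icc_subset_Icc_left
      (neg_le_neg (by exact_mod_cast h1)))) (τ₀ := 0) ⟨by simp, le_rfl⟩ ((hγ0 _).trans (hγ0 k).symm)
      ⟨h2, ht.2⟩
  have hβ : ∀ s t, t ≤ 0 → IsMIntegralCurveOn β L (Icc s t) := by
    intro s t ht
    refine (IsMIntegralCurveOn.congr_of_eqOn (hγ ⌈-s⌉₊) (hβγ _)).mono (Icc_subset_Icc ?_ ht)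
    linarith [Nat.le_ceil (-s)]
  have hβ0 : β 0 = x := (hβγ 0 ⟨by simp, le_rfl⟩).trans (hγ0 0)
  have hJ : ∀ t ∈ Iic (0 : ℝ), ∀ (s : ℝ) (η : ℝ → M),
      IsMIntegralCurveOn η L (Icc (min t s) (max t s)) → η t = β t → s ∈ Iic (0 : ℝ) ∧ η s = β s := by
    intro t ht s η hη he
    have ht' : t ≤ 0 := ht
    suffices hs : s ≤ 0 by
      exact ⟨hs, eqOn_of_isMIntegralCurveOn hL hη (hβ _ _ (max_le ht' hs)) ⟨min_le_left _ _,
        le_max_left _ _⟩ he ⟨min_le_right _ _, le_max_right _ _⟩⟩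
    by_contra! hs
    have hst : t ≤ s := ht'.trans hs.le
    rw [min_eq_left hst, max_eq_right hst] at hη
    obtain ⟨κ, hκ, e1, -⟩ := exists_concat_integralCurve (sub_one_lt t).le hst (hβ (t - 1) t ht')
      hη he.symm
    have e3 := eqOn_of_isMIntegralCurveOn hL (hκ.mono (Icc_subset_Icc_right hs.le))
      (hβ (t - 1) 0 le_rfl) (τ₀ := t) ⟨by linarith, ht'⟩ (e1 ⟨by linarith, le_rfl⟩)
    refine notMem_boundary_of_integralCurve hL hconv hκ (t₀ := 0) ⟨by linarith, hs⟩ ?_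
    rwa [e3 ⟨by linarith, le_rfl⟩, hβ0]
  have hS : IsCompact (β '' Iic 0) := (isClopen_image_of_complete hL hJ hn hne).1.isCompact
  have hopen : ∀ k : ℕ, IsOpen (β '' Ioc (-(k : ℝ)) 0) := by
    refine fun k => isOpen_iff_mem_nhds.2 ?_
    rintro - ⟨t, ht, rfl⟩
    filter_upwards [eventually_mem_image_of_complete hL hJ hn ht.2 (hne _)
      (half_pos (show 0 < t + k by linarith [ht.1]))] with y ⟨s, hs, hst, hy⟩
    exact ⟨s, ⟨by linarith [(abs_le.1 hst).1, ht.1], hs⟩, hy⟩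
  have hcover : β '' Iic 0 ⊆ ⋃ k : ℕ, β '' Ioc (-(k : ℝ)) 0 := by
    rintro - ⟨t, ht, rfl⟩
    obtain ⟨k, hk⟩ := exists_nat_gt (-t)
    exact mem_iUnion.2 ⟨k, t, ⟨by linarith, ht⟩, rfl⟩
  have hmono : Monotone fun k : ℕ => β '' Ioc (-(k : ℝ)) 0 :=
    fun k l hkl => image_mono (Ioc_subset_Ioc_left (neg_le_neg (by exact_mod_cast hkl)))
  obtain ⟨k, hk⟩ := hS.elim_directed_cover _ hopen hcover hmono.directed_le
  -- The point at time `-k` is visited again at a later time `t`.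
  obtain ⟨t, ht, hte⟩ := hk ⟨-k, show -(k : ℝ) ≤ 0 by simp, rfl⟩
  have h1 : IsMIntegralCurveOn (fun σ => β (σ + (-k - t))) L (Icc t 0) := by
    refine IsMIntegralCurveOn.shift _ (hβ _ _ ?_)
    linarith [ht.1]
  have h2 := eqOn_of_isMIntegralCurveOn hL h1 (hβ t 0 le_rfl) ⟨le_rfl, ht.2⟩
    (by simp only [add_sub_cancel, hte]) ⟨ht.2, le_rfl⟩
  simp only [zero_add] at h2
  refine notMem_boundary_of_integralCurve hL hconv (hβ (-k - t - 1) 0 le_rfl) (t₀ := -k - t)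
    ⟨by linarith, by linarith [ht.1]⟩ ?_
  rwa [h2, hβ0]

end OneDimensional

/-! ### The solution of the transport equation with given incoming boundary values -/

section Transport

variable {n : ℕ} [NeZero n] {M : Type*} [TopologicalSpace M]
  [ChartedSpace (EuclideanHalfSpace n) M] {L : (x : M) → TangentSpace (𝓡∂ n) x} {V f : M → ℂ}

open Classical in
/-- The solution `u` of `L u = -i V u` which agrees with `f` at the points where the integral curves
of `L` enter `M`. It is set to zero at the points whose backward integral curve never leaves `M`. -/
noncomputable def transport (L : (x : M) → TangentSpace (𝓡∂ n) x) (V f : M → ℂ) (x : M) : ℂ :=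
  if h : ∃ q : ℝ × (ℝ → M), IsEntryCurve L x q.1 q.2 then
    Complex.exp (-Complex.I * ∫ t in (-h.choose.1)..0, V (h.choose.2 t)) *
      f (h.choose.2 (-h.choose.1))
  else 0

lemma IsEntryCurve.bddAbove {x : M} {γ : ℝ → M} {T : ℝ} (h : IsEntryCurve L x T γ) :
    BddAbove (backwardTimes L x) := ⟨T, h.le⟩

lemma transport_eq_zero {x : M} (h : ¬BddAbove (backwardTimes L x)) : transport L V f x = 0 :=
  dif_neg fun ⟨_, hq⟩ => h hq.bddAbove

variable [IsManifold (𝓡∂ n) ∞ M] [T2Space M]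
  (hL : ContMDiff (𝓡∂ n) (𝓡∂ n).tangent ∞ (fun x => (⟨x, L x⟩ : TangentBundle (𝓡∂ n) M)))
include hL

lemma IsEntryCurve.transport_eq {x : M} {γ : ℝ → M} {T : ℝ} (h : IsEntryCurve L x T γ) :
    transport L V f x = Complex.exp (-Complex.I * ∫ t in (-T)..0, V (γ t)) * f (γ (-T)) := by
  have hex : ∃ q : ℝ × (ℝ → M), IsEntryCurve L x q.1 q.2 := ⟨(T, γ), h⟩
  have h' := hex.choose_spec
  have hT : hex.choose.1 = T := le_antisymm (h.le _ ⟨h'.nonneg, _, h'.curve, h'.apply_zero⟩)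
    (h'.le _ ⟨h.nonneg, _, h.curve, h.apply_zero⟩)
  have hγ' := h'.curve
  rw [hT] at hγ'
  have hle : -T ≤ 0 := by linarith [h.nonneg]
  have he := eqOn_of_isMIntegralCurveOn hL hγ' h.curve ⟨hle, le_rfl⟩
    (h'.apply_zero.trans h.apply_zero.symm)
  refine (dif_pos hex).trans ?_
  rw [hT, he ⟨le_rfl, hle⟩]
  congr 3
  refine intervalIntegral.integral_congr fun t ht => ?_
  rw [uIcc_of_le hle] at ht
  simp only [he ht]

/-- `transport L V f` solves the transport equation along every integral curve. -/
theorem hasDerivWithinAt_transport [CompactSpace M] (hV : Continuous V) {η : ℝ → M} {s t τ : ℝ}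
    (hη : IsMIntegralCurveOn η L (Icc s t)) (hτ : τ ∈ Icc s t) :
    HasDerivWithinAt (fun σ => transport L V f (η σ))
      (-Complex.I * V (η τ) * transport L V f (η τ)) (Icc s t) τ := by
  have hst : s ≤ t := hτ.1.trans hτ.2
  by_cases hb : BddAbove (backwardTimes L (η s))
  · obtain ⟨T, γ, h⟩ := exists_isEntryCurve hL hb
    have hT := h.nonneg
    -- The curve `η`, continued backwards to the boundary.
    have h1 : IsMIntegralCurveOn (fun σ => γ (σ + -s)) L (Icc (s - T) s) := by
      refine IsMIntegralCurveOn.shift (-s) ?_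
      rw [add_neg_cancel, show s - T + -s = -T by ring]
      exact h.curve
    obtain ⟨κ, hκ, -, e2⟩ := exists_concat_integralCurve (by linarith) hst h1 hη
      (by simp only [add_neg_cancel, h.apply_zero])
    have hu : ∀ σ ∈ Icc s t, transport L V f (η σ) =
        Complex.exp (-Complex.I * ∫ r in (s - T)..σ, V (κ r)) * f (κ (s - T)) := by
      intro σ hσ
      have hE : IsEntryCurve L (η σ) (T + (σ - s)) (fun r => κ (r + σ)) := by
        refine ⟨by linarith [hσ.1], IsMIntegralCurveOn.shift σ (hκ.mono (Icc_subset_Icc ?_ ?_)), ?_,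
          fun r hr => ?_⟩
        · linarith
        · linarith [hσ.2]
        · simp only [zero_add, e2 hσ]
        · by_cases hrs : σ - s ≤ r
          · have := h.le _ (sub_mem_backwardTimes hL hσ.1 (hη.mono (Icc_subset_Icc_right hσ.2))
              hr hrs)
            linarith
          · linarith
      rw [hE.transport_eq hL, intervalIntegral.integral_comp_add_right (fun r => V (κ r))]
      simp only [show -(T + (σ - s)) + σ = s - T by ring, zero_add]
    have hVκ : ContinuousOn (fun r => V (κ r)) (Icc (s - T) t) :=
      hV.comp_continuousOn hκ.continuousOn
    have hτ' : τ ∈ Icc (s - T) t := ⟨by linarith [hτ.1], hτ.2⟩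
    have hI : HasDerivWithinAt (fun σ => ∫ r in (s - T)..σ, V (κ r)) (V (κ τ)) (Icc (s - T) t) τ := by
      have : Fact (τ ∈ Icc (s - T) t) := ⟨hτ'⟩
      refine intervalIntegral.integral_hasDerivWithinAt_right ?_
        (hVκ.stronglyMeasurableAtFilter_nhdsWithin measurableSet_Icc τ) (hVκ τ hτ')
      refine (hVκ.mono ?_).intervalIntegrable
      rw [uIcc_of_le hτ'.1]
      exact Icc_subset_Icc_right hτ.2
    have hd := ((hI.mono (Icc_subset_Icc_left (show s - T ≤ s by linarith))).const_mul
      (-Complex.I)).cexp.mul_const (f (κ (s - T)))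
    refine (hd.congr_deriv ?_).congr_of_mem hu hτ
    rw [hu τ hτ, e2 hτ]
    ring
  · have hu : ∀ σ ∈ Icc s t, transport L V f (η σ) = 0 := by
      refine fun σ hσ => transport_eq_zero ?_
      rw [not_bddAbove_iff_forall_mem] at hb ⊢
      intro r hr
      exact backwardTimes_of_le (add_mem_backwardTimes hσ.1 (hη.mono (Icc_subset_Icc_right hσ.2))
        (hb r hr)) hr (by linarith [hσ.1])
    rw [hu τ hτ, mul_zero]
    exact (hasDerivWithinAt_const _ _ 0).congr_of_mem hu hτ

end Transport

/-! ### Smoothness of the solution -/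

section Smoothness

variable {n : ℕ} [NeZero n] {M : Type*} [TopologicalSpace M]
  [ChartedSpace (EuclideanHalfSpace n) M] [IsManifold (𝓡∂ n) ∞ M]
  {L : (x : M) → TangentSpace (𝓡∂ n) x} {V f u w : M → ℂ}

/-- The coefficient of the homogeneous transport equation in the chart centred at `c`. -/
noncomputable def chartCoeff (V : M → ℂ) (c : M) (y : EuclideanSpace ℝ (Fin n)) : ℂ :=
  -Complex.I * V ((extChartAt (𝓡∂ n) c).symm y)

/-- The right hand side of the transport equation for `u - f`, when `L u = -i V u`, in the chart
centred at `c`. -/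
noncomputable def chartSource (L : (x : M) → TangentSpace (𝓡∂ n) x) (V f : M → ℂ) (c : M)
    (y : EuclideanSpace ℝ (Fin n)) : ℂ :=
  chartCoeff V c y * f ((extChartAt (𝓡∂ n) c).symm y) -
    fderivWithin ℝ (fun y => f ((extChartAt (𝓡∂ n) c).symm y)) (halfSpace (firstCoord n)) y
      (chartField L c y)

lemma contDiffOn_chartCoeff (hV : ContMDiff (𝓡∂ n) 𝓘(ℝ, ℂ) ∞ V) (c : M) :
    ContDiffOn ℝ ∞ (chartCoeff V c) (extChartAt (𝓡∂ n) c).target :=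
  contDiffOn_const.mul (contDiffOn_chart hV c)

lemma contDiffOn_chart_lieDeriv
    (hL : ContMDiff (𝓡∂ n) (𝓡∂ n).tangent ∞ (fun x => (⟨x, L x⟩ : TangentBundle (𝓡∂ n) M)))
    (hf : ContMDiff (𝓡∂ n) 𝓘(ℝ, ℂ) ∞ f) (c : M) :
    ContDiffOn ℝ ∞ (fun y => fderivWithin ℝ (fun y => f ((extChartAt (𝓡∂ n) c).symm y))
      (halfSpace (firstCoord n)) y (chartField L c y)) (extChartAt (𝓡∂ n) c).target := by
  intro y hy
  have h1 : ContDiffWithinAt ℝ ∞ (fun y => f ((extChartAt (𝓡∂ n) c).symm y))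
      (halfSpace (firstCoord n)) y :=
    (contDiffOn_chart hf c y hy).mono_of_mem_nhdsWithin (extChartAt_target_mem hy)
  have h2 := h1.fderivWithin_right (m := ((⊤ : ℕ∞) : WithTop ℕ∞))
    (uniqueDiffOn_halfSpace (firstCoord_inwardVector (n := n))) le_rfl
    (extChartAt_target_subset c hy)
  exact (h2.mono (extChartAt_target_subset c)).clm_apply (contDiffOn_chartField hL c y hy)

lemma contDiffOn_chartSource
    (hL : ContMDiff (𝓡∂ n) (𝓡∂ n).tangent ∞ (fun x => (⟨x, L x⟩ : TangentBundle (𝓡∂ n) M)))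
    (hV : ContMDiff (𝓡∂ n) 𝓘(ℝ, ℂ) ∞ V) (hf : ContMDiff (𝓡∂ n) 𝓘(ℝ, ℂ) ∞ f) (c : M) :
    ContDiffOn ℝ ∞ (chartSource L V f c) (extChartAt (𝓡∂ n) c).target :=
  ((contDiffOn_chartCoeff hV c).mul (contDiffOn_chart hf c)).sub
    (contDiffOn_chart_lieDeriv hL hf c)

/-- The difference of a solution along the integral curves and a smooth function solves an
inhomogeneous transport equation along the integral curves. -/
lemma hasDerivWithinAt_sub_smooth (hf : ContMDiff (𝓡∂ n) 𝓘(ℝ, ℂ) ∞ f) {η : ℝ → M} {J : Set ℝ}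
    {τ : ℝ} (hη : IsMIntegralCurveOn η L J) (hτ : τ ∈ J) {c : M}
    (hc : η τ ∈ (extChartAt (𝓡∂ n) c).source)
    (hu : HasDerivWithinAt (fun σ => u (η σ)) (-Complex.I * V (η τ) * u (η τ)) J τ) :
    HasDerivWithinAt (fun σ => u (η σ) - f (η σ))
      (chartCoeff V c (extChartAt (𝓡∂ n) c (η τ)) * (u (η τ) - f (η τ)) +
        chartSource L V f c (extChartAt (𝓡∂ n) c (η τ))) J τ := by
  have hfd : MDifferentiableAt (𝓡∂ n) 𝓘(ℝ, ℂ) f (η τ) := (hf (η τ)).mdifferentiableAt (by simp)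
  refine (hu.sub (hasDerivWithinAt_comp_curve hη hτ hfd)).congr_deriv ?_
  unfold chartSource chartCoeff
  rw [fderivWithin_chartField L hc hfd, (extChartAt (𝓡∂ n) c).left_inv hc]
  ring

/-- A function on `M` which solves `w' = a w + b` along the integral curves of `L` has the same
property in a chart. -/
lemma isTransported_chart {c : M} {a b : EuclideanSpace ℝ (Fin n) → ℂ}
    (hw : ∀ (s t τ : ℝ) (η : ℝ → M), IsMIntegralCurveOn η L (Icc s t) → τ ∈ Icc s t →
      η τ ∈ (extChartAt (𝓡∂ n) c).source → HasDerivWithinAt (fun σ => w (η σ))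
        (a (extChartAt (𝓡∂ n) c (η τ)) * w (η τ) + b (extChartAt (𝓡∂ n) c (η τ))) (Icc s t) τ) :
    IsTransported (extChartAt (𝓡∂ n) c).target (chartField L c) a b
      (fun y => w ((extChartAt (𝓡∂ n) c).symm y)) := by
  intro s t Y hY hYt τ hτ
  set φ := extChartAt (𝓡∂ n) c with hφ
  have hη : IsMIntegralCurveOn (fun σ => φ.symm (Y σ)) L (Icc s t) := by
    intro σ hσ
    have hcont : ContinuousWithinAt (fun σ => φ.symm (Y σ)) (Icc s t) σ :=
      (continuousOn_extChartAt_symm c (Y σ) (hYt σ hσ)).comp (hY.continuousOn σ hσ) hYt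
    refine hasMFDerivWithinAt_of_chart (c := c) hcont (φ.map_target (hYt σ hσ)) ?_
    simp only [← hφ]
    rw [φ.right_inv (hYt σ hσ)]
    exact (hY σ hσ).congr_of_mem (fun r hr => φ.right_inv (hYt r hr)) hσ
  have h1 := hw s t τ _ hη hτ (φ.map_target (hYt τ hτ))
  rwa [φ.right_inv (hYt τ hτ)] at h1

end Smoothness

section Smooth

variable {n : ℕ} [NeZero n] {M : Type*} [TopologicalSpace M]
  [ChartedSpace (EuclideanHalfSpace n) M]

/-- The function `u` solves `L u = -i V u` along the integral curves of `L`, agrees with `f` on the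
boundary, and vanishes near the points whose backward integral curve never leaves `M`. -/
structure IsBoundarySolution (L : (x : M) → TangentSpace (𝓡∂ n) x) (V f u : M → ℂ) : Prop where
  along_curves : ∀ (s t τ : ℝ) (η : ℝ → M), IsMIntegralCurveOn η L (Icc s t) → τ ∈ Icc s t →
    HasDerivWithinAt (fun σ => u (η σ)) (-Complex.I * V (η τ) * u (η τ)) (Icc s t) τ
  boundary : ∀ x ∈ (𝓡∂ n).boundary M, u x = f x
  trapped : ∀ x, ¬BddAbove (backwardTimes L x) → ∀ᶠ y in 𝓝 x, u y = 0

variable [IsManifold (𝓡∂ n) ∞ M] {L : (x : M) → TangentSpace (𝓡∂ n) x} {V f u : M → ℂ}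
  (hu : IsBoundarySolution L V f u) (hf : ContMDiff (𝓡∂ n) 𝓘(ℝ, ℂ) ∞ f)
include hu

lemma IsBoundarySolution.sub_eq_zero_of_chart {c : M} {y : EuclideanSpace ℝ (Fin n)}
    (hy : y ∈ (extChartAt (𝓡∂ n) c).target) (h0 : firstCoord n y = 0) :
    u ((extChartAt (𝓡∂ n) c).symm y) - f ((extChartAt (𝓡∂ n) c).symm y) = 0 := by
  refine sub_eq_zero.2 (hu.boundary _ ?_)
  rwa [mem_boundary_iff ((extChartAt (𝓡∂ n) c).map_target hy), (extChartAt (𝓡∂ n) c).right_inv hy]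

include hf

lemma IsBoundarySolution.isTransported (c : M) :
    IsTransported (extChartAt (𝓡∂ n) c).target (chartField L c) (chartCoeff V c)
      (chartSource L V f c)
      (fun y => u ((extChartAt (𝓡∂ n) c).symm y) - f ((extChartAt (𝓡∂ n) c).symm y)) :=
  isTransported_chart (w := fun x => u x - f x) fun s t τ η hη hτ hc =>
    hasDerivWithinAt_sub_smooth hf hη hτ hc (hu.along_curves s t τ η hη hτ)

variable (hV : ContMDiff (𝓡∂ n) 𝓘(ℝ, ℂ) ∞ V)
  (hL : ContMDiff (𝓡∂ n) (𝓡∂ n).tangent ∞ (fun x => (⟨x, L x⟩ : TangentBundle (𝓡∂ n) M)))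
include hV hL

lemma IsBoundarySolution.contMDiffAt_of_transversal {c x : M}
    (hc : x ∈ (extChartAt (𝓡∂ n) c).source) (hx : x ∈ (𝓡∂ n).boundary M)
    (htr : firstCoord n (chartField L c (extChartAt (𝓡∂ n) c x)) ≠ 0) {k : ℕ} (hk : k ≠ 0) :
    ContMDiffAt (𝓡∂ n) 𝓘(ℝ, ℂ) k (fun x => u x - f x) x := by
  rw [contMDiffAt_iff_chart (by exact_mod_cast le_top) hc]
  have ht := (extChartAt (𝓡∂ n) c).map_source hc
  have hk' : (k : WithTop ℕ∞) ≤ ((⊤ : ℕ∞) : WithTop ℕ∞) := by exact_mod_cast le_top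
  have hmem := extChartAt_target_mem ht
  exact IsTransported.contDiffWithinAt_of_transversal (firstCoord_inwardVector (n := n))
    ((mem_boundary_iff hc).1 hx) hk
    (((contDiffOn_chartField hL c _ ht).mono_of_mem_nhdsWithin hmem).of_le hk')
    (((contDiffOn_chartCoeff hV c _ ht).mono_of_mem_nhdsWithin hmem).of_le hk')
    (((contDiffOn_chartSource hL hV hf c _ ht).mono_of_mem_nhdsWithin hmem).of_le hk')
    hmem (hu.isTransported hf c) (fun y hy h0 => hu.sub_eq_zero_of_chart hy h0) htr

/-- Smoothness propagates along integral curves in the interior. -/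
lemma IsBoundarySolution.contMDiffAt_propagate {γ : ℝ → M} {a b τ : ℝ}
    (hγ : IsMIntegralCurveOn γ L (Icc a b)) (hτ : τ ∈ Icc a b)
    (hint : γ τ ∉ (𝓡∂ n).boundary M) {k : ℕ} (hk : k ≠ 0) :
    ∀ᶠ p : ℝ × ℝ in 𝓝[Icc a b] τ ×ˢ 𝓝[Icc a b] τ,
      ContMDiffAt (𝓡∂ n) 𝓘(ℝ, ℂ) k (fun x => u x - f x) (γ p.1) →
      ContMDiffAt (𝓡∂ n) 𝓘(ℝ, ℂ) k (fun x => u x - f x) (γ p.2) := by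
  set c := γ τ with hc
  set φ := extChartAt (𝓡∂ n) c with hφ
  have hcs : c ∈ φ.source := mem_extChartAt_source c
  have hk' : (k : WithTop ℕ∞) ≤ ((⊤ : ℕ∞) : WithTop ℕ∞) := by exact_mod_cast le_top
  have ht := φ.map_source hcs
  have hpos : 0 < firstCoord n (φ c) := lt_of_le_of_ne (extChartAt_target_subset c ht)
    fun h0 => hint ((mem_boundary_iff hcs).2 h0.symm)
  have hmem := extChartAt_target_mem ht
  have hmem' : φ.target ∈ 𝓝 (φ c) := by
    rwa [nhdsWithin_eq_nhds.2 (halfSpace_mem_nhds hpos)] at hmem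
  -- Restrict to a time interval during which the curve stays in the interior of one chart.
  have hO : φ.source ∩ φ ⁻¹' {y | 0 < firstCoord n y} ∈ 𝓝 c :=
    inter_mem (extChartAt_source_mem_nhds _) ((continuousAt_extChartAt _).preimage_mem_nhds
      ((isOpen_lt continuous_const (firstCoord n).continuous).mem_nhds hpos))
  obtain ⟨δ, hδ, hδO⟩ := Metric.mem_nhdsWithin_iff.1 ((hγ τ hτ).1.eventually hO)
  set s := max a (τ - δ / 2) with hs
  set t := min b (τ + δ / 2) with ht'
  have hsub : Icc s t ⊆ Icc a b := Icc_subset_Icc (le_max_left _ _) (min_le_left _ _)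
  have hcO : ∀ σ ∈ Icc s t, γ σ ∈ φ.source ∧ 0 < firstCoord n (φ (γ σ)) := fun σ hσ => by
    refine hδO ⟨?_, hsub hσ⟩
    rw [Metric.mem_ball, Real.dist_eq, abs_lt]
    constructor
    · linarith [(le_max_right a (τ - δ / 2)).trans hσ.1]
    · linarith [hσ.2.trans (min_le_right b (τ + δ / 2))]
  have hτ' : τ ∈ Icc s t := ⟨max_le hτ.1 (by linarith), le_min hτ.2 (by linarith)⟩
  have hcurve : IsCurveOn (chartField L c) (fun σ => φ (γ σ)) s t :=
    isCurveOn_chart (hγ.mono hsub) fun σ hσ => (hcO σ hσ).1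
  obtain ⟨δ', hδ', hprop⟩ := IsTransported.contDiffAt_propagate (firstCoord_inwardVector (n := n))
    hpos hk (((contDiffOn_chartField hL c _ ht).mono_of_mem_nhdsWithin hmem).of_le hk')
    (((contDiffOn_chartCoeff hV c _ ht).mono_of_mem_nhdsWithin hmem).of_le hk')
    (((contDiffOn_chartSource hL hV hf c _ ht).mono_of_mem_nhdsWithin hmem).of_le hk')
    hmem' (hu.isTransported hf c) hτ' hcurve rfl
  have hiff : ∀ σ ∈ Icc s t, ContMDiffAt (𝓡∂ n) 𝓘(ℝ, ℂ) k (fun x => u x - f x) (γ σ) ↔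
      ContDiffAt ℝ k (fun y => u (φ.symm y) - f (φ.symm y)) (φ (γ σ)) := fun σ hσ => by
    rw [contMDiffAt_iff_chart hk' (hcO σ hσ).1]
    exact ⟨fun h => h.contDiffAt (halfSpace_mem_nhds (hcO σ hσ).2), fun h => h.contDiffWithinAt⟩
  have hev : ∀ᶠ σ in 𝓝[Icc a b] τ, σ ∈ Icc s t ∧ |σ - τ| < δ' := by
    filter_upwards [self_mem_nhdsWithin, mem_nhdsWithin_of_mem_nhds
      (Metric.ball_mem_nhds τ (half_pos hδ)), mem_nhdsWithin_of_mem_nhds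
      (Metric.ball_mem_nhds τ hδ')] with σ h1 h2 h3
    rw [Metric.mem_ball, Real.dist_eq] at h2 h3
    obtain ⟨h4, h5⟩ := abs_lt.1 h2
    exact ⟨⟨max_le h1.1 (by linarith), le_min h1.2 (by linarith)⟩, h3⟩
  filter_upwards [hev.prod_mk hev] with p hp h1
  rw [hiff _ hp.1.1] at h1
  rw [hiff _ hp.2.1]
  exact hprop _ hp.1.1 _ hp.2.1 hp.1.2 hp.2.2 h1

variable [T2Space M] [CompactSpace M] (hconv : IsStrictlyConvex L)
include hconv

/-- In the interior the solution is smooth, since it is smooth at the point where the integral curve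
enters. -/
lemma IsBoundarySolution.contMDiffAt_of_notMem_boundary {x : M} (hx : x ∉ (𝓡∂ n).boundary M) {k : ℕ}
    (hk : k ≠ 0) : ContMDiffAt (𝓡∂ n) 𝓘(ℝ, ℂ) k (fun x => u x - f x) x := by
  have hk' : (k : WithTop ℕ∞) ≤ ((⊤ : ℕ∞) : WithTop ℕ∞) := by exact_mod_cast le_top
  by_cases hb : BddAbove (backwardTimes L x)
  swap
  · refine (((hf x).neg).of_le hk').congr_of_eventuallyEq ?_
    filter_upwards [hu.trapped x hb] with y hy
    simp [hy]
  obtain ⟨T, γ, h⟩ := exists_isEntryCurve hL hb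
  have hbd := h.mem_boundary hL
  have hT : 0 < T := by
    refine lt_of_le_of_ne h.nonneg fun h0 => hx ?_
    rwa [← h0, neg_zero, h.apply_zero] at hbd
  have htr := (transversal_of_integralCurve hL hconv h.curve ⟨le_rfl, by linarith⟩ hbd
    (mem_extChartAt_source (γ (-T)))).1 (by linarith)
  have hstart := hu.contMDiffAt_of_transversal hf hV hL (mem_extChartAt_source (γ (-T))) hbd htr.ne'
    hk
  have hev : ∀ {y : M}, ContMDiffAt (𝓡∂ n) 𝓘(ℝ, ℂ) k (fun x => u x - f x) y →
      ∀ᶠ z in 𝓝 y, ContMDiffAt (𝓡∂ n) 𝓘(ℝ, ℂ) k (fun x => u x - f x) z := fun hy => by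
    have : IsManifold (𝓡∂ n) k M := IsManifold.of_le hk'
    exact (contMDiffAt_iff_contMDiffAt_nhds (by simp)).1 hy
  have := forall_mem_Icc_of_isOpen_isClosed
    (P := fun τ => ContMDiffAt (𝓡∂ n) 𝓘(ℝ, ℂ) k (fun x => u x - f x) (γ τ))
    (s := -T) (t := 0) ⟨le_rfl, by linarith⟩ hstart
    (fun τ hτ hP => (h.curve.continuousOn τ hτ).eventually (hev hP)) (fun τ hτ hP => ?_) 0
    ⟨by linarith, le_rfl⟩
  · simpa only [h.apply_zero] using this
  · rcases hτ.1.eq_or_lt with h1 | h1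
    · rw [← h1]; exact hstart
    · have hint : γ τ ∉ (𝓡∂ n).boundary M := by
        rcases hτ.2.eq_or_lt with h2 | h2
        · rwa [h2, h.apply_zero]
        · exact notMem_boundary_of_integralCurve hL hconv h.curve ⟨h1, h2⟩
      obtain ⟨σ, hσ1, hσ2⟩ := (hP.and_eventually (hu.contMDiffAt_propagate hf hV hL h.curve hτ hint
        hk).curry).exists
      exact (hσ2.self_of_nhdsWithin hτ) hσ1

/-- In the interior the solution satisfies the transport equation. -/
lemma IsBoundarySolution.fderiv_chart {c : M} {y : EuclideanSpace ℝ (Fin n)}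
    (hy : y ∈ (extChartAt (𝓡∂ n) c).target) (hpos : 0 < firstCoord n y) :
    fderiv ℝ (fun y => u ((extChartAt (𝓡∂ n) c).symm y) - f ((extChartAt (𝓡∂ n) c).symm y)) y
        (chartField L c y) =
      chartCoeff V c y *
        (u ((extChartAt (𝓡∂ n) c).symm y) - f ((extChartAt (𝓡∂ n) c).symm y)) +
      chartSource L V f c y := by
  set φ := extChartAt (𝓡∂ n) c with hφ
  set x := φ.symm y with hx
  have hxs : x ∈ φ.source := φ.map_target hy
  have hφx : φ x = y := φ.right_inv hy
  have hxb : x ∉ (𝓡∂ n).boundary M := by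
    rw [mem_boundary_iff hxs, ← hφ, hφx]
    exact hpos.ne'
  have hd : MDifferentiableAt (𝓡∂ n) 𝓘(ℝ, ℂ) (fun x => u x - f x) x :=
    (hu.contMDiffAt_of_notMem_boundary hf hV hL hconv hxb one_ne_zero).mdifferentiableAt (by simp)
  obtain ⟨ε, hε, γ, hγ, h0⟩ := exists_integralCurve_of_notMem_boundary hL hxb
  have h0m : (0 : ℝ) ∈ Icc (-ε) ε := ⟨by linarith, hε.le⟩
  have h1 := hasDerivWithinAt_comp_curve hγ h0m (by rw [h0]; exact hd)
  have h2 := hasDerivWithinAt_sub_smooth (c := c) hf hγ h0m (by rw [h0]; exact hxs)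
    (hu.along_curves _ _ _ γ hγ h0m)
  have h3 := (uniqueDiffOn_Icc (show -ε < ε by linarith) 0 h0m).eq_deriv _ h1 h2
  rw [h0, ← hφ, hφx] at h3
  have h4 := fderivWithin_chartField L hxs hd
  rw [← hφ, hφx, fderivWithin_of_mem_nhds (halfSpace_mem_nhds hpos)] at h4
  rw [← h3, ← h4]

/-- The solution is smooth up to the boundary, also at the glancing points. -/
theorem IsBoundarySolution.contMDiff : ContMDiff (𝓡∂ n) 𝓘(ℝ, ℂ) ∞ (fun x => u x - f x) := by
  have hkey : ∀ (x c : M), x ∈ (extChartAt (𝓡∂ n) c).source →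
      (x ∈ (𝓡∂ n).boundary M → firstCoord n (chartField L c (extChartAt (𝓡∂ n) c x)) ≠ 0) →
      ContMDiffAt (𝓡∂ n) 𝓘(ℝ, ℂ) ∞ (fun x => u x - f x) x := by
    intro x c hc htr
    have hk : ∀ k : ℕ, k ≠ 0 → ContMDiffAt (𝓡∂ n) 𝓘(ℝ, ℂ) k (fun x => u x - f x) x := by
      intro k hk
      by_cases hx : x ∈ (𝓡∂ n).boundary M
      · exact hu.contMDiffAt_of_transversal hf hV hL hc hx (htr hx) hk
      · exact hu.contMDiffAt_of_notMem_boundary hf hV hL hconv hx hk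
    exact contMDiffAt_infty.2 fun k =>
      (hk (k + 1) k.succ_ne_zero).of_le (by exact_mod_cast k.le_succ)
  intro x
  by_cases hgl : x ∈ (𝓡∂ n).boundary M →
    firstCoord n (chartField L x (extChartAt (𝓡∂ n) x x)) ≠ 0
  · exact hkey x x (mem_extChartAt_source x) hgl
  push Not at hgl
  obtain ⟨hxb, hgl⟩ := hgl
  set φ := extChartAt (𝓡∂ n) x with hφ
  have hxs : x ∈ φ.source := mem_extChartAt_source x
  have ht := φ.map_source hxs
  obtain ⟨r, hr, hrt⟩ := Metric.mem_nhdsWithin_iff.1 (extChartAt_target_mem ht)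
  have hsub : halfBall (firstCoord n) (φ x) r ⊆ φ.target := fun y hy => hrt ⟨hy.2, hy.1⟩
  have hsol : IsGlancingSolution (firstCoord n) (φ x) r (chartField L x)
      (fun q => chartCoeff V x q.1 * q.2 + chartSource L V f x q.1)
      (fun y => u (φ.symm y) - f (φ.symm y)) := by
    refine ⟨(contDiffOn_chartField hL x).mono hsub, ?_, fun y hy => ?_,
      fun y hy h0 => hu.sub_eq_zero_of_chart (hsub hy) h0, fun y hy hpos => ?_, fun y hy h0 h1 => ?_⟩
    · have hm : MapsTo (fun q : EuclideanSpace ℝ (Fin n) × ℂ => q.1)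
          (halfBall (firstCoord n) (φ x) r ×ˢ univ) φ.target := fun q hq => hsub hq.1
      exact (((contDiffOn_chartCoeff hV x).comp contDiffOn_fst hm).mul contDiffOn_snd).add
        ((contDiffOn_chartSource hL hV hf x).comp contDiffOn_fst hm)
    · have hyt := hsub hy.1
      have h1 := hkey (φ.symm y) x (φ.map_target hyt) fun hb => by
        rw [mem_boundary_iff (φ.map_target hyt)] at hb
        rw [← hφ, φ.right_inv hyt] at hb ⊢
        exact hy.2 hb
      rw [contMDiffAt_iff_chart le_rfl (φ.map_target hyt), ← hφ, φ.right_inv hyt] at h1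
      exact h1.mono fun z hz => hz.1.1
    · exact hu.fderiv_chart hf hV hL hconv (hsub ⟨hpos.le, hy⟩) hpos
    · have hyt := hsub hy
      have hb : φ.symm y ∈ (𝓡∂ n).boundary M := by
        rwa [mem_boundary_iff (φ.map_target hyt), ← hφ, φ.right_inv hyt]
      have h2 := hconv.chartField hL (c := x) (φ.map_target hyt) hb
        (by rw [← hφ, φ.right_inv hyt]; exact h1)
      rwa [← hφ, φ.right_inv hyt] at h2
  refine contMDiffAt_infty.2 fun k => ?_
  obtain ⟨r', hr', hk⟩ := hsol.exists_contDiffOn (firstCoord_inwardVector (n := n))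
    ((mem_boundary_iff hxs).1 hxb) hgl k hr
  rw [contMDiffAt_iff_chart (by exact_mod_cast le_top) hxs]
  have hm := Metric.mem_ball_self (x := φ x) hr'
  exact (hk (φ x) ⟨extChartAt_target_subset x ht, hm⟩).mono_of_mem_nhdsWithin
    (halfBall_mem_nhdsWithin hm)

/-- A smooth function which satisfies the transport equation in the interior satisfies it on the
boundary. -/
theorem IsBoundarySolution.lieDeriv_eq (x : M) :
    lieDeriv L (fun x => u x - f x + f x) x = -Complex.I * V x * u x := by
  have hw := hu.contMDiff hf hV hL hconv
  set φ := extChartAt (𝓡∂ n) x with hφ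
  have hxs : x ∈ φ.source := mem_extChartAt_source x
  have ht := φ.map_source hxs
  -- The transport equation in the chart, with coefficients that are continuous up to the boundary.
  set R : EuclideanSpace ℝ (Fin n) → ℂ := fun y =>
    fderivWithin ℝ (fun y => u (φ.symm y) - f (φ.symm y)) (halfSpace (firstCoord n)) y
      (chartField L x y) - (chartCoeff V x y * (u (φ.symm y) - f (φ.symm y)) +
        chartSource L V f x y) with hR
  have hRc : ContinuousWithinAt R (halfSpace (firstCoord n)) (φ x) :=
    (((contDiffOn_chart_lieDeriv hL hw x).sub (((contDiffOn_chartCoeff hV x).mul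
      (contDiffOn_chart hw x)).add (contDiffOn_chartSource hL hV hf x))).continuousOn _
        ht).mono_of_mem_nhdsWithin (extChartAt_target_mem ht)
  have hne : (𝓝[{y | 0 < firstCoord n y}] (φ x)).NeBot := by
    rw [← mem_closure_iff_nhdsWithin_neBot]
    exact closure_mono (fun z hz => hz.1) (mem_closure_interior_halfBall
      (firstCoord_inwardVector (n := n)) (r := 1)
      ⟨extChartAt_target_subset x ht, Metric.mem_ball_self one_pos⟩)
  have hle : 𝓝[{y | 0 < firstCoord n y}] (φ x) ≤ 𝓝[halfSpace (firstCoord n)] (φ x) :=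
    nhdsWithin_mono _ fun y hy => (show 0 < firstCoord n y from hy).le
  have h0 : R (φ x) = 0 := by
    refine tendsto_nhds_unique (hRc.tendsto.mono_left hle) (tendsto_const_nhds.congr' ?_)
    filter_upwards [hle (extChartAt_target_mem ht), self_mem_nhdsWithin] with y hy hpos
    have hpos' : 0 < firstCoord n y := hpos
    simp only [hR]
    rw [fderivWithin_of_mem_nhds (halfSpace_mem_nhds hpos'),
      hu.fderiv_chart hf hV hL hconv hy hpos', sub_self]
  have hwd : MDifferentiableAt (𝓡∂ n) 𝓘(ℝ, ℂ) (fun x => u x - f x) x :=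
    (hw x).mdifferentiableAt (by simp)
  have hfd : MDifferentiableAt (𝓡∂ n) 𝓘(ℝ, ℂ) f x := (hf x).mdifferentiableAt (by simp)
  have h1 := fderivWithin_chartField L hxs hwd
  have h2 := fderivWithin_chartField L hxs hfd
  have h3 : lieDeriv L (fun x => u x - f x + f x) x =
      lieDeriv L (fun x => u x - f x) x + lieDeriv L f x := by
    unfold lieDeriv
    exact DFunLike.congr_fun ((hwd.hasMFDerivAt.add hfd.hasMFDerivAt).mfderiv) (L x)
  simp only [hR, chartSource, chartCoeff] at h0
  rw [← hφ] at h1 h2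
  rw [h1, h2, φ.left_inv hxs] at h0
  rw [h3]
  linear_combination h0

end Smooth

/-! ### Equality of the Cauchy data -/

section CauchyData

lemma eq_exp_integral_mul {y v : ℝ → ℂ} {T : ℝ} (hT : 0 ≤ T) (hv : ContinuousOn v (Icc 0 T))
    (hy : ∀ t ∈ Icc 0 T, HasDerivWithinAt y (-Complex.I * v t * y t) (Icc 0 T) t) :
    y T = Complex.exp (-Complex.I * ∫ t in (0 : ℝ)..T, v t) * y 0 := by
  have hI : ∀ t ∈ Icc 0 T, HasDerivWithinAt (fun t => ∫ r in (0 : ℝ)..t, v r) (v t) (Icc 0 T) t := by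
    intro t ht
    have : Fact (t ∈ Icc 0 T) := ⟨ht⟩
    refine intervalIntegral.integral_hasDerivWithinAt_right ?_
      (hv.stronglyMeasurableAtFilter_nhdsWithin measurableSet_Icc t) (hv t ht)
    refine (hv.mono ?_).intervalIntegrable
    rw [uIcc_of_le ht.1]
    exact Icc_subset_Icc_right ht.2
  have hd : ∀ t ∈ Icc 0 T, HasDerivWithinAt
      (fun t => Complex.exp (Complex.I * ∫ r in (0 : ℝ)..t, v r) * y t) 0 (Icc 0 T) t := by
    intro t ht
    refine ((((hI t ht).const_mul Complex.I).cexp).mul (hy t ht)).congr_deriv ?_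
    ring
  have h1 := (convex_Icc 0 T).norm_image_sub_le_of_norm_hasDerivWithin_le hd (C := 0)
    (fun t _ => by simp) ⟨le_rfl, hT⟩ ⟨hT, le_rfl⟩
  rw [zero_mul, norm_le_zero_iff, sub_eq_zero] at h1
  simp only [intervalIntegral.integral_same, mul_zero, Complex.exp_zero, one_mul] at h1
  rw [← h1, ← mul_assoc, ← Complex.exp_add, neg_mul, neg_add_cancel, Complex.exp_zero, one_mul]

variable {n : ℕ} [NeZero n] {M : Type*} [TopologicalSpace M]
  [ChartedSpace (EuclideanHalfSpace n) M] [IsManifold (𝓡∂ n) ∞ M]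

lemma FirstOrderOperator.apply_eq_zero_iff (P : FirstOrderOperator n M) (u : M → ℂ) (x : M) :
    P.apply u x = 0 ↔ lieDeriv P.L u x = -Complex.I * P.V x * u x := by
  unfold FirstOrderOperator.apply
  rw [one_div, Complex.inv_I]
  constructor
  · intro h
    linear_combination Complex.I * h + lieDeriv P.L u x * Complex.I_mul_I
  · intro h
    rw [h]
    linear_combination (P.V x * u x) * Complex.I_mul_I

variable [T2Space M] [CompactSpace M]

/-- The boundary values of solutions of `P₁ u = 0` are boundary values of solutions of `P₂ u = 0`:
the solution is obtained by transporting the incoming boundary values along the integral curves of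
`L₂`, and the hypotheses say that it attains the same outgoing boundary values. -/
theorem smoothCauchyData_subset (P₁ P₂ : FirstOrderOperator n M)
    (hP₁ : P₁.IsRealPrincipalType) (hP₂ : P₂.IsRealPrincipalType)
    (hconv₁ : IsStrictlyConvex P₁.L) (hconv₂ : IsStrictlyConvex P₂.L)
    (hin : initialPoints P₁.L = initialPoints P₂.L)
    (hα : scatteringRelation P₁.symbol = scatteringRelation P₂.symbol)
    (hexp : ∀ (T₁ T₂ : ℝ) (x₁ x₂ : ℝ → M),
      IsMaximalIntegralCurve P₁.L x₁ T₁ → IsMaximalIntegralCurve P₂.L x₂ T₂ → x₁ 0 = x₂ 0 →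
      Complex.exp (-Complex.I * ∫ t in (0 : ℝ)..T₁, P₁.V (x₁ t)) =
        Complex.exp (-Complex.I * ∫ t in (0 : ℝ)..T₂, P₂.V (x₂ t))) :
    P₁.smoothCauchyData ⊆ P₂.smoothCauchyData := by
  rintro g ⟨f, hf, hPf, hg⟩
  have hL₁ := P₁.smooth_L
  have hL₂ := P₂.smooth_L
  have hne₁ : ∀ x, P₁.L x ≠ 0 := IsNontrapping.field_ne_zero hL₁ hP₁
  have hne₂ : ∀ x, P₂.L x ≠ 0 := IsNontrapping.field_ne_zero hL₂ hP₂
  have hn : n = 1 ∨ 2 ≤ n := by have := NeZero.ne n; omega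
  have hbdd : ∀ x ∈ (𝓡∂ n).boundary M, BddAbove (backwardTimes P₂.L x) := by
    intro x hx
    rcases hn with hn | hn
    · exact bddAbove_backwardTimes_of_mem_boundary hL₂ hn hconv₂ hne₂ hx
    · exact IsNontrapping.bddAbove_backwardTimes hL₂ hP₂ hn x
  have hend : ∀ {x₁ x₂ : ℝ → M} {T₁ T₂ : ℝ}, IsMaximalIntegralCurve P₁.L x₁ T₁ →
      IsMaximalIntegralCurve P₂.L x₂ T₂ → x₁ 0 = x₂ 0 → 0 < T₂ → x₁ T₁ = x₂ T₂ := by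
    intro x₁ x₂ T₁ T₂ h₁ h₂ h0 hT₂
    rcases hn with hn | hn
    · exact h₁.apply_end_eq_of_dim_one hL₁ hL₂ hn hconv₁ hconv₂ hne₁ h₂ h0 hT₂
    · exact h₁.apply_end_eq hL₁ hL₂ hn hα h₂ h0
  have hu : IsBoundarySolution P₂.L P₂.V f (transport P₂.L P₂.V f) := by
    refine ⟨fun s t τ η hη hτ => hasDerivWithinAt_transport hL₂ P₂.smooth_V.continuous hη hτ,
      fun x hx => ?_, fun x hx => ?_⟩
    · obtain ⟨T, γ, h⟩ := exists_isEntryCurve hL₂ (hbdd x hx)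
      rw [h.transport_eq hL₂]
      rcases h.nonneg.eq_or_lt with h0 | hT
      · subst h0
        simp [h.apply_zero]
      have hmax := h.isMaximalIntegralCurve hL₂ hconv₂ hx hT
      have hstart : γ (-T) ∈ initialPoints P₁.L := by
        rw [hin]
        exact ⟨T, _, hmax, by simp⟩
      obtain ⟨T₁, x₁, hx₁, hx₁0⟩ := hstart
      have h0 : x₁ 0 = γ (0 + -T) := by rw [hx₁0, zero_add]
      have hT₁ := hend hx₁ hmax h0 hT
      simp only [add_neg_cancel, h.apply_zero] at hT₁
      have he := hexp T₁ T x₁ _ hx₁ hmax h0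
      rw [intervalIntegral.integral_comp_add_right (fun t => P₂.V (γ t)), zero_add,
        add_neg_cancel] at he
      have hode := eq_exp_integral_mul (y := fun t => f (x₁ t))
        (v := fun t => P₁.V (x₁ t)) hx₁.1
        (P₁.smooth_V.continuous.comp_continuousOn hx₁.curve.continuousOn) fun t ht => by
          rw [← (P₁.apply_eq_zero_iff f (x₁ t)).1 (hPf _)]
          exact hasDerivWithinAt_comp_curve hx₁.curve ht ((hf _).mdifferentiableAt (by simp))
      rw [← he, ← hT₁, hode, hx₁0]
    · have hn1 : n = 1 := hn.resolve_right fun h2 =>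
        hx (IsNontrapping.bddAbove_backwardTimes hL₂ hP₂ h2 x)
      filter_upwards [eventually_not_bddAbove_backwardTimes hL₂ hn1 (hne₂ x) hx] with y hy
        using transport_eq_zero hy
  refine ⟨fun x => transport P₂.L P₂.V f x - f x + f x,
    (hu.contMDiff hf P₂.smooth_V hL₂ hconv₂).add hf, fun x => ?_, fun x => ?_⟩
  · rw [P₂.apply_eq_zero_iff, hu.lieDeriv_eq hf P₂.smooth_V hL₂ hconv₂, sub_add_cancel]
  · simp only [hu.boundary x x.2, sub_self, zero_add, hg x]

end CauchyData

end RealPrincipalType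

theorem theorem9 {n : ℕ} [NeZero n]
    {M : Type*} [TopologicalSpace M] [T2Space M] [CompactSpace M]
    [ChartedSpace (EuclideanHalfSpace n) M] [IsManifold (𝓡∂ n) ∞ M]
    (P₁ P₂ : RealPrincipalType.FirstOrderOperator n M)
    (hP₁ : P₁.IsRealPrincipalType) (hP₂ : P₂.IsRealPrincipalType)
    (hconv₁ : RealPrincipalType.IsStrictlyConvex P₁.L)
    (hconv₂ : RealPrincipalType.IsStrictlyConvex P₂.L)
    (hin : RealPrincipalType.initialPoints P₁.L = RealPrincipalType.initialPoints P₂.L)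
    (hα : RealPrincipalType.scatteringRelation P₁.symbol =
      RealPrincipalType.scatteringRelation P₂.symbol)
    (hexp : ∀ (T₁ T₂ : ℝ) (x₁ x₂ : ℝ → M),
      RealPrincipalType.IsMaximalIntegralCurve P₁.L x₁ T₁ →
      RealPrincipalType.IsMaximalIntegralCurve P₂.L x₂ T₂ →
      x₁ 0 = x₂ 0 →
      Complex.exp (-Complex.I * ∫ t in (0 : ℝ)..T₁, P₁.V (x₁ t)) =
        Complex.exp (-Complex.I * ∫ t in (0 : ℝ)..T₂, P₂.V (x₂ t))) :
    P₁.smoothCauchyData = P₂.smoothCauchyData :=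
  Subset.antisymm
    (RealPrincipalType.smoothCauchyData_subset P₁ P₂ hP₁ hP₂ hconv₁ hconv₂ hin hα hexp)
    (RealPrincipalType.smoothCauchyData_subset P₂ P₁ hP₂ hP₁ hconv₂ hconv₁ hin.symm hα.symm
      fun T₂ T₁ x₂ x₁ h₂ h₁ h0 => (hexp T₁ T₂ x₁ x₂ h₁ h₂ h0.symm).symm)
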